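/- Let $m,\hbar>0$ and let $V:\mathbb R\to\mathbb R$ be a measurable, locally square-integrable potential such that the Hamiltonian $$H=\frac{\hat p^2}{2m}+V(\hat x)=-\frac{\hbar^2}{2m}\frac{d^2}{dx^2}+V(x)$$ is essentially self-adjoint in $L^2(\mathbb R)$ on the domain $C_c^\infty(\mathbb R)$. Fix $t_i\in\mathbb R$. For $t_f>t_i$ the propagator $K(x_f,t_f;x_i,t_i)$ is defined by the path integral $$K(x_f,t_f;x_i,t_i)=\lim_{N\to\infty}\Big(\frac{mN}{2i\pi\hbar(t_f-t_i)}\Big)^{N/2}\int dx_1\cdots dx_{N-1}\,\exp\Big[\frac{i\epsilon}{\hbar}\sum_{j=0}^{N-1}\Big(\frac m2\Big(\frac{x_{j+1}-x_j}{\epsilon}\Big)^2-V(x_j)\Big)\Big],$$ with $\epsilon=(t_f-t_i)/N$, $x_0=x_i$, $x_N=x_f$, the principal branch of the power, and $\int dx_1\cdots dx_{N-1}=\lim_{R\to\infty}\int_{[-R,R]^{N-1}}dx_1\cdots dx_{N-1}$. Both limits and $K$ are understood in the sense of generalized functions of $(x_f,x_i)$: one first integrates against a function $\Phi(x_f,x_i)$,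 then lets $R\to\infty$ for each $N$, then $N\to\infty$; the resulting value is written $\langle K_{t_f},\Phi\rangle=\iint K(x_f,t_f;x_i,t_i)\,\Phi(x_f,x_i)\,dx_f\,dx_i$. (1) For all $t_f>t_i$ and $\Phi\in C_c^\infty(\mathbb R^2;\mathbb C)$ the limits defining $\langle K_{t_f},\Phi\rangle$ and $\langle K_{t_f},H_{x_f}\Phi\rangle$ exist ($H_{x_f}$ denotes $H$ acting in the variable $x_f$), $t_f\mapsto\langle K_{t_f},\Phi\rangle$ is differentiable, and $$\Big(i\hbar\frac{\partial}{\partial t_f}-H\Big)K(x_f,t_f;x_i,t_i)=0,\qquad\text{i.e.}\qquad i\hbar\frac{d}{dt_f}\langle K_{t_f},\Phi\rangle-\langle K_{t_f},H_{x_f}\Phi\rangle=0 .$$ Moreover, if on an open set $U$ of points $(t_f,x_f,x_i)$ with $t_f>t_i$ the propagator is given by a $C^2$ function, then this function satisfies the equation pointwise at every point of $U$ at whose $x_f$ the potential $V$ is continuous. (2) Let $f\in L^2(\mathbb R)$. The wavefunction $\psi(x,t)=\int K(x,t;x_i,t_i)f(x_i)\,dx_i$, $t>t_i$, exists as a family of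 elements $\psi(\cdot,t)\in L^2(\mathbb R)$, in the sense that for every $\varphi\in C_c^\infty(\mathbb R;\mathbb C)$ $$\int\varphi(x)\psi(x,t)\,dx=\lim_{R\to\infty}\big\langle K_t,\ \varphi(x_f)\,1_{[-R,R]}(x_i)f(x_i)\big\rangle,$$ where the limits defining the right-hand side exist. It satisfies the Schrödinger equation $\big(i\hbar\frac{\partial}{\partial t}-H\big)\psi(x,t)=0$: for all $t>t_i$ and $\varphi\in C_c^\infty(\mathbb R;\mathbb C)$, $t\mapsto\int\varphi(x)\,\psi(x,t)\,dx$ is differentiable and $$i\hbar\frac{d}{dt}\int\varphi(x)\,\psi(x,t)\,dx-\int (H\varphi)(x)\,\psi(x,t)\,dx=0 .$$ If a representative of $\psi$ is $C^2$ on an open set of points $(t,x)$ with $t>t_i$, it satisfies the equation pointwise there wherever $V$ is continuous at $x$. -/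

import Mathlib

open Complex Filter Topology MeasureTheory Set
open scoped ContDiff ENNReal

namespace PathIntegral

/-- Complex-valued test functions: smooth with compact support. -/
def IsTestFunction {E : Type*} [NormedAddCommGroup E] [NormedSpace ℝ E] (φ : E → ℂ) : Prop :=
  ContDiff ℝ ∞ φ ∧ HasCompactSupport φ

/-- The differential expression `H φ = p̂² φ / (2m) + V φ = -(ħ² / 2m) φ'' + V φ`. -/
noncomputable def hamiltonian (m ħ : ℝ) (V : ℝ → ℝ) (φ : ℝ → ℂ) (x : ℝ) : ℂ :=
  -((ħ : ℂ) ^ 2 / (2 * m)) * iteratedDeriv 2 φ x + (V x : ℂ) * φ x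

/-- `H` acting on the first (final-position) variable of `Φ (x_f, x_i)`. -/
noncomputable def hamiltonianFst (m ħ : ℝ) (V : ℝ → ℝ) (Φ : ℝ × ℝ → ℂ) (p : ℝ × ℝ) : ℂ :=
  hamiltonian m ħ V (fun x => Φ (x, p.2)) p.1

theorem hamiltonian_add (m ħ : ℝ) (V : ℝ → ℝ) {φ χ : ℝ → ℂ} (hφ : IsTestFunction φ)
    (hχ : IsTestFunction χ) :
    hamiltonian m ħ V (φ + χ) = hamiltonian m ħ V φ + hamiltonian m ħ V χ := by
  funext x
  have h1 : ContDiffAt ℝ (2 : ℕ) φ x := (contDiff_infty.1 hφ.1 2).contDiffAt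
  have h2 : ContDiffAt ℝ (2 : ℕ) χ x := (contDiff_infty.1 hχ.1 2).contDiffAt
  simp only [hamiltonian, Pi.add_apply, iteratedDeriv_add h1 h2]
  ring

theorem hamiltonian_smul (m ħ : ℝ) (V : ℝ → ℝ) (c : ℂ) {φ : ℝ → ℂ} (hφ : IsTestFunction φ) :
    hamiltonian m ħ V (c • φ) = c • hamiltonian m ħ V φ := by
  funext x
  have h1 : ContDiffAt ℝ (2 : ℕ) φ x := (contDiff_infty.1 hφ.1 2).contDiffAt
  have h2 : iteratedDeriv 2 (c • φ) x = c • iteratedDeriv 2 φ x :=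
    iteratedDeriv_const_smul h1 c
  simp only [hamiltonian, Pi.smul_apply, h2, smul_eq_mul]
  ring

/-- The graph in `L²(ℝ) × L²(ℝ)` of `φ ↦ H φ` on test functions `φ`. -/
noncomputable def hamiltonianGraph (m ħ : ℝ) (V : ℝ → ℝ) :
    Submodule ℂ (Lp ℂ 2 (volume : Measure ℝ) × Lp ℂ 2 (volume : Measure ℝ)) where
  carrier := {p | ∃ φ : ℝ → ℂ, IsTestFunction φ ∧ p.1 =ᵐ[volume] φ ∧
    p.2 =ᵐ[volume] hamiltonian m ħ V φ}
  add_mem' := by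
    rintro p q ⟨φ, hφ, h1, h2⟩ ⟨χ, hχ, h3, h4⟩
    refine ⟨φ + χ, ⟨hφ.1.add hχ.1, hφ.2.add hχ.2⟩, ?_, ?_⟩
    · exact (Lp.coeFn_add p.1 q.1).trans (h1.add h3)
    · rw [hamiltonian_add m ħ V hφ hχ]
      exact (Lp.coeFn_add p.2 q.2).trans (h2.add h4)
  zero_mem' := by
    refine ⟨0, ⟨contDiff_const, HasCompactSupport.zero⟩, Lp.coeFn_zero _ _ _, ?_⟩
    have h0 : hamiltonian m ħ V 0 = 0 := by
      have h := hamiltonian_smul m ħ V 0 (φ := 0) ⟨contDiff_const, HasCompactSupport.zero⟩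
      simpa using h
    rw [h0]
    exact Lp.coeFn_zero _ _ _
  smul_mem' := by
    rintro c p ⟨φ, hφ, h1, h2⟩
    refine ⟨c • φ, ⟨hφ.1.const_smul c, hφ.2.mono fun x hx => ?_⟩, ?_, ?_⟩
    · intro h; exact hx (by simp [h])
    · exact (Lp.coeFn_smul c p.1).trans (h1.const_smul c)
    · rw [hamiltonian_smul m ħ V c hφ]
      exact (Lp.coeFn_smul c p.2).trans (h2.const_smul c)

/-- The graph is the graph of a function, so that `hamiltonianOp` below is what it should be. -/
theorem hamiltonianGraph_functional (m ħ : ℝ) (V : ℝ → ℝ)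
    (p : Lp ℂ 2 (volume : Measure ℝ) × Lp ℂ 2 (volume : Measure ℝ))
    (hp : p ∈ hamiltonianGraph m ħ V) (h0 : p.1 = 0) : p.2 = 0 := by
  obtain ⟨φ, hφ, h1, h2⟩ := hp
  have h3 : φ =ᵐ[volume] (0 : ℝ → ℂ) := by
    rw [h0] at h1
    exact h1.symm.trans (Lp.coeFn_zero _ _ _)
  have h4 : φ = 0 := (hφ.1.continuous.ae_eq_iff_eq volume continuous_const).1 h3
  have h5 : hamiltonian m ħ V φ = 0 := by
    have h := hamiltonian_smul m ħ V 0 (φ := 0) ⟨contDiff_const, HasCompactSupport.zero⟩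
    rw [h4]
    simpa using h
  rw [h5] at h2
  exact Lp.ext (h2.trans (Lp.coeFn_zero _ _ _).symm)

/-- The Hamiltonian as an unbounded operator in `L²(ℝ)` with domain the test functions. -/
noncomputable def hamiltonianOp (m ħ : ℝ) (V : ℝ → ℝ) :
    Lp ℂ 2 (volume : Measure ℝ) →ₗ.[ℂ] Lp ℂ 2 (volume : Measure ℝ) :=
  (hamiltonianGraph m ħ V).toLinearPMap

/-- An unbounded operator is essentially self-adjoint if its closure is self-adjoint. -/
def IsEssentiallySelfAdjoint {E : Type*} [NormedAddCommGroup E] [InnerProductSpace ℂ E]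
    [CompleteSpace E] (A : E →ₗ.[ℂ] E) : Prop :=
  IsSelfAdjoint A.closure

/-- The path `x₀ = x_i, x₁, …, x_n, x_{n+1} = x_f` with interior points `q`. -/
def slicedPath {n : ℕ} (xf xi : ℝ) (q : Fin n → ℝ) : Fin (n + 2) → ℝ :=
  Fin.cons (α := fun _ => ℝ) xi (Fin.snoc (α := fun _ => ℝ) q xf)

/-- The action `ε ∑_{j=0}^{n} ((m/2) ((x_{j+1} - x_j)/ε)² - V(x_j))` of a sliced path. -/
noncomputable def slicedAction (m : ℝ) (V : ℝ → ℝ) (ε : ℝ) {n : ℕ} (x : Fin (n + 2) → ℝ) : ℝ :=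
  ε * ∑ j : Fin (n + 1), (m / 2 * ((x j.succ - x j.castSucc) / ε) ^ 2 - V (x j.castSucc))

/-- The kernel with `N = n + 1` time slices of length `ε = (t_f - t_i)/N`, normalizing factor
`(m N / (2 i π ħ (t_f - t_i)))^{N/2}` included, each of the `N - 1 = n` intermediate positions
being integrated over `[-R, R]`. -/
noncomputable def slicedKernel (m ħ : ℝ) (V : ℝ → ℝ) (ti tf : ℝ) (n : ℕ) (R xf xi : ℝ) : ℂ :=
  ((m : ℂ) * (n + 1) / (2 * I * Real.pi * ħ * (tf - ti))) ^ (((n : ℂ) + 1) / 2) *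
    ∫ q in {q : Fin n → ℝ | ∀ j, |q j| ≤ R},
      cexp (I / ħ * (slicedAction m V ((tf - ti) / (n + 1)) (slicedPath xf xi q) : ℝ))

/-- The sliced kernel integrated against `Φ (x_f, x_i)`. -/
noncomputable def slicedPairing (m ħ : ℝ) (V : ℝ → ℝ) (ti tf : ℝ) (n : ℕ) (R : ℝ)
    (Φ : ℝ × ℝ → ℂ) : ℂ :=
  ∫ p : ℝ × ℝ, slicedKernel m ħ V ti tf n R p.1 p.2 * Φ p

/-- The path integral, integrated against `Φ (x_f, x_i)`, converges to `c`: for each number of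
slices the integrals over the intermediate positions converge as improper integrals
(`R → ∞`), and their values converge to `c` as the number of slices tends to infinity. -/
def HasPathIntegral (m ħ : ℝ) (V : ℝ → ℝ) (ti tf : ℝ) (Φ : ℝ × ℝ → ℂ) (c : ℂ) : Prop :=
  ∃ a : ℕ → ℂ,
    (∀ n, Tendsto (fun R : ℝ => slicedPairing m ħ V ti tf n R Φ) atTop (𝓝 (a n))) ∧
      Tendsto a atTop (𝓝 c)

/-- The propagator `K(·, t_f; ·, t_i)` as a generalized function of `(x_f, x_i)`: its value
`∫∫ K(x_f, t_f; x_i, t_i) Φ(x_f, x_i) dx_f dx_i` on `Φ` is the path integral. -/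
noncomputable def propagator (m ħ : ℝ) (V : ℝ → ℝ) (ti tf : ℝ) (Φ : ℝ × ℝ → ℂ) : ℂ :=
  limUnder atTop fun n : ℕ => limUnder atTop fun R : ℝ => slicedPairing m ħ V ti tf n R Φ

/-- `ψ(·, t) = ∫ K(·, t; x_i, t_i) f(x_i) dx_i` for all `t > t_i`, as elements of `L²(ℝ)`: against
every test function `φ`, `∫ φ ψ(·, t)` is the improper integral over `x_i` of
`φ(x) K(x, t; x_i, t_i) f(x_i)`. The argument order is `ψ t x`. -/
def IsWavefunction (m ħ : ℝ) (V : ℝ → ℝ) (ti : ℝ) (f : ℝ → ℂ) (ψ : ℝ → ℝ → ℂ) : Prop :=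
  ∀ t, ti < t → MemLp (ψ t) 2 volume ∧
    ∀ φ : ℝ → ℂ, IsTestFunction φ → ∃ c : ℝ → ℂ,
      (∀ R : ℝ, HasPathIntegral m ħ V ti t
        (fun p => φ p.1 * (Icc (-R) R).indicator f p.2) (c R)) ∧
      Tendsto c atTop (𝓝 (∫ x, φ x * ψ t x))

end PathIntegral

/-!
The theorem is a weak form of the Trotter product formula. One time slice of length `ε`, with its
normalizing factor, is the contraction `sliceOp = freeProp ∘ e^{-iεV/ħ}` of `L²(ℝ)`, where
`freeProp` is multiplication of the Fourier transform by a quadratic phase (its Gaussian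
kernel is `coeFn_freeProp_toLp`). With the intermediate positions restricted to `[-R, R]`, the
sliced kernel is therefore the kernel of the product of `n + 1` slices with cutoffs in between
(`slicedPairing_mul`), and the limit `R → ∞` exists because the cutoffs converge strongly to the
identity (`tendsto_sliceVec`).

For the limit of infinitely many slices the self-adjoint closure of `H` is not exponentiated.
Instead, by weak compactness of balls, the powers `sliceOp ε ^ ⌊s / ε⌋` have weak limits along
ultrafilters, and a discrete Taylor expansion tested on `φ ∈ C_c^∞` shows that every such limit `w`
is a weak solution, `d/ds ⟪φ, w s⟫ = ⟪(i/ħ) H φ, w s⟫`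
(`IsProductFormula.exists_isWeakSolution`). The Laplace transform of the difference of two weak
solutions is orthogonal to the range of `1 - 2πiξ - (i/ħ) H`, which is dense since an essentially
self-adjoint operator has trivial deficiency spaces; so weak solutions are unique
(`IsWeakSolution.unique`), all ultrafilters give the same limit, and the products converge
weakly to contractions `U s` (`IsProductFormula.exists_propagator`, `exists_isEvolution`). No
smoothness of the potential enters: only `V φ ∈ L²` for test functions `φ`, which is local
square-integrability.

On products `φ(x_f) f(x_i)` the path integral thus equals `⟪φ̄, U(t_f - t_i) f⟫`, and the
Schrödinger equation is the weak equation satisfied by `U`. A test function `Φ` of two variables is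
a superposition `Φ(x, y) = ∫ ∂₂Φ(x, b) 1_{[b, M]}(y) db` of products, and all limits pass through
the integral over `b` by dominated convergence (`IsEvolution.hasPathIntegral_superposition`,
`IsEvolution.propagator_equation`). The wavefunction is `U(t - t_i) f`. Finally, for functions that
are twice continuously differentiable, integration by parts and testing with bump functions turn
the weak equation into the pointwise one (`classical_of_weak`).
-/

namespace PathIntegral

/-! ### Weak solutions of evolution equations -/

section WeakSolutions

open scoped InnerProductSpace

variable {E : Type*} [NormedAddCommGroup E] [InnerProductSpace ℂ E]

/-- A weak solution on `[0, ∞)` with initial value `u` of the evolution equation dual to the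
(unbounded) operator with graph `S`: for every pair `(φ, χ) ∈ S` one has
`d/ds ⟪φ, w s⟫ = ⟪χ, w s⟫`. Values of `w` at negative times are irrelevant. -/
structure IsWeakSolution (S : Set (E × E)) (u : E) (w : ℝ → E) : Prop where
  norm_le : ∀ s, 0 ≤ s → ‖w s‖ ≤ ‖u‖
  initial : w 0 = u
  hasDeriv : ∀ p ∈ S, ∀ s, 0 ≤ s →
    HasDerivWithinAt (fun r => ⟪p.1, w r⟫_ℂ) ⟪p.2, w s⟫_ℂ (Ici 0) s

/-! ### Orbits of a contraction -/

section Orbit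

variable {T : E →L[ℂ] E}

theorem norm_pow_apply_le (hT : ‖T‖ ≤ 1) (k : ℕ) (u : E) : ‖(T ^ k) u‖ ≤ ‖u‖ := by
  induction k with
  | zero => simp
  | succ k ih =>
    rw [pow_succ', mul_apply_eq_comp]
    exact (T.le_of_opNorm_le hT _).trans (by simpa using ih)

variable [CompleteSpace E]

theorem inner_pow_succ_sub (φ u : E) {ε : ℝ} (hε : 0 < ε) (k : ℕ) :
    ⟪φ, (T ^ (k + 1)) u⟫_ℂ - ⟪φ, (T ^ k) u⟫_ℂ =
      ε * ⟪ε⁻¹ • (T.adjoint φ - φ), (T ^ k) u⟫_ℂ := by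
  have h : (ε : ℂ) ≠ 0 := by exact_mod_cast hε.ne'
  rw [pow_succ', mul_apply_eq_comp, ← ContinuousLinearMap.adjoint_inner_left,
    ← inner_sub_left, ← Complex.coe_smul, inner_smul_left]
  simp [h]

/-- Orbits are weakly Lipschitz against `φ`, with the difference quotient of `φ` as constant. -/
theorem norm_inner_pow_add_sub_le (hT : ‖T‖ ≤ 1) (φ u : E) {ε : ℝ} (hε : 0 < ε) (k j : ℕ) :
    ‖⟪φ, (T ^ (k + j)) u⟫_ℂ - ⟪φ, (T ^ k) u⟫_ℂ‖ ≤
      j * ε * (‖ε⁻¹ • (T.adjoint φ - φ)‖ * ‖u‖) := by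
  induction j with
  | zero => simp
  | succ j ih =>
    have h1 : ‖⟪φ, (T ^ (k + j + 1)) u⟫_ℂ - ⟪φ, (T ^ (k + j)) u⟫_ℂ‖ ≤
        ε * (‖ε⁻¹ • (T.adjoint φ - φ)‖ * ‖u‖) := by
      rw [inner_pow_succ_sub φ u hε, norm_mul, Complex.norm_real, Real.norm_of_nonneg hε.le]
      gcongr
      exact (norm_inner_le_norm _ _).trans (by gcongr; exact norm_pow_apply_le hT _ _)
    have h2 := norm_add_le (⟪φ, (T ^ (k + j + 1)) u⟫_ℂ - ⟪φ, (T ^ (k + j)) u⟫_ℂ)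
      (⟪φ, (T ^ (k + j)) u⟫_ℂ - ⟪φ, (T ^ k) u⟫_ℂ)
    rw [sub_add_sub_cancel] at h2
    rw [← add_assoc, Nat.cast_succ]
    linarith

/-- Variant of `norm_inner_pow_add_sub_le` for a vector `χ` at which the difference quotient is
not controlled: `χ` is replaced by a nearby `φ`. -/
theorem norm_inner_pow_add_sub_le_of_approx (hT : ‖T‖ ≤ 1) (χ φ u : E) {ε : ℝ} (hε : 0 < ε)
    (k j : ℕ) :
    ‖⟪χ, (T ^ (k + j)) u⟫_ℂ - ⟪χ, (T ^ k) u⟫_ℂ‖ ≤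
      2 * (‖χ - φ‖ * ‖u‖) + j * ε * (‖ε⁻¹ • (T.adjoint φ - φ)‖ * ‖u‖) := by
  have h1 := norm_inner_pow_add_sub_le hT φ u hε k j
  have h2 : ∀ l, ‖⟪χ - φ, (T ^ l) u⟫_ℂ‖ ≤ ‖χ - φ‖ * ‖u‖ := fun l =>
    (norm_inner_le_norm _ _).trans (by gcongr; exact norm_pow_apply_le hT _ _)
  have h3 : ⟪χ, (T ^ (k + j)) u⟫_ℂ - ⟪χ, (T ^ k) u⟫_ℂ =
      (⟪χ - φ, (T ^ (k + j)) u⟫_ℂ - ⟪χ - φ, (T ^ k) u⟫_ℂ) +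
        (⟪φ, (T ^ (k + j)) u⟫_ℂ - ⟪φ, (T ^ k) u⟫_ℂ) := by
    simp only [inner_sub_left]; ring
  rw [h3]
  refine (norm_add_le _ _).trans (add_le_add ((norm_sub_le _ _).trans ?_) h1)
  linarith [h2 (k + j), h2 k]

/-- First-order expansion of an orbit of the contraction `T`, the discrete form of the
differentiability of its limits: `χ` stands for the limit of `ε⁻¹ (T† φ - φ)`, and `φ'` for a
vector close to `χ` with controlled difference quotient. -/
theorem norm_inner_pow_add_sub_sub_le (hT : ‖T‖ ≤ 1) (φ χ φ' u : E) {ε : ℝ} (hε : 0 < ε)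
    (k l : ℕ) :
    ‖⟪φ, (T ^ (k + l)) u⟫_ℂ - ⟪φ, (T ^ k) u⟫_ℂ - l * ε * ⟪χ, (T ^ k) u⟫_ℂ‖ ≤
      l * ε * ((‖ε⁻¹ • (T.adjoint φ - φ) - χ‖ * ‖u‖) +
        (2 * (‖χ - φ'‖ * ‖u‖) + l * ε * (‖ε⁻¹ • (T.adjoint φ' - φ')‖ * ‖u‖))) := by
  set D := ‖ε⁻¹ • (T.adjoint φ' - φ')‖ * ‖u‖
  set A := ‖ε⁻¹ • (T.adjoint φ - φ) - χ‖ * ‖u‖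
  set B := ‖χ - φ'‖ * ‖u‖
  have hD : 0 ≤ D := by positivity
  suffices H : ∀ j ≤ l,
      ‖⟪φ, (T ^ (k + j)) u⟫_ℂ - ⟪φ, (T ^ k) u⟫_ℂ - j * ε * ⟪χ, (T ^ k) u⟫_ℂ‖ ≤
        j * ε * (A + (2 * B + l * ε * D)) from H l le_rfl
  intro j hj
  induction j with
  | zero => simp
  | succ j ih =>
    have ih := ih (by omega)
    have h1 := inner_pow_succ_sub (T := T) φ u hε (k + j)
    have h2 : ‖⟪ε⁻¹ • (T.adjoint φ - φ) - χ, (T ^ (k + j)) u⟫_ℂ‖ ≤ A :=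
      (norm_inner_le_norm _ _).trans
        (mul_le_mul_of_nonneg_left (norm_pow_apply_le hT _ _) (norm_nonneg _))
    have h3 := norm_inner_pow_add_sub_le_of_approx hT χ φ' u hε k j
    have h3' : ‖⟪χ, (T ^ (k + j)) u⟫_ℂ - ⟪χ, (T ^ k) u⟫_ℂ‖ ≤ 2 * B + l * ε * D := by
      refine h3.trans ?_
      have : (j : ℝ) ≤ l := by exact_mod_cast (by omega : j ≤ l)
      gcongr
    have h4 : ⟪φ, (T ^ (k + j + 1)) u⟫_ℂ - ⟪φ, (T ^ k) u⟫_ℂ -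
        ((j + 1 : ℕ) : ℂ) * ε * ⟪χ, (T ^ k) u⟫_ℂ =
        (⟪φ, (T ^ (k + j)) u⟫_ℂ - ⟪φ, (T ^ k) u⟫_ℂ - j * ε * ⟪χ, (T ^ k) u⟫_ℂ) +
        ε * (⟪ε⁻¹ • (T.adjoint φ - φ) - χ, (T ^ (k + j)) u⟫_ℂ +
          (⟪χ, (T ^ (k + j)) u⟫_ℂ - ⟪χ, (T ^ k) u⟫_ℂ)) := by
      rw [inner_sub_left]
      rw [Nat.cast_succ]
      linear_combination h1
    rw [← add_assoc, h4]
    refine (norm_add_le _ _).trans ?_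
    rw [norm_mul, Complex.norm_real, Real.norm_of_nonneg hε.le]
    have h5 := (norm_add_le _ _).trans (add_le_add h2 h3')
    have h6 := mul_le_mul_of_nonneg_left h5 hε.le
    rw [Nat.cast_succ]
    linarith

end Orbit

/-! ### Existence of weak solutions along ultrafilters -/

/-- Weak compactness of balls in a Hilbert space, for limits along an ultrafilter. -/
theorem exists_weak_limit [CompleteSpace E] {ι : Type*} (𝒰 : Ultrafilter ι) (v : ι → E) (C : ℝ)
    (hv : ∀ᶠ i in 𝒰, ‖v i‖ ≤ C) :
    ∃ w : E, ‖w‖ ≤ C ∧ ∀ φ : E, Tendsto (fun i => ⟪φ, v i⟫_ℂ) 𝒰 (𝓝 ⟪φ, w⟫_ℂ) := by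
  let g : ι → WeakDual ℂ E := fun i =>
    StrongDual.toWeakDual (InnerProductSpace.toDual ℂ E (v i))
  have hK := WeakDual.isCompact_closedBall (𝕜 := ℂ) (E := E) 0 C
  obtain ⟨x, hx, hlim⟩ := hK.ultrafilter_le_nhds (𝒰.map g) (by
    rw [le_principal_iff]
    refine hv.mono fun i hi => ?_
    simpa [g] using hi)
  refine ⟨(InnerProductSpace.toDual ℂ E).symm (WeakDual.toStrongDual x), ?_, fun φ => ?_⟩
  · rw [LinearIsometryEquiv.norm_map]
    simpa using hx
  · have h1 : Tendsto (fun i => g i φ) 𝒰 (𝓝 (x φ)) :=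
      ((WeakDual.eval_continuous φ).tendsto x).comp hlim
    have h2 := (Complex.continuous_conj.tendsto _).comp h1
    refine (h2.congr fun i => ?_).trans_eq ?_
    · simp [g]
    · rw [← inner_conj_symm φ, InnerProductSpace.toDual_symm_apply]
      rfl

theorem tendsto_mul_floor_div {s : ℝ} (hs : 0 ≤ s) :
    Tendsto (fun ε : ℝ => (⌊s / ε⌋₊ : ℝ) * ε) (𝓝[>] 0) (𝓝 s) := by
  have h := (tendsto_nat_floor_mul_div_atTop hs).comp (tendsto_inv_nhdsGT_zero (𝕜 := ℝ))
  refine h.congr fun ε => ?_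
  simp [div_eq_mul_inv]

/-- The hypotheses of the product formula: `F ε`, `ε > 0`, are contractions whose adjoints have
the difference quotients `ε⁻¹ (F(ε)† φ - φ)` convergent to `χ` for all `(φ, χ)` in the graph `S`
of a densely defined operator. -/
structure IsProductFormula [CompleteSpace E] (S : Set (E × E)) (F : ℝ → E →L[ℂ] E) : Prop where
  contraction : ∀ ε, 0 < ε → ‖F ε‖ ≤ 1
  tendsto : ∀ p ∈ S,
    Tendsto (fun ε : ℝ => ε⁻¹ • ((F ε).adjoint p.1 - p.1)) (𝓝[>] 0) (𝓝 p.2)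
  dense : Dense (Prod.fst '' S)

variable [CompleteSpace E] {S : Set (E × E)} {F : ℝ → E →L[ℂ] E}

theorem IsProductFormula.exists_isWeakSolution (hF : IsProductFormula S F) (u : E)
    (𝒰 : Ultrafilter ℝ) (h𝒰 : (𝒰 : Filter ℝ) ≤ 𝓝[>] 0) :
    ∃ w : ℝ → E, IsWeakSolution S u w ∧ ∀ s, 0 ≤ s → ∀ φ : E,
      Tendsto (fun ε : ℝ => ⟪φ, (F ε ^ ⌊s / ε⌋₊) u⟫_ℂ) 𝒰 (𝓝 ⟪φ, w s⟫_ℂ) := by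
  have hpos : ∀ᶠ ε : ℝ in 𝒰, 0 < ε := h𝒰 (eventually_mem_nhdsWithin)
  choose w hwn hw using fun s : ℝ => exists_weak_limit 𝒰 (fun ε => (F ε ^ ⌊s / ε⌋₊) u) ‖u‖
    (hpos.mono fun ε hε => norm_pow_apply_le (hF.contraction ε hε) _ _)
  refine ⟨w, ⟨fun s _ => hwn s, ?_, ?_⟩, fun s _ => hw s⟩
  · refine ext_inner_left ℂ fun φ => tendsto_nhds_unique (hw 0 φ) ?_
    simp
  -- The step count between the times `r ≤ s`.
  have hlen : ∀ r s : ℝ, 0 ≤ r → r ≤ s →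
      Tendsto (fun ε : ℝ => ((⌊s / ε⌋₊ - ⌊r / ε⌋₊ : ℕ) : ℝ) * ε) 𝒰 (𝓝 (s - r)) := by
    intro r s hr hrs
    refine (((tendsto_mul_floor_div (hr.trans hrs)).sub (tendsto_mul_floor_div hr)).mono_left
      h𝒰).congr' (hpos.mono fun ε hε => ?_)
    have h : ⌊r / ε⌋₊ ≤ ⌊s / ε⌋₊ := Nat.floor_le_floor (by gcongr)
    simp only [Nat.cast_sub h]
    ring
  have hsplit : ∀ r s ε : ℝ, r ≤ s → 0 < ε →
      ⌊r / ε⌋₊ + (⌊s / ε⌋₊ - ⌊r / ε⌋₊) = ⌊s / ε⌋₊ := fun r s ε hrs hε =>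
    Nat.add_sub_cancel' (Nat.floor_le_floor (by gcongr))
  have hquot : ∀ p ∈ S, Tendsto (fun ε : ℝ => ‖ε⁻¹ • ((F ε).adjoint p.1 - p.1)‖ * ‖u‖) 𝒰
      (𝓝 (‖p.2‖ * ‖u‖)) := fun p hp => (((hF.tendsto p hp).mono_left h𝒰).norm).mul_const _
  have hA : ∀ χ : E, ∀ p ∈ S, ∀ r s : ℝ, 0 ≤ r → r ≤ s →
      ‖⟪χ, w s⟫_ℂ - ⟪χ, w r⟫_ℂ‖ ≤ 2 * (‖χ - p.1‖ * ‖u‖) + (s - r) * (‖p.2‖ * ‖u‖) := by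
    intro χ p hp r s hr hrs
    refine le_of_tendsto_of_tendsto ((hw s χ).sub (hw r χ)).norm
      (tendsto_const_nhds.add ((hlen r s hr hrs).mul (hquot p hp))) (hpos.mono fun ε hε => ?_)
    have := norm_inner_pow_add_sub_le_of_approx (hF.contraction ε hε) χ p.1 u hε ⌊r / ε⌋₊
      (⌊s / ε⌋₊ - ⌊r / ε⌋₊)
    rwa [hsplit r s ε hrs hε] at this
  have hB : ∀ q ∈ S, ∀ p ∈ S, ∀ r s : ℝ, 0 ≤ r → r ≤ s →
      ‖⟪q.1, w s⟫_ℂ - ⟪q.1, w r⟫_ℂ - ((s - r : ℝ) : ℂ) * ⟪q.2, w r⟫_ℂ‖ ≤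
        (s - r) * (2 * (‖q.2 - p.1‖ * ‖u‖) + (s - r) * (‖p.2‖ * ‖u‖)) := by
    intro q hq p hp r s hr hrs
    have h0 : Tendsto (fun ε : ℝ => ‖ε⁻¹ • ((F ε).adjoint q.1 - q.1) - q.2‖ * ‖u‖) 𝒰 (𝓝 0) := by
      have := ((((hF.tendsto q hq).mono_left h𝒰).sub_const q.2).norm).mul_const ‖u‖
      simpa using this
    have h1 := (hlen r s hr hrs)
    have h2 : Tendsto (fun ε : ℝ => (((⌊s / ε⌋₊ - ⌊r / ε⌋₊ : ℕ) : ℝ) * ε : ℂ)) 𝒰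
        (𝓝 ((s - r : ℝ) : ℂ)) := by
      refine ((Complex.continuous_ofReal.tendsto _).comp h1).congr fun ε => ?_
      simp
    have h3 := h1.mul (h0.add (tendsto_const_nhds (x := 2 * (‖q.2 - p.1‖ * ‖u‖)) |>.add
      (h1.mul (hquot p hp))))
    rw [zero_add] at h3
    refine le_of_tendsto_of_tendsto (((hw s q.1).sub (hw r q.1)).sub (h2.mul (hw r q.2))).norm h3
      (hpos.mono fun ε hε => ?_)
    have := norm_inner_pow_add_sub_sub_le (hF.contraction ε hε) q.1 q.2 p.1 u hε ⌊r / ε⌋₊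
      (⌊s / ε⌋₊ - ⌊r / ε⌋₊)
    rwa [hsplit r s ε hrs hε] at this
  -- The symmetric form of the expansion, with the derivative taken at either end.
  have hC : ∀ q ∈ S, ∀ p ∈ S, ∀ r s : ℝ, 0 ≤ r → 0 ≤ s →
      ‖⟪q.1, w s⟫_ℂ - ⟪q.1, w r⟫_ℂ - ((s - r : ℝ) : ℂ) * ⟪q.2, w r⟫_ℂ‖ ≤
        |s - r| * (4 * (‖q.2 - p.1‖ * ‖u‖) + 2 * |s - r| * (‖p.2‖ * ‖u‖)) := by
    intro q hq p hp r s hr hs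
    have hx : 0 ≤ ‖q.2 - p.1‖ * ‖u‖ := by positivity
    have hy : 0 ≤ ‖p.2‖ * ‖u‖ := by positivity
    rcases le_total r s with h | h
    · refine (hB q hq p hp r s hr h).trans ?_
      rw [abs_of_nonneg (sub_nonneg.2 h)]
      have : 0 ≤ s - r := sub_nonneg.2 h
      gcongr <;> nlinarith
    · have h1 := hB q hq p hp s r hs h
      have h2 := hA q.2 p hp s r hs h
      have h3 : ⟪q.1, w s⟫_ℂ - ⟪q.1, w r⟫_ℂ - ((s - r : ℝ) : ℂ) * ⟪q.2, w r⟫_ℂ =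
          -(⟪q.1, w r⟫_ℂ - ⟪q.1, w s⟫_ℂ - ((r - s : ℝ) : ℂ) * ⟪q.2, w s⟫_ℂ) +
            ((r - s : ℝ) : ℂ) * (⟪q.2, w r⟫_ℂ - ⟪q.2, w s⟫_ℂ) := by
        push_cast; ring
      have h4 : 0 ≤ r - s := sub_nonneg.2 h
      rw [h3, abs_sub_comm, abs_of_nonneg h4]
      refine (norm_add_le _ _).trans ?_
      rw [norm_neg, norm_mul, Complex.norm_real, Real.norm_of_nonneg h4]
      have h5 := mul_le_mul_of_nonneg_left h2 h4
      linarith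
  intro q hq s hs
  rw [hasDerivWithinAt_iff_isLittleO, Asymptotics.isLittleO_iff]
  intro c hc
  obtain ⟨_, hpd, p, hp, rfl⟩ := Metric.dense_iff.1 hF.dense q.2 (c / (8 * (‖u‖ + 1)))
    (by positivity)
  have hu : 0 < ‖u‖ + 1 := by positivity
  have h1 : 4 * (‖q.2 - p.1‖ * ‖u‖) ≤ c / 2 := by
    have h2 : ‖q.2 - p.1‖ ≤ c / (8 * (‖u‖ + 1)) := by
      rw [← dist_eq_norm, dist_comm]; exact (Metric.mem_ball.1 hpd).le
    have h3 : ‖q.2 - p.1‖ * ‖u‖ ≤ c / (8 * (‖u‖ + 1)) * (‖u‖ + 1) := by gcongr; simp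
    have h4 : c / (8 * (‖u‖ + 1)) * (‖u‖ + 1) = c / 8 := by field_simp
    linarith
  have h2 : ∀ᶠ r in 𝓝[Ici 0] s, 2 * |r - s| * (‖p.2‖ * ‖u‖) < c / 2 := by
    have : Tendsto (fun r => 2 * |r - s| * (‖p.2‖ * ‖u‖)) (𝓝 s) (𝓝 (2 * |s - s| * (‖p.2‖ * ‖u‖))) :=
      Continuous.tendsto (by fun_prop) s
    exact (this.mono_left nhdsWithin_le_nhds).eventually_lt_const (by simpa using hc)
  filter_upwards [h2, self_mem_nhdsWithin] with r hr hr0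
  have h3 := hC q hq p hp s r hs hr0
  rw [← Complex.real_smul] at h3
  refine h3.trans ?_
  rw [Real.norm_eq_abs, mul_comm c]
  gcongr
  linarith

end WeakSolutions

/-! ### Uniqueness of weak solutions and the abstract product formula -/

section Uniqueness

open scoped InnerProductSpace FourierTransform

variable {E : Type*} [NormedAddCommGroup E] [InnerProductSpace ℂ E] {S : Set (E × E)}

/-- The difference of two functions on `[0, ∞)`, continued to negative times by its value at
`0`. -/
def differenceFrom (w₁ w₂ : ℝ → E) (s : ℝ) : E := w₁ (max s 0) - w₂ (max s 0)

variable {u : E} {w₁ w₂ : ℝ → E}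

theorem IsWeakSolution.differenceFrom_of_nonpos (h₁ : IsWeakSolution S u w₁)
    (h₂ : IsWeakSolution S u w₂) {s : ℝ} (hs : s ≤ 0) : differenceFrom w₁ w₂ s = 0 := by
  simp [differenceFrom, max_eq_right hs, h₁.initial, h₂.initial]

theorem IsWeakSolution.norm_differenceFrom_le (h₁ : IsWeakSolution S u w₁)
    (h₂ : IsWeakSolution S u w₂) (s : ℝ) : ‖differenceFrom w₁ w₂ s‖ ≤ 2 * ‖u‖ := by
  refine (norm_sub_le _ _).trans ?_
  linarith [h₁.norm_le _ (le_max_right s 0), h₂.norm_le _ (le_max_right s 0)]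

/-- The weak derivative exists at `0` from both sides, as the difference vanishes there. -/
theorem IsWeakSolution.hasDerivAt_differenceFrom (h₁ : IsWeakSolution S u w₁)
    (h₂ : IsWeakSolution S u w₂) {p : E × E} (hp : p ∈ S) (s : ℝ) :
    HasDerivAt (fun r => ⟪p.1, differenceFrom w₁ w₂ r⟫_ℂ) ⟪p.2, differenceFrom w₁ w₂ s⟫_ℂ s := by
  have hright : ∀ s, 0 ≤ s → HasDerivWithinAt (fun r => ⟪p.1, differenceFrom w₁ w₂ r⟫_ℂ)
      ⟪p.2, differenceFrom w₁ w₂ s⟫_ℂ (Ici 0) s := by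
    intro s hs
    have h := (h₁.hasDeriv p hp s hs).sub (h₂.hasDeriv p hp s hs)
    have h3 : ∀ r ∈ Ici (0 : ℝ), differenceFrom w₁ w₂ r = w₁ r - w₂ r := fun r hr => by
      simp [differenceFrom, max_eq_left (mem_Ici.1 hr)]
    rw [h3 s hs, inner_sub_right]
    refine h.congr_of_mem (fun r hr => ?_) hs
    rw [h3 r hr, inner_sub_right]
    rfl
  have hleft : HasDerivWithinAt (fun r => ⟪p.1, differenceFrom w₁ w₂ r⟫_ℂ) 0 (Iic 0) 0 := by
    refine (hasDerivWithinAt_const 0 (Iic 0) (0 : ℂ)).congr_of_mem (fun r hr => ?_)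
      self_mem_Iic
    simp [h₁.differenceFrom_of_nonpos h₂ hr]
  rcases lt_trichotomy s 0 with hs | rfl | hs
  · have h0 := hasDerivAt_const s (0 : ℂ)
    rw [h₁.differenceFrom_of_nonpos h₂ hs.le, inner_zero_right]
    refine h0.congr_of_eventuallyEq ?_
    filter_upwards [eventually_lt_nhds hs] with r hr
    simp [h₁.differenceFrom_of_nonpos h₂ hr.le]
  · have h1 := hright 0 le_rfl
    rw [h₁.differenceFrom_of_nonpos h₂ le_rfl, inner_zero_right] at h1 ⊢
    have := h1.union hleft
    rwa [Ici_union_Iic, hasDerivWithinAt_univ] at this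
  · exact (hright s hs.le).hasDerivAt (Ici_mem_nhds hs)

/-- For vectors outside the domain continuity follows by uniform approximation. -/
theorem IsWeakSolution.continuous_inner_differenceFrom (h₁ : IsWeakSolution S u w₁)
    (h₂ : IsWeakSolution S u w₂) (hd : Dense (Prod.fst '' S)) (φ : E) :
    Continuous fun s => ⟪φ, differenceFrom w₁ w₂ s⟫_ℂ := by
  refine continuous_of_uniform_approx_of_continuous fun V hV => ?_
  obtain ⟨c, hc, hcV⟩ := Metric.mem_uniformity_dist.1 hV
  have hu : 0 < 2 * ‖u‖ + 1 := by positivity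
  obtain ⟨_, hpd, p, hp, rfl⟩ := Metric.dense_iff.1 hd φ (c / (2 * ‖u‖ + 1)) (by positivity)
  refine ⟨fun s => ⟪p.1, differenceFrom w₁ w₂ s⟫_ℂ, continuous_iff_continuousAt.2 fun s =>
    (h₁.hasDerivAt_differenceFrom h₂ hp s).continuousAt, fun s => hcV ?_⟩
  rw [Metric.mem_ball, dist_comm, dist_eq_norm, lt_div_iff₀ hu] at hpd
  rw [dist_eq_norm, ← inner_sub_left]
  refine (norm_inner_le_norm _ _).trans_lt (lt_of_le_of_lt ?_ hpd)
  gcongr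
  linarith [h₁.norm_differenceFrom_le h₂ s]

/-- The function `e^{-s} ⟪φ, w₁ s - w₂ s⟫` on `[0, ∞)`, continued by zero. Its Fourier transform
at `ξ` is the Laplace transform of `⟪φ, w₁ - w₂⟫` at `1 + 2πiξ`. -/
noncomputable def dampedDifference (w₁ w₂ : ℝ → E) (φ : E) (s : ℝ) : ℂ :=
  Real.exp (-s) * ⟪φ, differenceFrom w₁ w₂ s⟫_ℂ

theorem IsWeakSolution.norm_dampedDifference_le (h₁ : IsWeakSolution S u w₁)
    (h₂ : IsWeakSolution S u w₂) (φ : E) (s : ℝ) :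
    ‖dampedDifference w₁ w₂ φ s‖ ≤
      (Ici (0 : ℝ)).indicator (fun s => Real.exp (-s)) s * (‖φ‖ * (2 * ‖u‖)) := by
  by_cases hs : 0 ≤ s
  · rw [indicator_of_mem (mem_Ici.2 hs), dampedDifference, norm_mul, Complex.norm_real,
      Real.norm_of_nonneg (Real.exp_pos _).le]
    gcongr
    exact (norm_inner_le_norm _ _).trans (by gcongr; exact h₁.norm_differenceFrom_le h₂ s)
  · rw [dampedDifference, h₁.differenceFrom_of_nonpos h₂ (not_le.1 hs).le,
      indicator_of_notMem (by simpa using hs)]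
    simp

theorem integrable_indicator_exp_neg :
    Integrable ((Ici (0 : ℝ)).indicator fun s => Real.exp (-s)) := by
  rw [integrable_indicator_iff measurableSet_Ici, integrableOn_Ici_iff_integrableOn_Ioi]
  exact integrableOn_exp_neg_Ioi 0

theorem IsWeakSolution.continuous_dampedDifference (h₁ : IsWeakSolution S u w₁)
    (h₂ : IsWeakSolution S u w₂) (hd : Dense (Prod.fst '' S)) (φ : E) :
    Continuous (dampedDifference w₁ w₂ φ) :=
  (Complex.continuous_ofReal.comp (Real.continuous_exp.comp continuous_neg)).mul
    (h₁.continuous_inner_differenceFrom h₂ hd φ)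

theorem IsWeakSolution.integrable_dampedDifference (h₁ : IsWeakSolution S u w₁)
    (h₂ : IsWeakSolution S u w₂) (hd : Dense (Prod.fst '' S)) (φ : E) :
    Integrable (dampedDifference w₁ w₂ φ) :=
  (integrable_indicator_exp_neg.mul_const _).mono'
    (h₁.continuous_dampedDifference h₂ hd φ).aestronglyMeasurable
    (Eventually.of_forall fun s => h₁.norm_dampedDifference_le h₂ φ s)

/-- The weak equation after the Laplace transform: no boundary term arises, as the difference of two
solutions vanishes at time `0`. -/
theorem IsWeakSolution.fourier_dampedDifference_eq (h₁ : IsWeakSolution S u w₁)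
    (h₂ : IsWeakSolution S u w₂) (hd : Dense (Prod.fst '' S)) {p : E × E} (hp : p ∈ S) (ξ : ℝ) :
    (1 + 2 * Real.pi * I * ξ) * 𝓕 (dampedDifference w₁ w₂ p.1) ξ =
      𝓕 (dampedDifference w₁ w₂ p.2) ξ := by
  have hder : ∀ s, HasDerivAt (dampedDifference w₁ w₂ p.1)
      (dampedDifference w₁ w₂ p.2 s - dampedDifference w₁ w₂ p.1 s) s := by
    intro s
    have h3 : HasDerivAt (fun s : ℝ => ((Real.exp (-s) : ℝ) : ℂ))
        ((-Real.exp (-s) : ℝ) : ℂ) s := by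
      have := (hasDerivAt_neg s).exp
      simpa using this.ofReal_comp
    refine (h3.mul (h₁.hasDerivAt_differenceFrom h₂ hp s)).congr_deriv ?_
    simp only [dampedDifference]
    push_cast
    ring
  have hi1 := h₁.integrable_dampedDifference h₂ hd p.1
  have hi2 := h₁.integrable_dampedDifference h₂ hd p.2
  have hderiv : deriv (dampedDifference w₁ w₂ p.1) =
      dampedDifference w₁ w₂ p.2 - dampedDifference w₁ w₂ p.1 := funext fun s => (hder s).deriv
  have h3 := congrFun (Real.fourier_deriv hi1 (fun s => (hder s).differentiableAt)
    (by rw [hderiv]; exact hi2.sub hi1)) ξ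
  have h4 : 𝓕 (dampedDifference w₁ w₂ p.2 - dampedDifference w₁ w₂ p.1) ξ =
      𝓕 (dampedDifference w₁ w₂ p.2) ξ - 𝓕 (dampedDifference w₁ w₂ p.1) ξ := by
    simp only [Real.fourier_eq, Pi.sub_apply, smul_sub]
    exact integral_sub ((Real.fourierIntegral_convergent_iff ξ).2 hi2)
      ((Real.fourierIntegral_convergent_iff ξ).2 hi1)
  rw [hderiv, h4, smul_eq_mul] at h3
  linear_combination -h3

/-- Weak solutions are unique if the ranges of `φ ↦ (1 - 2πiξ) φ - χ`, `(φ, χ) ∈ S`, are dense: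
the Laplace transforms of two solutions agree on the line `Re = 1`. -/
theorem IsWeakSolution.unique (h₁ : IsWeakSolution S u w₁) (h₂ : IsWeakSolution S u w₂)
    (hd : Dense (Prod.fst '' S))
    (hrange : ∀ ξ : ℝ, Dense ((fun p : E × E => (1 - 2 * Real.pi * I * ξ) • p.1 - p.2) '' S))
    {s : ℝ} (hs : 0 ≤ s) : w₁ s = w₂ s := by
  have hint := fun φ => h₁.integrable_dampedDifference h₂ hd φ
  have hsub : ∀ φ χ : E, ∀ ξ : ℝ, 𝓕 (dampedDifference w₁ w₂ (φ - χ)) ξ =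
      𝓕 (dampedDifference w₁ w₂ φ) ξ - 𝓕 (dampedDifference w₁ w₂ χ) ξ := by
    intro φ χ ξ
    simp only [Real.fourier_eq]
    rw [← integral_sub ((Real.fourierIntegral_convergent_iff ξ).2 (hint φ))
      ((Real.fourierIntegral_convergent_iff ξ).2 (hint χ))]
    refine integral_congr_ae (Eventually.of_forall fun v => ?_)
    simp only [dampedDifference, inner_sub_left, ← smul_sub, mul_sub]
  have hsmul : ∀ (c : ℂ) (φ : E) (ξ : ℝ), 𝓕 (dampedDifference w₁ w₂ (c • φ)) ξ =
      (starRingEnd ℂ) c * 𝓕 (dampedDifference w₁ w₂ φ) ξ := by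
    intro c φ ξ
    simp only [Real.fourier_eq]
    rw [← integral_const_mul]
    refine integral_congr_ae (Eventually.of_forall fun v => ?_)
    simp only [dampedDifference, inner_smul_left, Circle.smul_def, smul_eq_mul]
    ring
  have hzero : ∀ (ξ : ℝ) (φ : E), 𝓕 (dampedDifference w₁ w₂ φ) ξ = 0 := by
    intro ξ
    set C := (∫ s, (Ici (0 : ℝ)).indicator (fun s => Real.exp (-s)) s) * (2 * ‖u‖) with hC
    have hbound : ∀ φ : E, ‖𝓕 (dampedDifference w₁ w₂ φ) ξ‖ ≤ C * ‖φ‖ := by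
      intro φ
      rw [Real.fourier_eq]
      refine (norm_integral_le_of_norm_le (integrable_indicator_exp_neg.mul_const
        (‖φ‖ * (2 * ‖u‖))) (Eventually.of_forall fun v => ?_)).trans_eq ?_
      · rw [Circle.norm_smul]
        exact h₁.norm_dampedDifference_le h₂ φ v
      · rw [integral_mul_const, hC]; ring
    have hcont : Continuous fun φ => 𝓕 (dampedDifference w₁ w₂ φ) ξ := by
      refine (LipschitzWith.of_dist_le_mul (K := C.toNNReal) fun φ χ => ?_).continuous
      rw [dist_eq_norm, dist_eq_norm, ← hsub]
      refine (hbound _).trans ?_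
      gcongr
      exact Real.le_coe_toNNReal C
    refine fun φ => congrFun (hcont.ext_on (hrange ξ) continuous_const ?_) φ
    rintro _ ⟨p, hp, rfl⟩
    have h3 := h₁.fourier_dampedDifference_eq h₂ hd hp ξ
    simp only [hsub, hsmul, ← h3, map_sub, map_mul, map_one, Complex.conj_I, Complex.conj_ofReal,
      Complex.conj_ofNat]
    ring
  refine ext_inner_left ℂ fun φ => ?_
  have hF : 𝓕 (dampedDifference w₁ w₂ φ) = fun _ => 0 := funext fun ξ => hzero ξ φ
  have hinv := (h₁.continuous_dampedDifference h₂ hd φ).fourierInv_fourier_eq (hint φ)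
    (by rw [hF]; exact integrable_zero _ _ _)
  have h3 : dampedDifference w₁ w₂ φ s = 0 := by
    rw [← hinv, hF]
    simp [Real.fourierInv_eq]
  have h4 : ((Real.exp (-s) : ℝ) : ℂ) ≠ 0 := by exact_mod_cast (Real.exp_pos _).ne'
  have h5 := (mul_eq_zero.1 h3).resolve_left h4
  rwa [differenceFrom, max_eq_left hs, inner_sub_right, sub_eq_zero] at h5

/-- Abstract product formula: powers of the contractions `F ε` converge weakly to the
operators solving the evolution equation weakly. -/
theorem IsProductFormula.exists_propagator [CompleteSpace E] {F : ℝ → E →L[ℂ] E}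
    (hF : IsProductFormula S F)
    (hrange : ∀ ξ : ℝ, Dense ((fun p : E × E => (1 - 2 * Real.pi * I * ξ) • p.1 - p.2) '' S)) :
    ∃ U : ℝ → E →L[ℂ] E, (∀ s, ‖U s‖ ≤ 1) ∧
      (∀ s, 0 ≤ s → ∀ φ u : E,
        Tendsto (fun ε : ℝ => ⟪φ, (F ε ^ ⌊s / ε⌋₊) u⟫_ℂ) (𝓝[>] 0) (𝓝 ⟪φ, U s u⟫_ℂ)) ∧
      ∀ u, IsWeakSolution S u fun s => U s u := by
  have hex : ∀ u : E, ∃ w : ℝ → E, IsWeakSolution S u w ∧ ∀ s, 0 ≤ s → ∀ φ : E,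
      Tendsto (fun ε : ℝ => ⟪φ, (F ε ^ ⌊s / ε⌋₊) u⟫_ℂ) (𝓝[>] 0) (𝓝 ⟪φ, w s⟫_ℂ) := by
    intro u
    obtain ⟨w, hw, -⟩ := hF.exists_isWeakSolution u (Ultrafilter.of (𝓝[>] (0 : ℝ)))
      (Ultrafilter.of_le _)
    refine ⟨w, hw, fun s hs φ => (tendsto_iff_ultrafilter _ _ _).2 fun 𝒰 h𝒰 => ?_⟩
    obtain ⟨w', hw', hlim⟩ := hF.exists_isWeakSolution u 𝒰 h𝒰
    rw [hw.unique hw' hF.dense hrange hs]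
    exact hlim s hs φ
  choose w hw hlim using hex
  have hmax : ∀ s : ℝ, 0 ≤ max s 0 := fun s => le_max_right s 0
  refine ⟨fun s => LinearMap.mkContinuous
    { toFun := fun u => w u (max s 0)
      map_add' := fun u v => ?_
      map_smul' := fun c u => ?_ } 1 fun u => ?_, fun s => ?_, fun s hs φ u => ?_, fun u => ?_⟩
  · refine ext_inner_left ℂ fun φ => tendsto_nhds_unique (hlim (u + v) _ (hmax s) φ) ?_
    simpa only [map_add, inner_add_right] using
      (hlim u _ (hmax s) φ).add (hlim v _ (hmax s) φ)
  · refine ext_inner_left ℂ fun φ => tendsto_nhds_unique (hlim (c • u) _ (hmax s) φ) ?_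
    simpa only [map_smul, inner_smul_right, RingHom.id_apply] using
      (hlim u _ (hmax s) φ).const_mul c
  · rw [one_mul]
    exact (hw u).norm_le _ (hmax s)
  · exact LinearMap.mkContinuous_norm_le _ zero_le_one _
  · have := hlim u s hs φ
    simpa [max_eq_left hs] using this
  · refine ⟨fun s hs => ?_, ?_, fun p hp s hs => ?_⟩
    · simpa [max_eq_left hs] using (hw u).norm_le s hs
    · simpa using (hw u).initial
    · have h := (hw u).hasDeriv p hp s hs
      refine (h.congr_of_mem (fun r hr => ?_) hs).congr_deriv ?_
      · simp [max_eq_left (mem_Ici.1 hr)]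
      · simp [max_eq_left hs]

end Uniqueness

/-! ### Consequences of essential self-adjointness -/

section SelfAdjoint

open scoped InnerProductSpace LinearPMap

variable {E : Type*} [NormedAddCommGroup E] [InnerProductSpace ℂ E] [CompleteSpace E]

/-- The deficiency spaces of an essentially self-adjoint operator are trivial. -/
theorem IsEssentiallySelfAdjoint.eq_zero_of_inner_eq {A : E →ₗ.[ℂ] E}
    (hA : IsEssentiallySelfAdjoint A) {z : ℂ} (hz : z.im ≠ 0) {v : E}
    (hv : ∀ p ∈ A.graph, ⟪p.2, v⟫_ℂ = z * ⟪p.1, v⟫_ℂ) : v = 0 := by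
  have hsa : A.closure† = A.closure := hA
  have hcl : ∀ p ∈ A.closure.graph, ⟪p.2, v⟫_ℂ = z * ⟪p.1, v⟫_ℂ := by
    by_cases hc : A.IsClosable
    · intro p hp
      rw [← hc.graph_closure_eq_closure_graph] at hp
      have hclosed : IsClosed {p : E × E | ⟪p.2, v⟫_ℂ = z * ⟪p.1, v⟫_ℂ} :=
        isClosed_eq (by fun_prop) (by fun_prop)
      exact closure_minimal (s := (A.graph : Set (E × E))) hv hclosed hp
    · rwa [LinearPMap.closure_def' hc]
  have hinner : ∀ x : A.closure.domain, ⟪z • v, (x : E)⟫_ℂ = ⟪v, A.closure x⟫_ℂ := by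
    intro x
    have h := hcl (x, A.closure x) (LinearPMap.mem_graph _ x)
    have h2 := congrArg (starRingEnd ℂ) h
    rw [map_mul, inner_conj_symm, inner_conj_symm] at h2
    rw [inner_smul_left, h2]
  have hdom : v ∈ (A.closure†).domain :=
    LinearPMap.mem_adjoint_domain_of_exists _ ⟨z • v, hinner⟩
  have happ : A.closure† ⟨v, hdom⟩ = z • v :=
    LinearPMap.adjoint_apply_eq (IsSelfAdjoint.dense_domain hA) ⟨v, hdom⟩ hinner
  have hgraph : (v, z • v) ∈ A.closure.graph := by
    rw [← hsa]
    exact (LinearPMap.mem_graph_iff _).2 ⟨⟨v, hdom⟩, rfl, happ⟩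
  have h := hcl _ hgraph
  simp only [inner_smul_left] at h
  by_contra hne
  have h2 := mul_right_cancel₀ (inner_self_ne_zero.2 hne) h
  exact hz (Complex.conj_eq_iff_im.1 h2)

end SelfAdjoint

/-- The Hilbert space `L²(ℝ)`. -/
noncomputable abbrev L2 := Lp ℂ 2 (volume : Measure ℝ)

theorem hamiltonianOp_graph (m ħ : ℝ) (V : ℝ → ℝ) :
    (hamiltonianOp m ħ V).graph = hamiltonianGraph m ħ V :=
  Submodule.toLinearPMap_graph_eq _ fun p hp h0 => hamiltonianGraph_functional m ħ V p hp h0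

/-- The graph of `(i/ħ) H` on test functions. -/
noncomputable def generatorGraph (m ħ : ℝ) (V : ℝ → ℝ) : Set (L2 × L2) :=
  (fun p : L2 × L2 => (p.1, (I / ħ : ℂ) • p.2)) '' (hamiltonianGraph m ħ V : Set (L2 × L2))

/-- The orthogonal complement of the range consists of solutions `v` of `H† v = z v` with `z` not
real, that is, of a deficiency space. -/
theorem dense_range_generatorGraph {m ħ : ℝ} (hħ : 0 < ħ) {V : ℝ → ℝ}
    (hH : IsEssentiallySelfAdjoint (hamiltonianOp m ħ V)) (ξ : ℝ) :
    Dense ((fun p : L2 × L2 => (1 - 2 * Real.pi * I * ξ : ℂ) • p.1 - p.2) ''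
      generatorGraph m ħ V) := by
  have hħ' : (ħ : ℂ) ≠ 0 := by exact_mod_cast hħ.ne'
  let M : Submodule ℂ L2 := (hamiltonianGraph m ħ V).map
    ((1 - 2 * Real.pi * I * ξ : ℂ) • LinearMap.fst ℂ L2 L2 - (I / ħ : ℂ) • LinearMap.snd ℂ L2 L2)
  have hM : (fun p : L2 × L2 => (1 - 2 * Real.pi * I * ξ : ℂ) • p.1 - p.2) ''
      generatorGraph m ħ V = M := by
    rw [generatorGraph, image_image]
    rfl
  rw [hM, ← Submodule.dense_iff_topologicalClosure_eq_top.symm,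
    Submodule.topologicalClosure_eq_top_iff, Submodule.eq_bot_iff]
  intro v hv
  refine hH.eq_zero_of_inner_eq (z := I * ħ * (1 + 2 * Real.pi * I * ξ)) ?_ fun p hp => ?_
  · simpa using hħ.ne'
  rw [hamiltonianOp_graph] at hp
  have h := (Submodule.mem_orthogonal _ _).1 hv _ ⟨p, hp, rfl⟩
  simp only [LinearMap.sub_apply, LinearMap.smul_apply, LinearMap.fst_apply, LinearMap.snd_apply,
    inner_sub_left, inner_smul_left, map_sub, map_mul, map_one, map_div₀, Complex.conj_I,
    Complex.conj_ofReal, Complex.conj_ofNat] at h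
  field_simp at h
  linear_combination (-I) * h + (inner ℂ p.2 v) * Complex.I_sq

/-! ### Multiplication operators in `L²(ℝ)` -/

section Multiplication

theorem inner_eq_integral (u v : L2) : inner ℂ u v = ∫ x, (starRingEnd ℂ) (u x) * v x := by
  rw [L2.inner_def]
  refine integral_congr_ae (Eventually.of_forall fun x => ?_)
  simp [RCLike.inner_apply, mul_comm]

theorem norm_sq_eq_integral (u : L2) : ‖u‖ ^ 2 = ∫ x, ‖u x‖ ^ 2 := by
  have h : ((‖u‖ ^ 2 : ℝ) : ℂ) = ((∫ x, ‖u x‖ ^ 2 : ℝ) : ℂ) := by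
    rw [← integral_complex_ofReal]
    push_cast
    refine (inner_self_eq_norm_sq_to_K (𝕜 := ℂ) u).symm.trans ?_
    rw [inner_eq_integral]
    refine integral_congr_ae (Eventually.of_forall fun x => ?_)
    simp [Complex.conj_mul']
  exact_mod_cast h

/-- Dominated convergence in `L²`. The representatives `F i` are explicit, since an index set that
is not countable does not allow to choose the exceptional sets uniformly. -/
theorem tendsto_L2_of_dominated {ι : Type*} {l : Filter ι} [l.IsCountablyGenerated] {v : ι → L2}
    {w : L2} {F : ι → ℝ → ℂ} {f : ℝ → ℂ} {h : ℝ → ℝ} (hv : ∀ᶠ i in l, v i =ᵐ[volume] F i)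
    (hw : w =ᵐ[volume] f) (hh : MemLp h 2 volume) (hb : ∀ᶠ i in l, ∀ᵐ x, ‖F i x‖ ≤ h x)
    (hf : ∀ᵐ x, ‖f x‖ ≤ h x) (hlim : ∀ᵐ x, Tendsto (fun i => F i x) l (𝓝 (f x))) :
    Tendsto v l (𝓝 w) := by
  rw [tendsto_iff_norm_sub_tendsto_zero]
  have hsq : Tendsto (fun i => ∫ x, ‖F i x - f x‖ ^ 2) l (𝓝 (∫ _ : ℝ, (0 : ℝ))) := by
    refine tendsto_integral_filter_of_dominated_convergence (fun x => 4 * h x ^ 2)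
      (hv.mono fun i hi => ((((Lp.aestronglyMeasurable _).congr hi).sub
        ((Lp.aestronglyMeasurable _).congr hw)).norm.pow 2)) ?_
      (hh.integrable_sq.const_mul 4) ?_
    · filter_upwards [hb] with i hi
      filter_upwards [hi, hf] with x h1 h2
      have h3 : ‖F i x - f x‖ ≤ 2 * h x := (norm_sub_le _ _).trans (by linarith)
      rw [Real.norm_of_nonneg (by positivity)]
      calc ‖F i x - f x‖ ^ 2 ≤ (2 * h x) ^ 2 := by gcongr
        _ = 4 * h x ^ 2 := by ring
    · filter_upwards [hlim] with x hx
      have := ((tendsto_iff_norm_sub_tendsto_zero.1 hx).pow 2)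
      simpa using this
  rw [integral_zero] at hsq
  have h2 : ∀ᶠ i in l, ∫ x, ‖F i x - f x‖ ^ 2 = ‖v i - w‖ ^ 2 := by
    filter_upwards [hv] with i hi
    rw [norm_sq_eq_integral]
    refine integral_congr_ae ?_
    filter_upwards [Lp.coeFn_sub (v i) w, hi, hw] with x hx h1 h2
    rw [hx, Pi.sub_apply, h1, h2]
  have h3 := (Real.continuous_sqrt.tendsto 0).comp (hsq.congr' h2)
  simpa [Function.comp_def] using h3

/-- A multiplier of absolute value at most one. -/
def IsMultiplier (g : ℝ → ℂ) : Prop := AEStronglyMeasurable g volume ∧ ∀ x, ‖g x‖ ≤ 1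

theorem IsMultiplier.memLp {g : ℝ → ℂ} (hg : IsMultiplier g) {f : ℝ → ℂ} {p : ℝ≥0∞}
    (hf : MemLp f p volume) : MemLp (fun x => g x * f x) p volume := by
  refine hf.of_le (hg.1.mul hf.1) (Eventually.of_forall fun x => ?_)
  rw [norm_mul]
  exact mul_le_of_le_one_left (norm_nonneg _) (hg.2 x)

theorem IsMultiplier.conj {g : ℝ → ℂ} (hg : IsMultiplier g) :
    IsMultiplier fun x => (starRingEnd ℂ) (g x) :=
  ⟨Complex.continuous_conj.comp_aestronglyMeasurable hg.1, fun x => by simpa using hg.2 x⟩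

/-- The operator of multiplication by `g` in `L²(ℝ)`. -/
noncomputable def mulL2 {g : ℝ → ℂ} (hg : IsMultiplier g) : L2 →L[ℂ] L2 :=
  LinearMap.mkContinuous
    { toFun := fun u => (hg.memLp (Lp.memLp u)).toLp
      map_add' := fun u v => by
        rw [← MemLp.toLp_add]
        refine MemLp.toLp_congr _ _ ?_
        filter_upwards [Lp.coeFn_add u v] with x hx
        rw [hx, Pi.add_apply, Pi.add_apply, mul_add]
      map_smul' := fun c u => by
        rw [RingHom.id_apply, ← MemLp.toLp_const_smul]
        refine MemLp.toLp_congr _ _ ?_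
        filter_upwards [Lp.coeFn_smul c u] with x hx
        simp only [hx, Pi.smul_apply, smul_eq_mul]
        ring } 1 fun u => by
    rw [one_mul]
    refine Lp.norm_le_norm_of_ae_le ?_
    filter_upwards [MemLp.coeFn_toLp (hg.memLp (Lp.memLp u))] with x hx
    rw [LinearMap.coe_mk, AddHom.coe_mk, hx, norm_mul]
    exact mul_le_of_le_one_left (norm_nonneg _) (hg.2 x)

theorem coeFn_mulL2 {g : ℝ → ℂ} (hg : IsMultiplier g) (u : L2) :
    mulL2 hg u =ᵐ[volume] fun x => g x * u x :=
  MemLp.coeFn_toLp (hg.memLp (Lp.memLp u))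

theorem norm_mulL2_le {g : ℝ → ℂ} (hg : IsMultiplier g) : ‖mulL2 hg‖ ≤ 1 :=
  LinearMap.mkContinuous_norm_le _ zero_le_one _

theorem norm_mulL2_apply_le {g : ℝ → ℂ} (hg : IsMultiplier g) (u : L2) : ‖mulL2 hg u‖ ≤ ‖u‖ := by
  simpa using (mulL2 hg).le_of_opNorm_le (norm_mulL2_le hg) u

theorem inner_mulL2_left {g : ℝ → ℂ} (hg : IsMultiplier g) (u v : L2) :
    inner ℂ (mulL2 hg.conj u) v = inner ℂ u (mulL2 hg v) := by
  rw [inner_eq_integral, inner_eq_integral]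
  refine integral_congr_ae ?_
  filter_upwards [coeFn_mulL2 hg v, coeFn_mulL2 hg.conj u] with x h1 h2
  rw [h1, h2, map_mul, Complex.conj_conj]
  ring

theorem adjoint_mulL2 {g : ℝ → ℂ} (hg : IsMultiplier g) : (mulL2 hg).adjoint = mulL2 hg.conj :=
  (ContinuousLinearMap.eq_adjoint_iff _ _).2 (fun u v => inner_mulL2_left hg u v) |>.symm

theorem tendsto_mulL2 {ι : Type*} {l : Filter ι} [l.IsCountablyGenerated] {g : ι → ℝ → ℂ}
    (hg : ∀ i, IsMultiplier (g i)) (hlim : ∀ x, Tendsto (fun i => g i x) l (𝓝 1)) (u : L2) :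
    Tendsto (fun i => mulL2 (hg i) u) l (𝓝 u) := by
  refine tendsto_L2_of_dominated (Eventually.of_forall fun i => coeFn_mulL2 (hg i) u)
    (ae_eq_refl _) (Lp.memLp u).norm
    (Eventually.of_forall fun i => Eventually.of_forall fun x => ?_)
    (Eventually.of_forall fun x => le_rfl) (Eventually.of_forall fun x => ?_)
  · rw [norm_mul]
    exact mul_le_of_le_one_left (norm_nonneg _) ((hg i).2 x)
  · simpa using (hlim x).mul_const (u x)

/-- The multiplier `e^{iθ}`. -/
theorem isMultiplier_phase {θ : ℝ → ℝ} (hθ : Measurable θ) :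
    IsMultiplier fun x => cexp (I * θ x) := by
  refine ⟨(by fun_prop : Measurable fun x => cexp (I * θ x)).aestronglyMeasurable, fun x => ?_⟩
  rw [Complex.norm_exp_I_mul_ofReal]

theorem isMultiplier_indicator {s : Set ℝ} (hs : MeasurableSet s) :
    IsMultiplier (s.indicator fun _ => 1) :=
  ⟨(measurable_const.indicator hs).aestronglyMeasurable, fun x => by
    by_cases h : x ∈ s <;> simp [h]⟩

end Multiplication

/-! ### The free propagator -/

section Free

open scoped FourierTransform

theorem integral_fourier_mul_eq {f g : ℝ → ℂ} (hf : Integrable f) (hg : Integrable g) :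
    ∫ x, 𝓕 f x * g x = ∫ x, f x * 𝓕 g x := by
  have h := VectorFourier.integral_fourierIntegral_smul_eq_flip (𝕜 := ℝ) (e := Real.fourierChar)
    (L := innerₗ ℝ) (μ := volume) (ν := volume) (f := f) (g := g) Real.continuous_fourierChar
    continuous_inner hf hg
  rwa [flip_innerₗ] at h

theorem integral_fourierInv_mul_eq {f g : ℝ → ℂ} (hf : Integrable f) (hg : Integrable g) :
    ∫ x, 𝓕⁻ f x * g x = ∫ x, f x * 𝓕⁻ g x := by
  have h := integral_fourier_mul_eq hf hg.comp_neg
  rw [← Real.fourierInv_eq_fourier_comp_neg] at h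
  rw [← h, ← integral_neg_eq_self]
  simp only [Real.fourierInv_eq_fourier_neg, neg_neg]

theorem continuous_fourierInv {f : ℝ → ℂ} (hf : Integrable f) : Continuous (𝓕⁻ f) := by
  have h : Continuous (𝓕 f) := VectorFourier.fourierIntegral_continuous
    Real.continuous_fourierChar continuous_inner hf
  have h2 : 𝓕⁻ f = fun w => 𝓕 f (-w) := funext fun w => Real.fourierInv_eq_fourier_neg f w
  rw [h2]
  exact h.comp continuous_neg

/-- For integrable square-integrable functions the inverse Fourier transform in `L²` is given by
the integral. -/
theorem coeFn_fourierInv_toLp {f : ℝ → ℂ} (hf : MemLp f 2 volume) (hf1 : Integrable f) :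
    (𝓕⁻ hf.toLp : L2) =ᵐ[volume] 𝓕⁻ f := by
  refine ae_eq_of_integral_contDiff_smul_eq ((Lp.memLp _).locallyIntegrable one_le_two)
    (continuous_fourierInv hf1).locallyIntegrable fun g hg hgc => ?_
  have hψc : HasCompactSupport fun x => (g x : ℂ) := hgc.comp_left Complex.ofReal_zero
  let ψ : SchwartzMap ℝ ℂ := hψc.toSchwartzMap (Complex.ofRealCLM.contDiff.comp hg)
  have hψ : ∀ x, ψ x = g x := fun x => rfl
  have h1 : ∫ x, g x • (𝓕⁻ hf.toLp : L2) x = inner ℂ (ψ.toLp 2 : L2) (𝓕⁻ hf.toLp : L2) := by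
    rw [inner_eq_integral]
    refine integral_congr_ae ?_
    filter_upwards [ψ.coeFn_toLp 2] with x hx
    rw [hx, hψ, Complex.conj_ofReal, Complex.real_smul]
  have h2 : inner ℂ (ψ.toLp 2 : L2) (𝓕⁻ hf.toLp : L2) = inner ℂ ((𝓕 ψ).toLp 2 : L2) hf.toLp := by
    rw [← SchwartzMap.toLp_fourier_eq, ← Lp.inner_fourier_eq,
      FourierTransform.fourier_fourierInv_eq]
  rw [h1, h2, inner_eq_integral]
  have h3 : ∀ x, (starRingEnd ℂ) (𝓕 ψ x) = 𝓕⁻ (ψ : ℝ → ℂ) x := by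
    intro x
    rw [SchwartzMap.fourier_coe, Real.fourier_eq', Real.fourierInv_eq', ← integral_conj]
    refine integral_congr_ae (Eventually.of_forall fun y => ?_)
    simp only [smul_eq_mul, map_mul, ← Complex.exp_conj, hψ, Complex.conj_ofReal, Complex.conj_I]
    congr 2
    push_cast
    ring
  calc ∫ x, (starRingEnd ℂ) (((𝓕 ψ : SchwartzMap ℝ ℂ).toLp 2 : L2) x) * (hf.toLp : L2) x
    _ = ∫ x, 𝓕⁻ (ψ : ℝ → ℂ) x * f x := by
        refine integral_congr_ae ?_
        filter_upwards [(𝓕 ψ).coeFn_toLp 2, hf.coeFn_toLp] with x hx h'x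
        rw [hx, h'x, h3]
    _ = ∫ x, (ψ : ℝ → ℂ) x * 𝓕⁻ f x := integral_fourierInv_mul_eq ψ.integrable hf1
    _ = ∫ x, g x • 𝓕⁻ f x := by
        refine integral_congr_ae (Eventually.of_forall fun x => ?_)
        simp only [hψ, Complex.real_smul]

/-- The free propagator: multiplication of the Fourier transform by `e^{-iτξ²}`. -/
noncomputable def freeProp (τ : ℝ) : L2 →L[ℂ] L2 :=
  (Lp.fourierTransformₗᵢ ℝ ℂ).symm.toContinuousLinearEquiv.toContinuousLinearMap ∘L
    mulL2 (isMultiplier_phase (θ := fun ξ => -(τ * ξ ^ 2)) (by fun_prop)) ∘L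
      (Lp.fourierTransformₗᵢ ℝ ℂ).toContinuousLinearEquiv.toContinuousLinearMap

theorem freeProp_apply (τ : ℝ) (u : L2) : freeProp τ u =
    𝓕⁻ (mulL2 (isMultiplier_phase (θ := fun ξ => -(τ * ξ ^ 2)) (by fun_prop)) (𝓕 u)) := rfl

theorem norm_freeProp_apply_le (τ : ℝ) (u : L2) : ‖freeProp τ u‖ ≤ ‖u‖ := by
  rw [freeProp_apply, ← Lp.norm_fourier_eq, FourierTransform.fourier_fourierInv_eq]
  exact (norm_mulL2_apply_le _ _).trans_eq (Lp.norm_fourier_eq u)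

theorem adjoint_freeProp (τ : ℝ) : (freeProp τ).adjoint = freeProp (-τ) := by
  refine ((ContinuousLinearMap.eq_adjoint_iff _ _).2 fun u v => ?_).symm
  rw [freeProp_apply, freeProp_apply, ← Lp.inner_fourier_eq, ← Lp.inner_fourier_eq u,
    FourierTransform.fourier_fourierInv_eq, FourierTransform.fourier_fourierInv_eq,
    ← inner_mulL2_left]
  congr 1
  refine Lp.ext ?_
  filter_upwards [coeFn_mulL2 (isMultiplier_phase (θ := fun ξ => -(-τ * ξ ^ 2)) (by fun_prop))
      (𝓕 u),
    coeFn_mulL2 (isMultiplier_phase (θ := fun ξ => -(τ * ξ ^ 2)) (by fun_prop)).conj (𝓕 u)]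
    with x h1 h2
  rw [h1, h2, ← Complex.exp_conj]
  simp

/-- The integral kernel of the free propagator, as a function of the difference of positions. -/
noncomputable def freeKernel (τ z : ℝ) : ℂ :=
  (Real.pi / (I * τ) : ℂ) ^ (1 / 2 : ℂ) * cexp (I * (Real.pi ^ 2 * z ^ 2 / τ : ℝ))

theorem norm_freeKernel (τ z : ℝ) :
    ‖freeKernel τ z‖ = ‖(Real.pi / (I * τ) : ℂ) ^ (1 / 2 : ℂ)‖ := by
  rw [freeKernel, norm_mul, Complex.norm_exp_I_mul_ofReal, mul_one]

theorem continuous_freeKernel (τ : ℝ) : Continuous (freeKernel τ) := by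
  unfold freeKernel
  fun_prop

theorem pi_div_mem_slitPlane {τ : ℝ} (hτ : τ ≠ 0) : (Real.pi / (I * τ) : ℂ) ∈ slitPlane := by
  have hτ' : (τ : ℂ) ≠ 0 := by exact_mod_cast hτ
  have : (Real.pi / (I * τ) : ℂ) = -((Real.pi / τ : ℝ) : ℂ) * I := by
    push_cast
    field_simp
    rw [Complex.I_sq]
    ring
  rw [this]
  right
  simp [hτ, Real.pi_ne_zero]

theorem conj_freeKernel_neg {τ : ℝ} (hτ : τ ≠ 0) (z : ℝ) :
    (starRingEnd ℂ) (freeKernel (-τ) z) = freeKernel τ z := by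
  have h : (Real.pi / (I * τ) : ℂ).arg ≠ Real.pi :=
    (Complex.mem_slitPlane_iff_arg.1 (pi_div_mem_slitPlane hτ)).1
  have h1 : (Real.pi / (I * (-τ : ℝ)) : ℂ) = (starRingEnd ℂ) (Real.pi / (I * τ) : ℂ) := by
    simp
  have h2 : (starRingEnd ℂ) (1 / 2 : ℂ) = 1 / 2 := by
    rw [map_div₀, map_one, Complex.conj_ofNat]
  rw [freeKernel, freeKernel, h1, Complex.conj_cpow _ _ h, map_mul, Complex.conj_conj, h2,
    ← Complex.exp_conj, map_mul, Complex.conj_I, Complex.conj_ofReal]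
  congr 2
  push_cast
  rw [div_neg]
  ring

/-- Convolution with a decaying Gaussian as a Fourier multiplier. -/
theorem integral_gaussian_mul {c : ℂ} (hc : 0 < c.re) {φ : ℝ → ℂ} (hφ : Integrable φ) (x : ℝ) :
    ∫ y : ℝ, (c⁻¹ ^ (1 / 2 : ℂ) * cexp (-Real.pi / c * (x - y) ^ 2)) * φ y =
      ∫ ξ : ℝ, cexp (-Real.pi * c * ξ ^ 2 + 2 * Real.pi * (I * x) * ξ) * 𝓕 φ ξ := by
  have hgi : Integrable fun ξ : ℝ => cexp (-Real.pi * c * ξ ^ 2 + 2 * Real.pi * (I * x) * ξ) := by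
    have hre : 0 < ((Real.pi : ℂ) * c).re := by
      rw [Complex.re_ofReal_mul]; exact mul_pos Real.pi_pos hc
    refine (integrable_cexp_quadratic hre (2 * Real.pi * (I * x)) 0).congr
      (Eventually.of_forall fun ξ => ?_)
    ring_nf
  rw [← integral_fourier_mul_eq hgi hφ, fourier_gaussian_pi' hc]
  refine integral_congr_ae (Eventually.of_forall fun y => ?_)
  have harg : c.arg ≠ Real.pi := fun h => by
    rw [Complex.arg_eq_pi_iff] at h; exact absurd hc (not_lt.2 h.1.le)
  simp only [Complex.inv_cpow _ _ harg, one_div]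
  congr 3
  linear_combination (-Real.pi / c * (-2 * x * y + x ^ 2 * (1 - I ^ 2))) * Complex.I_sq

/-- The free kernel as a Fourier multiplier, by approximation with decaying Gaussians. -/
theorem integral_freeKernel_mul {τ : ℝ} (hτ : τ ≠ 0) {φ : ℝ → ℂ} (hφ : Integrable φ)
    (hφ' : Integrable (𝓕 φ)) (x : ℝ) :
    ∫ y, freeKernel τ (x - y) * φ y = 𝓕⁻ (fun ξ => cexp (I * (-(τ * ξ ^ 2) : ℝ)) * 𝓕 φ ξ) x := by
  have hπ : (Real.pi : ℂ) ≠ 0 := by exact_mod_cast Real.pi_ne_zero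
  have hτ' : (τ : ℂ) ≠ 0 := by exact_mod_cast hτ
  let c : ℝ → ℂ := fun δ => δ + I * (τ / Real.pi)
  have hcre : ∀ δ, (c δ).re = δ := fun δ => by
    have : (I * (τ / Real.pi) : ℂ) = I * ((τ / Real.pi : ℝ) : ℂ) := by push_cast; ring
    simp [c, this]
  have hc0 : c 0 ≠ 0 := by simp [c, hτ, Real.pi_ne_zero]
  have hcinv : (c 0)⁻¹ = Real.pi / (I * τ) := by
    simp only [c, Complex.ofReal_zero, zero_add]
    field_simp
  have hslit : (c 0)⁻¹ ∈ slitPlane := hcinv ▸ pi_div_mem_slitPlane hτ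
  have hct : Tendsto c (𝓝[>] 0) (𝓝 (c 0)) :=
    (Continuous.tendsto (by fun_prop) 0).mono_left nhdsWithin_le_nhds
  have hcinvt : Tendsto (fun δ => (c δ)⁻¹) (𝓝[>] 0) (𝓝 (c 0)⁻¹) := hct.inv₀ hc0
  have hpow : Tendsto (fun δ => (c δ)⁻¹ ^ (1 / 2 : ℂ)) (𝓝[>] 0)
      (𝓝 ((c 0)⁻¹ ^ (1 / 2 : ℂ))) := hcinvt.cpow tendsto_const_nhds hslit
  have hpos : ∀ᶠ δ : ℝ in 𝓝[>] 0, 0 < δ := eventually_mem_nhdsWithin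
  have hL : Tendsto (fun δ => ∫ y : ℝ, ((c δ)⁻¹ ^ (1 / 2 : ℂ) *
      cexp (-Real.pi / c δ * (x - y) ^ 2)) * φ y) (𝓝[>] 0)
      (𝓝 (∫ y, freeKernel τ (x - y) * φ y)) := by
    refine tendsto_integral_filter_of_dominated_convergence
      (fun y => (‖(c 0)⁻¹ ^ (1 / 2 : ℂ)‖ + 1) * ‖φ y‖)
      (Eventually.of_forall fun δ => (Continuous.aestronglyMeasurable (by fun_prop)).mul hφ.1) ?_
      (hφ.norm.const_mul _) (Eventually.of_forall fun y => ?_)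
    · filter_upwards [hpow.norm.eventually_le_const (lt_add_one _), hpos] with δ h1 h2
      refine Eventually.of_forall fun y => ?_
      rw [norm_mul, norm_mul]
      gcongr
      refine (mul_le_of_le_one_right (norm_nonneg _) ?_).trans h1
      rw [Complex.norm_exp, Real.exp_le_one_iff]
      have h3 : (-Real.pi / c δ * (x - y) ^ 2 : ℂ) =
          ((-Real.pi * (x - y) ^ 2 : ℝ) : ℂ) * (c δ)⁻¹ := by push_cast; ring
      rw [h3, Complex.re_ofReal_mul, Complex.inv_re, hcre]
      have h4 : 0 ≤ δ / normSq (c δ) := div_nonneg h2.le (normSq_nonneg _)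
      have h5 : -Real.pi * (x - y) ^ 2 ≤ 0 := by
        have := mul_nonneg Real.pi_pos.le (sq_nonneg (x - y)); linarith
      exact mul_nonpos_of_nonpos_of_nonneg h5 h4
    · refine Tendsto.mul_const _ ?_
      have h1 : freeKernel τ (x - y) =
          (c 0)⁻¹ ^ (1 / 2 : ℂ) * cexp (-Real.pi / c 0 * (x - y) ^ 2) := by
        rw [freeKernel, hcinv]
        congr 2
        rw [div_eq_mul_inv _ (c 0), hcinv]
        push_cast
        field_simp
        rw [Complex.I_sq]
        ring
      rw [h1]
      refine hpow.mul ((Complex.continuous_exp.tendsto _).comp ?_)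
      exact (tendsto_const_nhds.div hct hc0).mul_const _
  have hR : Tendsto (fun δ => ∫ ξ : ℝ, cexp (-Real.pi * c δ * ξ ^ 2 + 2 * Real.pi * (I * x) * ξ) *
      𝓕 φ ξ) (𝓝[>] 0) (𝓝 (𝓕⁻ (fun ξ => cexp (I * (-(τ * ξ ^ 2) : ℝ)) * 𝓕 φ ξ) x)) := by
    rw [Real.fourierInv_eq']
    refine tendsto_integral_filter_of_dominated_convergence (fun ξ => ‖𝓕 φ ξ‖)
      (Eventually.of_forall fun δ => (Continuous.aestronglyMeasurable (by fun_prop)).mul hφ'.1) ?_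
      hφ'.norm (Eventually.of_forall fun ξ => ?_)
    · filter_upwards [hpos] with δ h2
      refine Eventually.of_forall fun ξ => ?_
      rw [norm_mul]
      refine mul_le_of_le_one_left (norm_nonneg _) ?_
      rw [Complex.norm_exp, Real.exp_le_one_iff]
      have h3 : (-Real.pi * c δ * ξ ^ 2 + 2 * Real.pi * (I * x) * ξ : ℂ) =
          ((-Real.pi * ξ ^ 2 : ℝ) : ℂ) * c δ + ((2 * Real.pi * x * ξ : ℝ) : ℂ) * I := by
        push_cast; ring
      rw [h3, Complex.add_re, Complex.re_ofReal_mul, hcre, Complex.re_ofReal_mul, Complex.I_re,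
        mul_zero, add_zero]
      have := mul_nonneg (mul_nonneg Real.pi_pos.le (sq_nonneg ξ)) h2.le
      linarith
    · rw [smul_eq_mul, ← mul_assoc (cexp _) (cexp _), ← Complex.exp_add]
      refine Tendsto.mul_const _ ((Complex.continuous_exp.tendsto _).comp ?_)
      have h1 : (((2 * Real.pi * inner ℝ ξ x : ℝ) : ℂ) * I + I * ((-(τ * ξ ^ 2) : ℝ) : ℂ)) =
          -Real.pi * c 0 * ξ ^ 2 + 2 * Real.pi * (I * x) * ξ := by
        simp only [c, RCLike.inner_apply, conj_trivial]
        push_cast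
        field_simp
        ring
      rw [h1]
      exact ((tendsto_const_nhds.mul hct).mul_const _).add_const _
  refine tendsto_nhds_unique (hL.congr' ?_) hR
  filter_upwards [hpos] with δ hδ
  exact integral_gaussian_mul (by rw [hcre]; exact hδ) hφ x

/-- The free propagator on Schwartz functions, as an integral operator. -/
theorem coeFn_freeProp_schwartz {τ : ℝ} (hτ : τ ≠ 0) (φ : SchwartzMap ℝ ℂ) :
    freeProp τ (φ.toLp 2) =ᵐ[volume] fun x => ∫ y, freeKernel τ (x - y) * φ y := by
  have hmul := isMultiplier_phase (θ := fun ξ => -(τ * ξ ^ 2)) (by fun_prop)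
  have h2 : MemLp (fun ξ => cexp (I * (-(τ * ξ ^ 2) : ℝ)) * 𝓕 φ ξ) 2 volume :=
    hmul.memLp ((𝓕 φ).memLp 2)
  have h1 : Integrable (fun ξ => cexp (I * (-(τ * ξ ^ 2) : ℝ)) * 𝓕 φ ξ) :=
    memLp_one_iff_integrable.1 (hmul.memLp ((𝓕 φ).memLp 1))
  have h3 : freeProp τ (φ.toLp 2) = 𝓕⁻ h2.toLp := by
    rw [freeProp_apply, SchwartzMap.toLp_fourier_eq]
    congr 1
    refine Lp.ext ?_
    filter_upwards [coeFn_mulL2 hmul ((𝓕 φ).toLp 2), h2.coeFn_toLp, (𝓕 φ).coeFn_toLp 2]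
      with x e1 e2 e3
    rw [e1, e2, e3]
  rw [h3]
  refine (coeFn_fourierInv_toLp h2 h1).trans (Eventually.of_forall fun x => ?_)
  have h4 := (𝓕 φ).integrable (μ := volume)
  simp only [SchwartzMap.fourier_coe] at h4 ⊢
  exact (integral_freeKernel_mul hτ φ.integrable h4 x).symm

theorem integrable_freeKernel_mul (τ : ℝ) {f : ℝ → ℂ} (hf : Integrable f) (x : ℝ) :
    Integrable fun y => freeKernel τ (x - y) * f y :=
  hf.bdd_mul ((continuous_freeKernel τ).comp (by fun_prop)).aestronglyMeasurable
    (Eventually.of_forall fun y => (norm_freeKernel τ _).le)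

/-- The free propagator on integrable functions, as an integral operator. -/
theorem coeFn_freeProp_toLp {τ : ℝ} (hτ : τ ≠ 0) {f : ℝ → ℂ} (hf : MemLp f 2 volume)
    (hf1 : Integrable f) :
    freeProp τ hf.toLp =ᵐ[volume] fun x => ∫ y, freeKernel τ (x - y) * f y := by
  have hcont : Continuous fun x => ∫ y, freeKernel τ (x - y) * f y := by
    refine continuous_of_dominated
      (bound := fun y => ‖(Real.pi / (I * τ) : ℂ) ^ (1 / 2 : ℂ)‖ * ‖f y‖)
      (fun x => (integrable_freeKernel_mul τ hf1 x).1) (fun x => Eventually.of_forall fun y => ?_)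
      (hf1.norm.const_mul _) (Eventually.of_forall fun y => ?_)
    · rw [norm_mul, norm_freeKernel]
    · exact ((continuous_freeKernel τ).comp (by fun_prop)).mul continuous_const
  refine ae_eq_of_integral_contDiff_smul_eq ((Lp.memLp _).locallyIntegrable one_le_two)
    hcont.locallyIntegrable fun g hg hgc => ?_
  have hψc : HasCompactSupport fun x => (g x : ℂ) := hgc.comp_left Complex.ofReal_zero
  let ψ : SchwartzMap ℝ ℂ := hψc.toSchwartzMap (Complex.ofRealCLM.contDiff.comp hg)
  have hψ : ∀ x, ψ x = g x := fun x => rfl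
  have h1 : ∫ x, g x • freeProp τ hf.toLp x = inner ℂ (freeProp (-τ) (ψ.toLp 2)) hf.toLp := by
    rw [← adjoint_freeProp, ContinuousLinearMap.adjoint_inner_left, inner_eq_integral]
    refine integral_congr_ae ?_
    filter_upwards [ψ.coeFn_toLp 2] with x hx
    rw [hx, hψ, Complex.conj_ofReal, Complex.real_smul]
  have h2 : inner ℂ (freeProp (-τ) (ψ.toLp 2)) hf.toLp =
      ∫ x, ∫ y, freeKernel τ (x - y) * ψ y * f x := by
    rw [inner_eq_integral]
    refine integral_congr_ae ?_
    filter_upwards [coeFn_freeProp_schwartz (neg_ne_zero.2 hτ) ψ, hf.coeFn_toLp] with x e1 e2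
    rw [e1, e2, ← integral_conj, ← integral_mul_const]
    refine integral_congr_ae (Eventually.of_forall fun y => ?_)
    simp only [map_mul, conj_freeKernel_neg hτ, hψ, Complex.conj_ofReal]
  rw [h1, h2, integral_integral_swap]
  · refine integral_congr_ae (Eventually.of_forall fun x => ?_)
    simp only [Complex.real_smul, ← hψ]
    rw [← integral_const_mul]
    refine integral_congr_ae (Eventually.of_forall fun y => ?_)
    have : freeKernel τ (y - x) = freeKernel τ (x - y) := by
      simp only [freeKernel]; congr 4; ring
    simp only [this]
    ring
  · have h3 : Integrable (fun p : ℝ × ℝ => f p.1 * ψ p.2) (volume.prod volume) :=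
      hf1.mul_prod ψ.integrable
    have h4 : Continuous fun p : ℝ × ℝ => freeKernel τ (p.1 - p.2) :=
      (continuous_freeKernel τ).comp (by fun_prop)
    refine (h3.bdd_mul h4.aestronglyMeasurable
      (Eventually.of_forall fun p => (norm_freeKernel τ _).le)).congr
      (Eventually.of_forall fun p => ?_)
    simp only [Function.uncurry]
    ring

end Free

/-! ### One time slice, and its expansion to first order -/

section TimeSlice

open scoped FourierTransform

theorem IsTestFunction.iteratedDeriv_two {φ : ℝ → ℂ} (hφ : IsTestFunction φ) :
    IsTestFunction (iteratedDeriv 2 φ) := by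
  have h : iteratedDeriv 2 φ = deriv (deriv φ) := by
    rw [iteratedDeriv_succ, iteratedDeriv_one]
  rw [h]
  exact ⟨ContDiff.iterate_deriv 2 hφ.1, hφ.2.deriv.deriv⟩

theorem IsTestFunction.memLp {φ : ℝ → ℂ} (hφ : IsTestFunction φ) (p : ℝ≥0∞) :
    MemLp φ p volume := hφ.1.continuous.memLp_of_hasCompactSupport hφ.2

theorem memLp_potential_mul {V : ℝ → ℝ} (hV : Measurable V)
    (hV2 : LocallyIntegrable (fun x => V x ^ 2) (volume : Measure ℝ)) {φ : ℝ → ℂ}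
    (hφ : Continuous φ) (hc : HasCompactSupport φ) :
    MemLp (fun x => (V x : ℂ) * φ x) 2 volume := by
  have hm : AEStronglyMeasurable (fun x => (V x : ℂ) * φ x) volume :=
    (Complex.measurable_ofReal.comp hV).aestronglyMeasurable.mul hφ.aestronglyMeasurable
  rw [memLp_two_iff_integrable_sq_norm hm]
  refine (hV2.integrable_smul_left_of_hasCompactSupport (g := fun x => ‖φ x‖ ^ 2)
    (by fun_prop) (hc.norm.comp_left (g := fun r : ℝ => r ^ 2) (by simp))).congr
    (Eventually.of_forall fun x => ?_)
  simp [mul_pow, mul_comm]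

theorem memLp_hamiltonian {m ħ : ℝ} {V : ℝ → ℝ} (hV : Measurable V)
    (hV2 : LocallyIntegrable (fun x => V x ^ 2) (volume : Measure ℝ)) {φ : ℝ → ℂ}
    (hφ : IsTestFunction φ) : MemLp (hamiltonian m ħ V φ) 2 volume :=
  ((hφ.iteratedDeriv_two.memLp 2).const_mul _).add
    (memLp_potential_mul hV hV2 hφ.1.continuous hφ.2)

theorem tendsto_exp_quotient (b : ℝ) :
    Tendsto (fun ε : ℝ => (ε⁻¹ : ℂ) * (cexp (I * (ε * b : ℝ)) - 1)) (𝓝[>] 0) (𝓝 (I * b)) := by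
  have h : HasDerivAt (fun ε : ℝ => cexp (I * (ε * b : ℝ))) (I * b) 0 := by
    have h1 : HasDerivAt (fun ε : ℝ => I * ((ε * b : ℝ) : ℂ)) (I * b) 0 := by
      simpa using ((hasDerivAt_id (0 : ℝ)).mul_const b).ofReal_comp.const_mul I
    simpa using h1.cexp
  have h2 := (hasDerivAt_iff_tendsto_slope_zero.1 h).mono_left
    (nhdsWithin_mono 0 (fun x (hx : 0 < x) => hx.ne'))
  refine h2.congr fun ε => ?_
  rw [Complex.real_smul]
  simp

theorem norm_exp_quotient_le (ε b : ℝ) :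
    ‖(ε⁻¹ : ℂ) * (cexp (I * (ε * b : ℝ)) - 1)‖ ≤ |b| := by
  rcases eq_or_ne ε 0 with rfl | hε
  · simp
  rw [norm_mul, norm_inv, Complex.norm_real, Real.norm_eq_abs]
  have h := Real.norm_exp_I_mul_ofReal_sub_one_le (x := ε * b)
  rw [Real.norm_eq_abs, abs_mul] at h
  rw [inv_mul_le_iff₀ (abs_pos.2 hε)]
  exact h

/-- The generator of a group of phase multiplications. -/
theorem tendsto_phase_quotient {b : ℝ → ℝ} (hb : Measurable b) {u w : L2}
    (hw : w =ᵐ[volume] fun x => I * b x * u x) :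
    Tendsto (fun ε : ℝ => ε⁻¹ • (mulL2 (isMultiplier_phase (hb.const_mul ε)) u - u))
      (𝓝[>] 0) (𝓝 w) := by
  refine tendsto_L2_of_dominated
    (F := fun ε x => ((ε⁻¹ : ℂ) * (cexp (I * (ε * b x : ℝ)) - 1)) * u x)
    (Eventually.of_forall fun ε => ?_) hw (Lp.memLp w).norm
    (Eventually.of_forall fun ε => ?_) ?_ ?_
  · filter_upwards [Lp.coeFn_smul ε⁻¹ (mulL2 (isMultiplier_phase (hb.const_mul ε)) u - u),
      Lp.coeFn_sub (mulL2 (isMultiplier_phase (hb.const_mul ε)) u) u,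
      coeFn_mulL2 (isMultiplier_phase (hb.const_mul ε)) u] with x h1 h2 h3
    rw [h1, Pi.smul_apply, h2, Pi.sub_apply, h3, Complex.real_smul]
    push_cast
    ring
  · filter_upwards [hw] with x hx
    have h1 : ‖I * (b x : ℂ)‖ = |b x| := by simp
    rw [hx, norm_mul, norm_mul (I * _), h1]
    gcongr
    exact norm_exp_quotient_le ε (b x)
  · filter_upwards [hw] with x hx
    rw [← hx]
  · exact Eventually.of_forall fun x => (tendsto_exp_quotient (b x)).mul_const (u x)

theorem mulL2_congr {g g' : ℝ → ℂ} (h : g = g') (hg : IsMultiplier g) (hg' : IsMultiplier g') :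
    mulL2 hg = mulL2 hg' := by
  subst h; rfl

theorem fourier_smul_L2 (a : ℂ) (v : L2) : (𝓕 (a • v) : L2) = a • 𝓕 v :=
  (Lp.fourierTransformₗᵢ ℝ ℂ).map_smul a v

/-- The generator of the free propagator, on the Fourier side. -/
theorem tendsto_freeProp_quotient (c : ℝ) {u w : L2}
    (hw : (𝓕 w : L2) =ᵐ[volume] fun ξ => I * ((c * ξ ^ 2 : ℝ) : ℂ) * (𝓕 u : L2) ξ) :
    Tendsto (fun ε : ℝ => ε⁻¹ • (freeProp (-(ε * c)) u - u)) (𝓝[>] 0) (𝓝 w) := by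
  have hb : Measurable fun ξ : ℝ => c * ξ ^ 2 := by fun_prop
  have h1 := ((Lp.fourierTransformₗᵢ ℝ ℂ).symm.continuous.tendsto _).comp
    (tendsto_phase_quotient hb hw)
  refine (h1.congr fun ε => ?_).trans_eq ?_
  · have e1 : ∀ (r : ℝ) (a b : L2), (Lp.fourierTransformₗᵢ ℝ ℂ).symm (r • (a - b)) =
        r • ((Lp.fourierTransformₗᵢ ℝ ℂ).symm a - (Lp.fourierTransformₗᵢ ℝ ℂ).symm b) := by
      intro r a b
      rw [← map_sub]
      exact (Lp.fourierTransformₗᵢ ℝ ℂ).symm.toContinuousLinearEquiv.toContinuousLinearMap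
        |>.map_smul_of_tower r _
    have e2 : (fun ξ : ℝ => cexp (I * ((-(-(ε * c) * ξ ^ 2) : ℝ) : ℂ))) =
        fun ξ : ℝ => cexp (I * ((ε * (c * ξ ^ 2) : ℝ) : ℂ)) := by
      funext ξ
      congr 3
      ring
    rw [Function.comp_apply, freeProp_apply, e1,
      mulL2_congr e2 _ (isMultiplier_phase (hb.const_mul ε))]
    congr 2
    exact (Lp.fourierTransformₗᵢ ℝ ℂ).symm_apply_apply _
  · congr 1
    exact (Lp.fourierTransformₗᵢ ℝ ℂ).symm_apply_apply _

theorem fourier_iteratedDeriv_two {φ φ'' : SchwartzMap ℝ ℂ}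
    (h : (φ'' : ℝ → ℂ) = iteratedDeriv 2 φ) (ξ : ℝ) :
    𝓕 φ'' ξ = -(4 * Real.pi ^ 2 * ξ ^ 2) * 𝓕 φ ξ := by
  have hint : ∀ n : ℕ, (n : ℕ∞) ≤ 2 → Integrable (iteratedDeriv n φ) := by
    intro n hn
    have hn : n ≤ 2 := by exact_mod_cast hn
    interval_cases n
    · simpa using φ.integrable
    · have := (SchwartzMap.derivCLM ℂ ℂ φ).integrable (μ := volume)
      rw [iteratedDeriv_one]
      exact this
    · rw [← h]; exact φ''.integrable
  have h1 := congrFun (Real.fourier_iteratedDeriv (N := 2) (φ.smooth 2) hint (n := 2) le_rfl) ξ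
  rw [SchwartzMap.fourier_coe, h, h1, SchwartzMap.fourier_coe, smul_eq_mul]
  linear_combination (4 * Real.pi ^ 2 * ξ ^ 2 * 𝓕 (φ : ℝ → ℂ) ξ) * Complex.I_sq

theorem coeFn_fourier_smul_iteratedDeriv_two (c : ℝ) {φ φ'' : SchwartzMap ℝ ℂ}
    (h : (φ'' : ℝ → ℂ) = iteratedDeriv 2 φ) {u v : L2} (hu : u = φ.toLp 2)
    (hv : v = φ''.toLp 2) :
    (𝓕 ((-(I * c / (4 * Real.pi ^ 2)) : ℂ) • v) : L2) =ᵐ[volume]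
      fun ξ => I * ((c * ξ ^ 2 : ℝ) : ℂ) * (𝓕 u : L2) ξ := by
  have h1 : (𝓕 u : L2) =ᵐ[volume] (𝓕 φ : SchwartzMap ℝ ℂ) := by
    rw [hu, SchwartzMap.toLp_fourier_eq]; exact SchwartzMap.coeFn_toLp _ 2 volume
  have h2 : (𝓕 v : L2) =ᵐ[volume] (𝓕 φ'' : SchwartzMap ℝ ℂ) := by
    rw [hv, SchwartzMap.toLp_fourier_eq]; exact SchwartzMap.coeFn_toLp _ 2 volume
  rw [fourier_smul_L2]
  filter_upwards [Lp.coeFn_smul (-(I * c / (4 * Real.pi ^ 2)) : ℂ) (𝓕 v : L2), h1, h2]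
    with ξ e1 e2 e3
  rw [e1, Pi.smul_apply, e3, e2, fourier_iteratedDeriv_two h, smul_eq_mul]
  have hπ : (Real.pi : ℂ) ≠ 0 := by exact_mod_cast Real.pi_ne_zero
  push_cast
  field_simp

/-- The coefficient `c` such that the free evolution over time `ε` is `freeProp (ε c)`. -/
noncomputable def freeRate (m ħ : ℝ) : ℝ := 2 * Real.pi ^ 2 * ħ / m

/-- The operator of one time slice of length `ε`: the phase of the potential followed by the
free evolution. -/
noncomputable def sliceOp (m ħ : ℝ) {V : ℝ → ℝ} (hV : Measurable V) (ε : ℝ) : L2 →L[ℂ] L2 :=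
  freeProp (ε * freeRate m ħ) ∘L
    mulL2 (isMultiplier_phase (θ := fun x => ε * (-V x / ħ)) (by fun_prop))

theorem norm_sliceOp_apply_le (m ħ : ℝ) {V : ℝ → ℝ} (hV : Measurable V) (ε : ℝ) (u : L2) :
    ‖sliceOp m ħ hV ε u‖ ≤ ‖u‖ :=
  (norm_freeProp_apply_le _ _).trans (norm_mulL2_apply_le _ _)

theorem adjoint_sliceOp_apply (m ħ : ℝ) {V : ℝ → ℝ} (hV : Measurable V) (ε : ℝ) (u : L2) :
    (sliceOp m ħ hV ε).adjoint u =
      mulL2 (isMultiplier_phase ((hV.div_const ħ).const_mul ε))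
        (freeProp (-(ε * freeRate m ħ)) u) := by
  rw [sliceOp, ContinuousLinearMap.adjoint_comp, adjoint_freeProp, adjoint_mulL2]
  rw [mulL2_congr _ _ (isMultiplier_phase ((hV.div_const ħ).const_mul ε))]
  · rfl
  · funext x
    rw [← Complex.exp_conj, map_mul, Complex.conj_I, Complex.conj_ofReal]
    congr 1
    push_cast
    ring

/-- The time slices agree with the evolution to first order. Only the adjoints are expanded, on test
functions, where `V φ` is square-integrable although `V` need not be bounded. -/
theorem isProductFormula_sliceOp {m ħ : ℝ} (hħ : 0 < ħ) {V : ℝ → ℝ} (hV : Measurable V)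
    (hV2 : LocallyIntegrable (fun x => V x ^ 2) (volume : Measure ℝ)) :
    IsProductFormula (generatorGraph m ħ V) (sliceOp m ħ hV) where
  contraction ε _ := ContinuousLinearMap.opNorm_le_bound _ zero_le_one fun u => by
    rw [one_mul]; exact norm_sliceOp_apply_le m ħ hV ε u
  tendsto := by
    rintro _ ⟨⟨u, w⟩, ⟨φ, hφ, hu, hw⟩, rfl⟩
    simp only at hu hw ⊢
    let φS : SchwartzMap ℝ ℂ := hφ.2.toSchwartzMap hφ.1
    let φS'' : SchwartzMap ℝ ℂ := hφ.iteratedDeriv_two.2.toSchwartzMap hφ.iteratedDeriv_two.1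
    have hφS : ∀ x, φS x = φ x := fun x => rfl
    have hφS'' : ∀ x, φS'' x = iteratedDeriv 2 φ x := fun x => rfl
    have hu' : u = φS.toLp 2 := Lp.ext (hu.trans (φS.coeFn_toLp 2).symm)
    have hVφ := memLp_potential_mul hV hV2 hφ.1.continuous hφ.2
    have hkin := tendsto_freeProp_quotient (freeRate m ħ)
      (coeFn_fourier_smul_iteratedDeriv_two (freeRate m ħ) (φ := φS) (φ'' := φS'') rfl hu' rfl)
    have hpot : Tendsto (fun ε : ℝ =>
        ε⁻¹ • (mulL2 (isMultiplier_phase ((hV.div_const ħ).const_mul ε)) u - u))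
        (𝓝[>] 0) (𝓝 ((I / ħ : ℂ) • hVφ.toLp)) := by
      refine tendsto_phase_quotient (hV.div_const ħ) ?_
      filter_upwards [Lp.coeFn_smul (I / ħ : ℂ) hVφ.toLp, hVφ.coeFn_toLp, hu] with x e1 e2 e3
      rw [e1, Pi.smul_apply, e2, e3, smul_eq_mul]
      push_cast
      ring
    -- The phases are uniformly bounded and converge strongly to the identity.
    have hstrong : ∀ v : L2, Tendsto (fun ε : ℝ =>
        mulL2 (isMultiplier_phase ((hV.div_const ħ).const_mul ε)) v) (𝓝[>] 0) (𝓝 v) := by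
      refine fun v => tendsto_mulL2 _ (fun x => ?_) v
      have : Tendsto (fun ε : ℝ => cexp (I * (ε * (V x / ħ) : ℝ))) (𝓝 0)
          (𝓝 (cexp (I * (0 * (V x / ħ) : ℝ)))) := Continuous.tendsto (by fun_prop) 0
      simpa using this.mono_left nhdsWithin_le_nhds
    have hkin' : Tendsto (fun ε : ℝ =>
        mulL2 (isMultiplier_phase ((hV.div_const ħ).const_mul ε))
          (ε⁻¹ • (freeProp (-(ε * freeRate m ħ)) u - u))) (𝓝[>] 0)
        (𝓝 ((-(I * freeRate m ħ / (4 * Real.pi ^ 2)) : ℂ) • (φS''.toLp 2 : L2))) := by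
      set A := (-(I * freeRate m ħ / (4 * Real.pi ^ 2)) : ℂ) • (φS''.toLp 2 : L2)
      have h1 := (hstrong A)
      have h2 : Tendsto (fun ε : ℝ =>
          mulL2 (isMultiplier_phase ((hV.div_const ħ).const_mul ε))
            (ε⁻¹ • (freeProp (-(ε * freeRate m ħ)) u - u) - A)) (𝓝[>] 0) (𝓝 0) := by
        refine squeeze_zero_norm (fun ε => norm_mulL2_apply_le _ _) ?_
        simpa using (hkin.sub_const A).norm
      have h3 := h2.add h1
      rw [zero_add] at h3
      refine h3.congr fun ε => ?_
      rw [← map_add, sub_add_cancel]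
    have hsum := hkin'.add hpot
    refine (hsum.congr fun ε => ?_).trans_eq ?_
    · rw [adjoint_sliceOp_apply, ContinuousLinearMap.map_smul_of_tower, map_sub, ← smul_add,
        sub_add_sub_cancel]
      rfl
    · congr 1
      refine Lp.ext ?_
      filter_upwards [Lp.coeFn_add ((-(I * freeRate m ħ / (4 * Real.pi ^ 2)) : ℂ) •
        (φS''.toLp 2 : L2)) ((I / ħ : ℂ) • hVφ.toLp), Lp.coeFn_smul (I / ħ : ℂ) hVφ.toLp,
        hVφ.coeFn_toLp,
        Lp.coeFn_smul (-(I * freeRate m ħ / (4 * Real.pi ^ 2)) : ℂ) (φS''.toLp 2 : L2),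
        φS''.coeFn_toLp 2, hw, Lp.coeFn_smul (I / ħ : ℂ) w] with x e1 e2 e3 e4 e5 e6 e7
      rw [e1, Pi.add_apply, e2, Pi.smul_apply, e3, e4, Pi.smul_apply, e5, e7, Pi.smul_apply, e6,
        hφS'']
      simp only [hamiltonian, freeRate, smul_eq_mul]
      have hπ : (Real.pi : ℂ) ≠ 0 := by exact_mod_cast Real.pi_ne_zero
      have hħ' : (ħ : ℂ) ≠ 0 := by exact_mod_cast hħ.ne'
      push_cast
      field_simp
      ring
  dense := by
    refine (Lp.dense_hasCompactSupport_contDiff (F := ℂ) (μ := (volume : Measure ℝ))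
      (p := 2) (by simp)).mono ?_
    rintro u ⟨φ, hu, hc, hφ⟩
    have hH := memLp_hamiltonian (m := m) (ħ := ħ) hV hV2 ⟨hφ, hc⟩
    exact ⟨_, ⟨(u, hH.toLp), ⟨φ, ⟨hφ, hc⟩, hu, hH.coeFn_toLp⟩, rfl⟩, rfl⟩

end TimeSlice

/-! ### The sliced kernel as an iterated integral -/

section SlicedKernel

/-- The contribution of one time slice, from the position `y` to the position `x`. -/
noncomputable def sliceFactor (m ħ : ℝ) (V : ℝ → ℝ) (ε x y : ℝ) : ℂ :=
  cexp (I / ħ * (ε * (m / 2 * ((x - y) / ε) ^ 2 - V y) : ℝ))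

/-- The sliced kernel without its normalizing factor, as an iterated integral. -/
noncomputable def rawKernel (m ħ : ℝ) (V : ℝ → ℝ) (ε R : ℝ) : ℕ → ℝ → ℝ → ℂ
  | 0, x, y => sliceFactor m ħ V ε x y
  | n + 1, x, y => ∫ q in Icc (-R) R, sliceFactor m ħ V ε x q * rawKernel m ħ V ε R n q y

theorem norm_sliceFactor (m ħ : ℝ) (V : ℝ → ℝ) (ε x y : ℝ) : ‖sliceFactor m ħ V ε x y‖ = 1 := by
  have h : I / ħ * ((ε * (m / 2 * ((x - y) / ε) ^ 2 - V y) : ℝ) : ℂ) =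
      I * ((ε * (m / 2 * ((x - y) / ε) ^ 2 - V y) / ħ : ℝ) : ℂ) := by push_cast; ring
  rw [sliceFactor, h, Complex.norm_exp_I_mul_ofReal]

variable {m ħ : ℝ} {V : ℝ → ℝ}

theorem _root_.Measurable.sliceFactor {α : Type*} [MeasurableSpace α] {f g : α → ℝ}
    (hV : Measurable V) (ε : ℝ) (hf : Measurable f) (hg : Measurable g) :
    Measurable fun a => sliceFactor m ħ V ε (f a) (g a) := by
  unfold PathIntegral.sliceFactor
  fun_prop

theorem stronglyMeasurable_rawKernel (hV : Measurable V) (ε R : ℝ) (n : ℕ) :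
    StronglyMeasurable fun p : ℝ × ℝ => rawKernel m ħ V ε R n p.1 p.2 := by
  induction n with
  | zero => exact (hV.sliceFactor ε measurable_fst measurable_snd).stronglyMeasurable
  | succ n ih =>
    refine StronglyMeasurable.integral_prod_right
      (f := fun (p : ℝ × ℝ) q => sliceFactor m ħ V ε p.1 q * rawKernel m ħ V ε R n q p.2) ?_
    refine StronglyMeasurable.mul ?_ ?_
    · exact (hV.sliceFactor ε (measurable_fst.comp measurable_fst)
        measurable_snd).stronglyMeasurable
    · exact ih.comp_measurable (g := fun z : (ℝ × ℝ) × ℝ => (z.2, z.1.2)) (by fun_prop)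

theorem norm_rawKernel_le (ε R : ℝ) (n : ℕ) (x y : ℝ) :
    ‖rawKernel m ħ V ε R n x y‖ ≤ (volume.real (Icc (-R) R)) ^ n := by
  induction n generalizing x with
  | zero => simp [rawKernel, norm_sliceFactor]
  | succ n ih =>
    rw [rawKernel, pow_succ]
    refine norm_setIntegral_le_of_norm_le_const measure_Icc_lt_top fun q _ => ?_
    rw [norm_mul, norm_sliceFactor, one_mul]
    exact ih q

theorem exp_slicedAction (ε : ℝ) {n : ℕ} (x : Fin (n + 2) → ℝ) :
    cexp (I / ħ * (slicedAction m V ε x : ℝ)) =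
      ∏ j : Fin (n + 1), sliceFactor m ħ V ε (x j.succ) (x j.castSucc) := by
  simp only [sliceFactor, ← Complex.exp_sum, slicedAction]
  congr 1
  push_cast
  rw [Finset.mul_sum, Finset.mul_sum]

theorem slicedPath_snoc {n : ℕ} (xf xi y : ℝ) (q : Fin n → ℝ) :
    slicedPath xf xi (Fin.snoc (α := fun _ => ℝ) q y) =
      Fin.snoc (α := fun _ => ℝ) (slicedPath y xi q) xf := by
  unfold slicedPath
  exact Fin.cons_snoc_eq_snoc_cons _ _ _

theorem exp_slicedAction_snoc (ε : ℝ) {n : ℕ} (xf xi y : ℝ) (q : Fin n → ℝ) :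
    cexp (I / ħ * (slicedAction m V ε (slicedPath xf xi (Fin.snoc (α := fun _ => ℝ) q y)) : ℝ)) =
      sliceFactor m ħ V ε xf y * cexp (I / ħ * (slicedAction m V ε (slicedPath y xi q) : ℝ)) := by
  rw [exp_slicedAction, exp_slicedAction, slicedPath_snoc, Fin.prod_univ_castSucc, mul_comm]
  have hlast : slicedPath y xi q (Fin.last (n + 1)) = y := by
    rw [slicedPath, ← Fin.succ_last, Fin.cons_succ, Fin.snoc_last]
  congr 1
  · rw [Fin.succ_last, Fin.snoc_last, Fin.snoc_castSucc, hlast]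
  · refine Finset.prod_congr rfl fun j _ => ?_
    rw [Fin.succ_castSucc, Fin.snoc_castSucc, Fin.snoc_castSucc]

theorem measurable_slicedPath {n : ℕ} (xf xi : ℝ) (j : Fin (n + 2)) :
    Measurable fun q : Fin n → ℝ => slicedPath xf xi q j := by
  unfold slicedPath
  induction j using Fin.cases with
  | zero => simp
  | succ j =>
    simp only [Fin.cons_succ]
    induction j using Fin.lastCases with
    | last => simp
    | cast j => simpa using measurable_pi_apply j

theorem measurable_exp_slicedAction (hV : Measurable V) (ε : ℝ) {n : ℕ} (xf xi : ℝ) :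
    Measurable fun q : Fin n → ℝ =>
      cexp (I / ħ * (slicedAction m V ε (slicedPath xf xi q) : ℝ)) := by
  have h : (fun q : Fin n → ℝ => cexp (I / ħ * (slicedAction m V ε (slicedPath xf xi q) : ℝ))) =
      fun q => ∏ j : Fin (n + 1), sliceFactor m ħ V ε (slicedPath xf xi q j.succ)
        (slicedPath xf xi q j.castSucc) := funext fun q => exp_slicedAction ε _
  rw [h]
  exact Finset.measurable_fun_prod _ fun j _ => hV.sliceFactor ε
    (measurable_slicedPath xf xi j.succ) (measurable_slicedPath xf xi j.castSucc)

/-- The multiple integral over the intermediate positions is an iterated integral. -/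
theorem integral_exp_slicedAction (hV : Measurable V) (ε R : ℝ) (n : ℕ) (xf xi : ℝ) :
    ∫ q in {q : Fin n → ℝ | ∀ j, |q j| ≤ R},
      cexp (I / ħ * (slicedAction m V ε (slicedPath xf xi q) : ℝ)) =
    rawKernel m ħ V ε R n xf xi := by
  induction n generalizing xf with
  | zero =>
    have h0 : {q : Fin 0 → ℝ | ∀ j, |q j| ≤ R} = univ := by
      ext q; simp
    rw [h0, setIntegral_univ, Measure.volume_pi_eq_dirac (default : Fin 0 → ℝ), integral_dirac]
    rw [exp_slicedAction]
    simp [rawKernel, slicedPath]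
    rfl
  | succ n ih =>
    let e := MeasurableEquiv.piFinSuccAbove (fun _ : Fin (n + 1) => ℝ) (Fin.last n)
    have he := volume_preserving_piFinSuccAbove (fun _ : Fin (n + 1) => ℝ) (Fin.last n)
    have hsymm : ∀ z : ℝ × (Fin n → ℝ), e.symm z = Fin.snoc (α := fun _ => ℝ) z.2 z.1 := by
      intro z
      exact Fin.insertNth_last' _ _
    have hset : e.symm ⁻¹' {q : Fin (n + 1) → ℝ | ∀ j, |q j| ≤ R} =
        Icc (-R) R ×ˢ {q : Fin n → ℝ | ∀ j, |q j| ≤ R} := by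
      ext z
      simp only [mem_preimage, mem_ofPred_eq, hsymm, mem_prod, mem_Icc, ← abs_le]
      rw [Fin.forall_fin_succ']
      simp only [Fin.snoc_castSucc, Fin.snoc_last]
      exact and_comm
    have hfin : volume {q : Fin n → ℝ | ∀ j, |q j| ≤ R} < ⊤ := by
      have : {q : Fin n → ℝ | ∀ j, |q j| ≤ R} = univ.pi fun _ => Icc (-R) R := by
        ext q; simp only [mem_ofPred_eq, mem_univ_pi, mem_Icc, abs_le]
      rw [this]
      exact (isCompact_univ_pi fun _ => isCompact_Icc).measure_lt_top
    rw [← (he.symm e).setIntegral_preimage_emb e.symm.measurableEmbedding, hset,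
      Measure.volume_eq_prod, setIntegral_prod]
    · rw [rawKernel]
      refine setIntegral_congr_fun measurableSet_Icc fun y _ => ?_
      simp only [hsymm, exp_slicedAction_snoc]
      rw [integral_const_mul, ih]
    · refine Measure.integrableOn_of_bounded (M := 1) ?_ ?_ ?_
      · rw [Measure.prod_prod]
        exact ENNReal.mul_ne_top measure_Icc_lt_top.ne hfin.ne
      · exact ((measurable_exp_slicedAction hV ε xf xi).comp e.symm.measurable).aestronglyMeasurable
      · refine Eventually.of_forall fun z => ?_
        rw [exp_slicedAction, norm_prod]
        simp [norm_sliceFactor]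

theorem slicedKernel_eq (hV : Measurable V) (ti tf : ℝ) (n : ℕ) (R xf xi : ℝ) :
    slicedKernel m ħ V ti tf n R xf xi =
      ((m : ℂ) * (n + 1) / (2 * I * Real.pi * ħ * (tf - ti))) ^ (((n : ℂ) + 1) / 2) *
        rawKernel m ħ V ((tf - ti) / (n + 1)) R n xf xi := by
  rw [slicedKernel, integral_exp_slicedAction hV]

end SlicedKernel

/-! ### The sliced kernel as a product of operators -/

section SlicedOperators

variable {m ħ : ℝ} {V : ℝ → ℝ}

/-- The normalizing factor of one time slice. -/
noncomputable def sliceNorm (m ħ ε : ℝ) : ℂ :=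
  (Real.pi / (I * (ε * freeRate m ħ : ℝ)) : ℂ) ^ (1 / 2 : ℂ)

theorem sliceNorm_mul_sliceFactor (hm : 0 < m) (hħ : 0 < ħ) {ε : ℝ} (hε : 0 < ε) (x y : ℝ) :
    sliceNorm m ħ ε * sliceFactor m ħ V ε x y =
      freeKernel (ε * freeRate m ħ) (x - y) * cexp (I * (ε * (-V y / ħ) : ℝ)) := by
  rw [freeKernel, mul_assoc, ← Complex.exp_add, sliceNorm, sliceFactor]
  congr 2
  have h1 : Real.pi ^ 2 * (x - y) ^ 2 / (ε * freeRate m ħ) =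
      ε * (m / 2 * ((x - y) / ε) ^ 2) / ħ := by
    have := Real.pi_ne_zero
    rw [freeRate]
    field_simp
  rw [h1]
  have hħ' : (ħ : ℂ) ≠ 0 := by exact_mod_cast hħ.ne'
  have hε' : (ε : ℂ) ≠ 0 := by exact_mod_cast hε.ne'
  push_cast
  field_simp
  ring

/-- The factors of the slices combine to the principal branch of the power in the definition of the
sliced kernel, because the exponent is a natural multiple of `1 / 2`. -/
theorem pow_sliceNorm (hm : 0 < m) (hħ : 0 < ħ) {ti tf : ℝ} (ht : ti < tf) (n : ℕ) :
    sliceNorm m ħ ((tf - ti) / (n + 1)) ^ (n + 1) =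
      ((m : ℂ) * (n + 1) / (2 * I * Real.pi * ħ * (tf - ti))) ^ (((n : ℂ) + 1) / 2) := by
  have h1 : (((n : ℂ) + 1) / 2) = ((n + 1 : ℕ) : ℂ) * (1 / 2 : ℂ) := by push_cast; ring
  rw [h1, Complex.cpow_nat_mul, sliceNorm]
  congr 2
  have hm' : (m : ℂ) ≠ 0 := by exact_mod_cast hm.ne'
  have hħ' : (ħ : ℂ) ≠ 0 := by exact_mod_cast hħ.ne'
  have hπ : (Real.pi : ℂ) ≠ 0 := by exact_mod_cast Real.pi_ne_zero
  have ht' : (tf - ti : ℂ) ≠ 0 := by exact_mod_cast (sub_pos.2 ht).ne'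
  have hn : ((n : ℂ) + 1) ≠ 0 := by exact_mod_cast n.succ_ne_zero
  rw [freeRate]
  push_cast
  field_simp

theorem coeFn_sliceOp_toLp (hm : 0 < m) (hħ : 0 < ħ) (hV : Measurable V) {ε : ℝ} (hε : 0 < ε)
    {g : ℝ → ℂ} (hg : MemLp g 2 volume) (hg1 : Integrable g) :
    sliceOp m ħ hV ε hg.toLp =ᵐ[volume]
      fun x => sliceNorm m ħ ε * ∫ y, sliceFactor m ħ V ε x y * g y := by
  have hτ : ε * freeRate m ħ ≠ 0 := by
    rw [freeRate]
    have := Real.pi_pos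
    positivity
  have hmul := isMultiplier_phase (θ := fun x => ε * (-V x / ħ)) (by fun_prop)
  have h1 : Integrable (fun x => cexp (I * (ε * (-V x / ħ) : ℝ)) * g x) :=
    memLp_one_iff_integrable.1 (hmul.memLp (memLp_one_iff_integrable.2 hg1))
  have h2 : mulL2 hmul hg.toLp = (hmul.memLp hg).toLp := by
    refine Lp.ext ?_
    filter_upwards [coeFn_mulL2 hmul hg.toLp, hg.coeFn_toLp, (hmul.memLp hg).coeFn_toLp]
      with x e1 e2 e3
    rw [e1, e2, e3]
  have h3 : sliceOp m ħ hV ε hg.toLp = freeProp (ε * freeRate m ħ) (hmul.memLp hg).toLp := by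
    rw [← h2]; rfl
  rw [h3]
  filter_upwards [coeFn_freeProp_toLp hτ (hmul.memLp hg) h1] with x hx
  rw [hx, ← integral_const_mul]
  refine integral_congr_ae (Eventually.of_forall fun y => ?_)
  simp only [← mul_assoc]
  rw [sliceNorm_mul_sliceFactor hm hħ hε]

/-- The operator restricting functions to `[-R, R]`. -/
noncomputable def cutoff (R : ℝ) : L2 →L[ℂ] L2 :=
  mulL2 (isMultiplier_indicator (measurableSet_Icc (a := -R) (b := R)))

theorem norm_cutoff_apply_le (R : ℝ) (u : L2) : ‖cutoff R u‖ ≤ ‖u‖ := norm_mulL2_apply_le _ u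

theorem tendsto_cutoff (u : L2) : Tendsto (fun R => cutoff R u) atTop (𝓝 u) := by
  refine tendsto_mulL2 _ (fun x => ?_) u
  refine tendsto_const_nhds.congr' ?_
  filter_upwards [eventually_ge_atTop |x|] with R hR
  rw [indicator_of_mem (mem_Icc.2 (abs_le.1 hR))]

/-- The result of `n + 1` time slices applied to `u`, with the `n` intermediate positions
restricted to `[-R, R]`. -/
noncomputable def sliceVec (m ħ : ℝ) (hV : Measurable V) (ε R : ℝ) (u : L2) : ℕ → L2
  | 0 => sliceOp m ħ hV ε u
  | n + 1 => sliceOp m ħ hV ε (cutoff R (sliceVec m ħ hV ε R u n))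

theorem norm_sliceVec_le (hV : Measurable V) (ε R : ℝ) (u : L2) (n : ℕ) :
    ‖sliceVec m ħ hV ε R u n‖ ≤ ‖u‖ := by
  induction n with
  | zero => exact norm_sliceOp_apply_le m ħ hV ε u
  | succ n ih =>
    exact (norm_sliceOp_apply_le m ħ hV ε _).trans ((norm_cutoff_apply_le R _).trans ih)

/-- Removing the cutoffs: the improper integrals over the intermediate positions converge. -/
theorem tendsto_sliceVec (hV : Measurable V) (ε : ℝ) (u : L2) (n : ℕ) :
    Tendsto (fun R => sliceVec m ħ hV ε R u n) atTop (𝓝 ((sliceOp m ħ hV ε ^ (n + 1)) u)) := by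
  induction n with
  | zero => simp [sliceVec]
  | succ n ih =>
    set w := (sliceOp m ħ hV ε ^ (n + 1)) u
    have h1 : Tendsto (fun R => cutoff R (sliceVec m ħ hV ε R u n)) atTop (𝓝 w) := by
      have h2 : Tendsto (fun R => cutoff R (sliceVec m ħ hV ε R u n - w)) atTop (𝓝 0) := by
        refine squeeze_zero_norm (fun R => norm_cutoff_apply_le R _) ?_
        simpa using (ih.sub_const w).norm
      have h3 := h2.add (tendsto_cutoff w)
      rw [zero_add] at h3
      refine h3.congr fun R => ?_
      rw [← map_add, sub_add_cancel]
    rw [pow_succ', mul_apply_eq_comp]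
    exact ((sliceOp m ħ hV ε).continuous.tendsto w).comp h1

/-- The operator product with cutoffs has the normalized iterated integral as its kernel. -/
theorem coeFn_sliceVec (hm : 0 < m) (hħ : 0 < ħ) (hV : Measurable V) {ε : ℝ} (hε : 0 < ε) (R : ℝ)
    {f : ℝ → ℂ} (hf : MemLp f 2 volume) (hf1 : Integrable f) (n : ℕ) :
    sliceVec m ħ hV ε R hf.toLp n =ᵐ[volume]
      fun x => sliceNorm m ħ ε ^ (n + 1) * ∫ y, rawKernel m ħ V ε R n x y * f y := by
  induction n with
  | zero =>
    simp only [sliceVec, zero_add, pow_one, rawKernel]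
    exact coeFn_sliceOp_toLp hm hħ hV hε hf hf1
  | succ n ih =>
    set g₀ : ℝ → ℂ := fun x => sliceNorm m ħ ε ^ (n + 1) * ∫ y, rawKernel m ħ V ε R n x y * f y
      with hg₀
    set g : ℝ → ℂ := (Icc (-R) R).indicator g₀ with hg
    have hg₀m : AEStronglyMeasurable g₀ volume := (Lp.aestronglyMeasurable _).congr ih
    have hcut : cutoff R (sliceVec m ħ hV ε R hf.toLp n) =ᵐ[volume] g := by
      filter_upwards [ih, coeFn_mulL2
        (isMultiplier_indicator (measurableSet_Icc (a := -R) (b := R)))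
        (sliceVec m ħ hV ε R hf.toLp n)] with x e1 e2
      rw [cutoff, e2, e1, hg]
      by_cases hx : x ∈ Icc (-R) R <;> simp [hx]
    have hg2 : MemLp g 2 volume := (memLp_congr_ae hcut).1 (Lp.memLp _)
    have hg1 : Integrable g := by
      rw [hg, integrable_indicator_iff measurableSet_Icc]
      refine Measure.integrableOn_of_bounded (M := ‖sliceNorm m ħ ε ^ (n + 1)‖ *
        ∫ y, volume.real (Icc (-R) R) ^ n * ‖f y‖) measure_Icc_lt_top.ne hg₀m
        (Eventually.of_forall fun x => ?_)
      rw [hg₀, norm_mul]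
      gcongr
      refine norm_integral_le_of_norm_le (hf1.norm.const_mul _) (Eventually.of_forall fun y => ?_)
      rw [norm_mul]
      gcongr
      exact norm_rawKernel_le ε R n x y
    have hcut' : cutoff R (sliceVec m ħ hV ε R hf.toLp n) = hg2.toLp :=
      Lp.ext (hcut.trans hg2.coeFn_toLp.symm)
    rw [sliceVec, hcut']
    refine (coeFn_sliceOp_toLp hm hħ hV hε hg2 hg1).trans (Eventually.of_forall fun x => ?_)
    have hswap : ∫ q in Icc (-R) R, ∫ y,
        sliceFactor m ħ V ε x q * rawKernel m ħ V ε R n q y * f y =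
        ∫ y, ∫ q in Icc (-R) R, sliceFactor m ħ V ε x q * rawKernel m ħ V ε R n q y * f y := by
      refine integral_integral_swap ?_
      have h1 : Integrable (fun p : ℝ × ℝ => (1 : ℂ) * f p.2)
          ((volume.restrict (Icc (-R) R)).prod volume) :=
        Integrable.mul_prod (integrable_const _) hf1
      simp only [one_mul] at h1
      refine h1.bdd_mul (c := 1 * volume.real (Icc (-R) R) ^ n)
        (f := fun p : ℝ × ℝ => sliceFactor m ħ V ε x p.1 * rawKernel m ħ V ε R n p.1 p.2) ?_ ?_
      · exact (hV.sliceFactor ε measurable_const measurable_fst).aestronglyMeasurable.mul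
          (stronglyMeasurable_rawKernel hV ε R n).aestronglyMeasurable
      · refine Eventually.of_forall fun p => ?_
        rw [norm_mul, norm_sliceFactor]
        gcongr
        exact norm_rawKernel_le ε R n _ _
    simp only [rawKernel]
    have h2 : ∫ y, sliceFactor m ħ V ε x y * g y = sliceNorm m ħ ε ^ (n + 1) *
        ∫ q in Icc (-R) R, ∫ y, sliceFactor m ħ V ε x q * rawKernel m ħ V ε R n q y * f y := by
      rw [← integral_const_mul, ← integral_indicator measurableSet_Icc]
      refine integral_congr_ae (Eventually.of_forall fun q => ?_)
      simp only [hg]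
      by_cases hq : q ∈ Icc (-R) R
      · simp only [indicator_of_mem hq, hg₀]
        rw [mul_left_comm, ← integral_const_mul]
        simp only [mul_assoc]
      · simp [indicator_of_notMem hq]
    simp only [h2, hswap, integral_mul_const]
    ring

/-- The sliced kernel is bounded, uniformly in the positions. -/
theorem exists_norm_slicedKernel_le (hV : Measurable V) (ti tf : ℝ) (n : ℕ) (R : ℝ) :
    ∃ C, ∀ xf xi, ‖slicedKernel m ħ V ti tf n R xf xi‖ ≤ C := by
  refine ⟨‖((m : ℂ) * (n + 1) / (2 * I * Real.pi * ħ * (tf - ti))) ^ (((n : ℂ) + 1) / 2)‖ *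
    volume.real (Icc (-R) R) ^ n, fun xf xi => ?_⟩
  rw [slicedKernel_eq hV, norm_mul]
  exact mul_le_mul_of_nonneg_left (norm_rawKernel_le _ R n xf xi) (norm_nonneg _)

theorem stronglyMeasurable_slicedKernel (hV : Measurable V) (ti tf : ℝ) (n : ℕ) (R : ℝ) :
    StronglyMeasurable fun p : ℝ × ℝ => slicedKernel m ħ V ti tf n R p.1 p.2 := by
  simp only [slicedKernel_eq hV]
  exact (stronglyMeasurable_rawKernel hV _ R n).const_mul _

theorem _root_.MeasureTheory.MemLp.conj {φ : ℝ → ℂ} (hφ : MemLp φ 2 volume) :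
    MemLp (fun x => (starRingEnd ℂ) (φ x)) 2 volume := hφ.star

/-- The sliced kernel paired with a product `φ(x_f) f(x_i)`. -/
theorem slicedPairing_mul (hm : 0 < m) (hħ : 0 < ħ) (hV : Measurable V) {ti tf : ℝ} (ht : ti < tf)
    (n : ℕ) (R : ℝ) {φ f : ℝ → ℂ} (hφ : MemLp φ 2 volume) (hφ1 : Integrable φ)
    (hf : MemLp f 2 volume) (hf1 : Integrable f) :
    slicedPairing m ħ V ti tf n R (fun p => φ p.1 * f p.2) =
      inner ℂ hφ.conj.toLp (sliceVec m ħ hV ((tf - ti) / (n + 1)) R hf.toLp n) := by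
  have hε : 0 < (tf - ti) / (n + 1) := by
    have := sub_pos.2 ht
    positivity
  obtain ⟨C, hC⟩ := exists_norm_slicedKernel_le (m := m) (ħ := ħ) hV ti tf n R
  rw [slicedPairing, Measure.volume_eq_prod, integral_prod, inner_eq_integral]
  · refine integral_congr_ae ?_
    filter_upwards [hφ.conj.coeFn_toLp, coeFn_sliceVec hm hħ hV hε R hf hf1 n] with x e1 e2
    rw [e1, e2, Complex.conj_conj, pow_sliceNorm hm hħ ht, ← integral_const_mul,
      ← integral_const_mul]
    refine integral_congr_ae (Eventually.of_forall fun y => ?_)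
    simp only [slicedKernel_eq hV]
    ring
  · exact (hφ1.mul_prod hf1).bdd_mul
      (stronglyMeasurable_slicedKernel hV ti tf n R).aestronglyMeasurable
      (Eventually.of_forall fun p => hC p.1 p.2)

end SlicedOperators

/-! ### The path integral and the evolution operators -/

section Evolution

variable {m ħ : ℝ} {V : ℝ → ℝ}

/-- The operators `U s`, `s ≥ 0`, are the weak limits of the products of time slices, and
solve the Schrödinger equation weakly. -/
structure IsEvolution (m ħ : ℝ) (hV : Measurable V) (U : ℝ → L2 →L[ℂ] L2) : Prop where
  norm_le : ∀ s, ‖U s‖ ≤ 1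
  tendsto : ∀ s, 0 < s → ∀ φ u : L2,
    Tendsto (fun n : ℕ => inner ℂ φ ((sliceOp m ħ hV (s / (n + 1)) ^ (n + 1)) u)) atTop
      (𝓝 (inner ℂ φ (U s u)))
  weak : ∀ u, IsWeakSolution (generatorGraph m ħ V) u fun s => U s u

/-- The abstract product formula along the slice lengths `ε = s / (n + 1)`, where
`⌊s / ε⌋ = n + 1`. -/
theorem exists_isEvolution (hħ : 0 < ħ) (hV : Measurable V)
    (hV2 : LocallyIntegrable (fun x => V x ^ 2) (volume : Measure ℝ))
    (hH : IsEssentiallySelfAdjoint (hamiltonianOp m ħ V)) :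
    ∃ U : ℝ → L2 →L[ℂ] L2, IsEvolution m ħ hV U := by
  obtain ⟨U, h1, h2, h3⟩ := (isProductFormula_sliceOp (m := m) hħ hV hV2).exists_propagator
    (dense_range_generatorGraph hħ hH)
  refine ⟨U, h1, fun s hs φ u => ?_, h3⟩
  have hε : Tendsto (fun n : ℕ => s / ((n : ℝ) + 1)) atTop (𝓝[>] 0) := by
    refine tendsto_nhdsWithin_iff.2 ⟨?_, Eventually.of_forall fun n => ?_⟩
    · have := (tendsto_one_div_add_atTop_nhds_zero_nat (𝕜 := ℝ)).const_mul s
      simpa [div_eq_mul_inv] using this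
    · exact mem_Ioi.2 (by positivity)
  refine ((h2 s hs.le φ u).comp hε).congr fun n => ?_
  have h4 : ⌊s / (s / ((n : ℝ) + 1))⌋₊ = n + 1 := by
    rw [div_div_cancel₀ hs.ne']
    exact_mod_cast Nat.floor_natCast (R := ℝ) (n + 1)
  rw [Function.comp_apply, h4]

variable {hV : Measurable V} {U : ℝ → L2 →L[ℂ] L2}

theorem IsEvolution.norm_apply_le (hU : IsEvolution m ħ hV U) (s : ℝ) (u : L2) :
    ‖U s u‖ ≤ ‖u‖ := by
  simpa using (U s).le_of_opNorm_le (hU.norm_le s) u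

theorem IsTestFunction.conj {E : Type*} [NormedAddCommGroup E] [NormedSpace ℝ E] {φ : E → ℂ}
    (hφ : IsTestFunction φ) : IsTestFunction fun x => (starRingEnd ℂ) (φ x) :=
  ⟨Complex.conjCLE.contDiff.comp hφ.1, hφ.2.comp_left (map_zero _)⟩

theorem hamiltonian_conj (φ : ℝ → ℂ) (x : ℝ) :
    hamiltonian m ħ V (fun y => (starRingEnd ℂ) (φ y)) x =
      (starRingEnd ℂ) (hamiltonian m ħ V φ x) := by
  have h1 : ∀ χ : ℝ → ℂ, deriv (fun y => (starRingEnd ℂ) (χ y)) =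
      fun y => (starRingEnd ℂ) (deriv χ y) := by
    intro χ
    funext y
    exact deriv.star
  have h2 : iteratedDeriv 2 (fun y => (starRingEnd ℂ) (φ y)) x =
      (starRingEnd ℂ) (iteratedDeriv 2 φ x) := by
    simp only [iteratedDeriv_succ, iteratedDeriv_zero, h1]
  simp only [hamiltonian, h2, map_add, map_mul, map_neg, map_div₀, map_pow, Complex.conj_ofReal,
    Complex.conj_ofNat]

/-- The weak Schrödinger equation, with the bilinear pairing written as an inner product. -/
theorem IsEvolution.hasDerivAt (hU : IsEvolution m ħ hV U)
    (hV2 : LocallyIntegrable (fun x => V x ^ 2) (volume : Measure ℝ)) {φ : ℝ → ℂ}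
    (hφ : IsTestFunction φ) (u : L2) {s : ℝ} (hs : 0 < s) :
    HasDerivAt (fun r => inner ℂ (hφ.memLp 2).conj.toLp (U r u))
      (-(I / ħ) * inner ℂ (memLp_hamiltonian (m := m) (ħ := ħ) hV hV2 hφ).conj.toLp (U s u)) s := by
  have hmem : ((hφ.memLp 2).conj.toLp, (I / ħ : ℂ) •
      (memLp_hamiltonian (m := m) (ħ := ħ) hV hV2 hφ).conj.toLp) ∈ generatorGraph m ħ V := by
    refine ⟨((hφ.memLp 2).conj.toLp, (memLp_hamiltonian hV hV2 hφ).conj.toLp),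
      ⟨_, hφ.conj, (hφ.memLp 2).conj.coeFn_toLp, ?_⟩, rfl⟩
    refine (memLp_hamiltonian hV hV2 hφ).conj.coeFn_toLp.trans (Eventually.of_forall fun x => ?_)
    exact (hamiltonian_conj φ x).symm
  have h := ((hU.weak u).hasDeriv _ hmem s hs.le).hasDerivAt (Ici_mem_nhds hs)
  refine h.congr_deriv ?_
  simp only [inner_smul_left, map_div₀, Complex.conj_I, Complex.conj_ofReal]
  ring

theorem HasPathIntegral.unique {ti tf : ℝ} {Φ : ℝ × ℝ → ℂ} {c c' : ℂ}
    (h : HasPathIntegral m ħ V ti tf Φ c) (h' : HasPathIntegral m ħ V ti tf Φ c') : c = c' := by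
  obtain ⟨a, ha, hc⟩ := h
  obtain ⟨a', ha', hc'⟩ := h'
  have : a = a' := funext fun n => tendsto_nhds_unique (ha n) (ha' n)
  subst this
  exact tendsto_nhds_unique hc hc'

theorem HasPathIntegral.propagator_eq {ti tf : ℝ} {Φ : ℝ × ℝ → ℂ} {c : ℂ}
    (h : HasPathIntegral m ħ V ti tf Φ c) : propagator m ħ V ti tf Φ = c := by
  obtain ⟨a, ha, hc⟩ := h
  have : (fun n : ℕ => limUnder atTop fun R : ℝ => slicedPairing m ħ V ti tf n R Φ) = a :=
    funext fun n => (ha n).limUnder_eq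
  rw [propagator, this]
  exact hc.limUnder_eq

/-- The path integral on products `φ(x_f) f(x_i)` is a matrix element of the evolution. -/
theorem IsEvolution.hasPathIntegral_mul (hU : IsEvolution m ħ hV U) (hm : 0 < m) (hħ : 0 < ħ)
    {ti tf : ℝ} (ht : ti < tf) {φ f : ℝ → ℂ} (hφ : MemLp φ 2 volume) (hφ1 : Integrable φ)
    (hf : MemLp f 2 volume) (hf1 : Integrable f) :
    HasPathIntegral m ħ V ti tf (fun p => φ p.1 * f p.2)
      (inner ℂ hφ.conj.toLp (U (tf - ti) hf.toLp)) := by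
  refine ⟨fun n => inner ℂ hφ.conj.toLp
    ((sliceOp m ħ hV ((tf - ti) / (n + 1)) ^ (n + 1)) hf.toLp), fun n => ?_,
    hU.tendsto _ (sub_pos.2 ht) _ _⟩
  simp only [slicedPairing_mul hm hħ hV ht n _ hφ hφ1 hf hf1]
  exact tendsto_const_nhds.inner (tendsto_sliceVec hV _ _ n)

/-- The indicator function of `[b, M]`. -/
noncomputable def stepFun (M b : ℝ) : ℝ → ℂ := (Icc b M).indicator fun _ => 1

theorem memLp_stepFun (M b : ℝ) (p : ℝ≥0∞) : MemLp (stepFun M b) p volume :=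
  memLp_indicator_const p measurableSet_Icc 1 (Or.inr measure_Icc_lt_top.ne)

theorem integrable_stepFun (M b : ℝ) : Integrable (stepFun M b) :=
  memLp_one_iff_integrable.1 (memLp_stepFun M b 1)

theorem norm_stepFun_le {M b : ℝ} (hb : -M ≤ b) (x : ℝ) :
    ‖stepFun M b x‖ ≤ ‖stepFun M (-M) x‖ := by
  rw [stepFun, stepFun, norm_indicator_eq_indicator_norm, norm_indicator_eq_indicator_norm]
  exact indicator_le_indicator_of_subset (Icc_subset_Icc_left hb) (fun _ => norm_nonneg _) x

theorem norm_toLp_stepFun_le {M b : ℝ} (hb : -M ≤ b) :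
    ‖(memLp_stepFun M b 2).toLp‖ ≤ ‖(memLp_stepFun M (-M) 2).toLp‖ := by
  refine Lp.norm_le_norm_of_ae_le ?_
  filter_upwards [(memLp_stepFun M b 2).coeFn_toLp, (memLp_stepFun M (-M) 2).coeFn_toLp]
    with x e1 e2
  rw [e1, e2]
  exact norm_stepFun_le hb x

/-- A density `g b x` on which superpositions `∫ g b x 1_{[b, M]}(y) db` of products are built:
it vanishes for `b` outside `[-M, M]`, and is dominated in `x`, uniformly in `b`. -/
structure IsDensity (M : ℝ) (g : ℝ → ℝ → ℂ) (G : ℝ → ℝ) : Prop where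
  stronglyMeasurable : StronglyMeasurable fun z : ℝ × ℝ => g z.1 z.2
  memLp : MemLp G 2 volume
  integrable : Integrable G
  norm_le : ∀ b x, ‖g b x‖ ≤ G x
  eq_zero : ∀ b, b ∉ Icc (-M) M → g b = 0

variable {M : ℝ} {g : ℝ → ℝ → ℂ} {G : ℝ → ℝ}

theorem IsDensity.memLp_apply (hg : IsDensity M g G) (b : ℝ) : MemLp (g b) 2 volume :=
  hg.memLp.mono' (hg.stronglyMeasurable.comp_measurable
    (g := fun x => (b, x)) (by fun_prop)).aestronglyMeasurable
    (Eventually.of_forall fun x => hg.norm_le b x)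

theorem IsDensity.integrable_apply (hg : IsDensity M g G) (b : ℝ) : Integrable (g b) :=
  hg.integrable.mono' (hg.stronglyMeasurable.comp_measurable
    (g := fun x => (b, x)) (by fun_prop)).aestronglyMeasurable
    (Eventually.of_forall fun x => hg.norm_le b x)

/-- The bound on the pairings of `g b` with the images of `1_{[b, M]}` under contractions. -/
noncomputable def IsDensity.bound (hg : IsDensity M g G) : ℝ → ℝ :=
  (Icc (-M) M).indicator fun _ => ‖hg.memLp.toLp‖ * ‖(memLp_stepFun M (-M) 2).toLp‖

theorem IsDensity.integrable_bound (hg : IsDensity M g G) : Integrable hg.bound := by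
  unfold IsDensity.bound
  rw [integrable_indicator_iff measurableSet_Icc]
  exact integrableOn_const measure_Icc_lt_top.ne

theorem IsDensity.norm_inner_le (hg : IsDensity M g G) (b : ℝ) {v : L2}
    (hv : ‖v‖ ≤ ‖(memLp_stepFun M b 2).toLp‖) :
    ‖inner ℂ (hg.memLp_apply b).conj.toLp v‖ ≤ hg.bound b := by
  refine (norm_inner_le_norm _ _).trans ?_
  by_cases hb : b ∈ Icc (-M) M
  · rw [IsDensity.bound, indicator_of_mem hb]
    gcongr
    · refine Lp.norm_le_norm_of_ae_le ?_
      filter_upwards [(hg.memLp_apply b).conj.coeFn_toLp, hg.memLp.coeFn_toLp] with x e1 e2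
      rw [e1, e2, RCLike.norm_conj]
      exact (hg.norm_le b x).trans (le_abs_self _)
    · exact hv.trans (norm_toLp_stepFun_le hb.1)
  · have h0 : (hg.memLp_apply b).conj.toLp = 0 := by
      refine Lp.ext ?_
      filter_upwards [(hg.memLp_apply b).conj.coeFn_toLp, Lp.coeFn_zero ℂ 2 volume] with x e1 e2
      rw [e1, e2, hg.eq_zero b hb]
      simp
    rw [h0, norm_zero, zero_mul, IsDensity.bound, indicator_of_notMem hb]

theorem IsDensity.integrable_prod (hg : IsDensity M g G) :
    Integrable (fun z : ℝ × (ℝ × ℝ) => g z.1 z.2.1 * stepFun M z.1 z.2.2)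
      (volume.prod volume) := by
  have h1 : Integrable (fun z : ℝ × (ℝ × ℝ) => (Icc (-M) M).indicator (fun _ => (1 : ℝ)) z.1 *
      (G z.2.1 * ‖stepFun M (-M) z.2.2‖)) (volume.prod volume) := by
    have h2 : Integrable ((Icc (-M) M).indicator fun _ => (1 : ℝ)) := by
      rw [integrable_indicator_iff measurableSet_Icc]
      exact integrableOn_const measure_Icc_lt_top.ne
    exact h2.mul_prod (hg.integrable.mul_prod (integrable_stepFun M (-M)).norm)
  have hstep : Measurable fun z : ℝ × (ℝ × ℝ) => stepFun M z.1 z.2.2 := by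
    have : (fun z : ℝ × (ℝ × ℝ) => stepFun M z.1 z.2.2) =
        {z : ℝ × (ℝ × ℝ) | z.1 ≤ z.2.2 ∧ z.2.2 ≤ M}.indicator fun _ => 1 := by
      funext z
      rfl
    rw [this]
    have h1 : MeasurableSet {z : ℝ × (ℝ × ℝ) | z.1 ≤ z.2.2} :=
      measurableSet_le (by fun_prop) (by fun_prop)
    have h2 : MeasurableSet {z : ℝ × (ℝ × ℝ) | z.2.2 ≤ M} :=
      measurableSet_le (by fun_prop) (by fun_prop)
    exact measurable_const.indicator (h1.inter h2)
  refine h1.mono' ?_ (Eventually.of_forall fun z => ?_)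
  · exact (hg.stronglyMeasurable.comp_measurable (g := fun z : ℝ × (ℝ × ℝ) => (z.1, z.2.1))
      (by fun_prop)).aestronglyMeasurable.mul hstep.aestronglyMeasurable
  · by_cases hb : z.1 ∈ Icc (-M) M
    · rw [indicator_of_mem hb, one_mul, norm_mul]
      have := (norm_nonneg _).trans (hg.norm_le z.1 z.2.1)
      gcongr
      · exact hg.norm_le _ _
      · exact norm_stepFun_le hb.1 _
    · rw [indicator_of_notMem hb, hg.eq_zero _ hb]
      simp

theorem IsDensity.slicedPairing_eq (hg : IsDensity M g G) (hm : 0 < m) (hħ : 0 < ħ)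
    (hV : Measurable V) {ti tf : ℝ} (ht : ti < tf) (n : ℕ) (R : ℝ) :
    AEStronglyMeasurable (fun b => inner ℂ (hg.memLp_apply b).conj.toLp
      (sliceVec m ħ hV ((tf - ti) / (n + 1)) R (memLp_stepFun M b 2).toLp n)) volume ∧
    slicedPairing m ħ V ti tf n R (fun p => ∫ b, g b p.1 * stepFun M b p.2) =
      ∫ b, inner ℂ (hg.memLp_apply b).conj.toLp
        (sliceVec m ħ hV ((tf - ti) / (n + 1)) R (memLp_stepFun M b 2).toLp n) := by
  obtain ⟨C, hC⟩ := exists_norm_slicedKernel_le (m := m) (ħ := ħ) hV ti tf n R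
  have hint : Integrable (fun z : ℝ × (ℝ × ℝ) => slicedKernel m ħ V ti tf n R z.2.1 z.2.2 *
      (g z.1 z.2.1 * stepFun M z.1 z.2.2)) (volume.prod volume) :=
    hg.integrable_prod.bdd_mul ((stronglyMeasurable_slicedKernel hV ti tf n R).comp_measurable
      (g := fun z : ℝ × (ℝ × ℝ) => z.2) measurable_snd).aestronglyMeasurable
      (Eventually.of_forall fun z => hC z.2.1 z.2.2)
  have heq : ∀ b, ∫ p : ℝ × ℝ, slicedKernel m ħ V ti tf n R p.1 p.2 *
      (g b p.1 * stepFun M b p.2) = inner ℂ (hg.memLp_apply b).conj.toLp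
        (sliceVec m ħ hV ((tf - ti) / (n + 1)) R (memLp_stepFun M b 2).toLp n) := fun b =>
    slicedPairing_mul hm hħ hV ht n R (hg.memLp_apply b) (hg.integrable_apply b)
      (memLp_stepFun M b 2) (integrable_stepFun M b)
  constructor
  · simp only [← heq]
    exact hint.integral_prod_left.aestronglyMeasurable
  · simp only [← heq]
    rw [integral_integral_swap hint, slicedPairing]
    simp only [integral_const_mul]

/-- The path integral on superpositions of products. -/
theorem IsEvolution.hasPathIntegral_superposition (hU : IsEvolution m ħ hV U)
    (hg : IsDensity M g G) (hm : 0 < m) (hħ : 0 < ħ) {ti tf : ℝ} (ht : ti < tf) :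
    AEStronglyMeasurable (fun b => inner ℂ (hg.memLp_apply b).conj.toLp
      (U (tf - ti) (memLp_stepFun M b 2).toLp)) volume ∧
    HasPathIntegral m ħ V ti tf (fun p => ∫ b, g b p.1 * stepFun M b p.2)
      (∫ b, inner ℂ (hg.memLp_apply b).conj.toLp (U (tf - ti) (memLp_stepFun M b 2).toLp)) := by
  have hR : ∀ (n : ℕ) (b : ℝ), Tendsto (fun R => inner ℂ (hg.memLp_apply b).conj.toLp
      (sliceVec m ħ hV ((tf - ti) / (n + 1)) R (memLp_stepFun M b 2).toLp n)) atTop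
      (𝓝 (inner ℂ (hg.memLp_apply b).conj.toLp
        ((sliceOp m ħ hV ((tf - ti) / (n + 1)) ^ (n + 1)) (memLp_stepFun M b 2).toLp))) :=
    fun n b => tendsto_const_nhds.inner (tendsto_sliceVec hV _ _ n)
  have hn : ∀ b : ℝ, Tendsto (fun n : ℕ => inner ℂ (hg.memLp_apply b).conj.toLp
      ((sliceOp m ħ hV ((tf - ti) / (n + 1)) ^ (n + 1)) (memLp_stepFun M b 2).toLp)) atTop
      (𝓝 (inner ℂ (hg.memLp_apply b).conj.toLp (U (tf - ti) (memLp_stepFun M b 2).toLp))) :=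
    fun b => hU.tendsto _ (sub_pos.2 ht) _ _
  have hmeas : ∀ n : ℕ, AEStronglyMeasurable (fun b => inner ℂ (hg.memLp_apply b).conj.toLp
      ((sliceOp m ħ hV ((tf - ti) / (n + 1)) ^ (n + 1)) (memLp_stepFun M b 2).toLp)) volume :=
    fun n => aestronglyMeasurable_of_tendsto_ae atTop
      (fun R => (hg.slicedPairing_eq hm hħ hV ht n R).1) (Eventually.of_forall (hR n))
  refine ⟨aestronglyMeasurable_of_tendsto_ae atTop hmeas (Eventually.of_forall hn),
    fun n => ∫ b, inner ℂ (hg.memLp_apply b).conj.toLp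
      ((sliceOp m ħ hV ((tf - ti) / (n + 1)) ^ (n + 1)) (memLp_stepFun M b 2).toLp),
    fun n => ?_, ?_⟩
  · simp only [fun R => (hg.slicedPairing_eq hm hħ hV ht n R).2]
    exact tendsto_integral_filter_of_dominated_convergence hg.bound
      (Eventually.of_forall fun R => (hg.slicedPairing_eq hm hħ hV ht n R).1)
      (Eventually.of_forall fun R => Eventually.of_forall fun b =>
        hg.norm_inner_le b (norm_sliceVec_le hV _ R _ n))
      hg.integrable_bound (Eventually.of_forall (hR n))
  · refine tendsto_integral_of_dominated_convergence hg.bound hmeas hg.integrable_bound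
      (fun n => Eventually.of_forall fun b => hg.norm_inner_le b ?_) (Eventually.of_forall hn)
    exact norm_pow_apply_le (ContinuousLinearMap.opNorm_le_bound _ zero_le_one fun u => by
      rw [one_mul]; exact norm_sliceOp_apply_le m ħ hV _ u) _ _

end Evolution

/-! ### Test functions of two variables as superpositions of products -/

section TestFunctions

/-- The partial derivative in the first variable. -/
noncomputable def partialFst (F : ℝ × ℝ → ℂ) (p : ℝ × ℝ) : ℂ := fderiv ℝ F p (1, 0)

/-- The partial derivative in the second variable. -/
noncomputable def partialSnd (F : ℝ × ℝ → ℂ) (p : ℝ × ℝ) : ℂ := fderiv ℝ F p (0, 1)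

theorem IsTestFunction.fderiv_apply {E : Type*} [NormedAddCommGroup E] [NormedSpace ℝ E]
    {F : E → ℂ} (hF : IsTestFunction F) (v : E) : IsTestFunction fun p => fderiv ℝ F p v :=
  ⟨(hF.1.fderiv_right (m := ∞) (by simp)).clm_apply contDiff_const, hF.2.fderiv_apply ℝ v⟩

variable {F : ℝ × ℝ → ℂ}

theorem IsTestFunction.partialFst (hF : IsTestFunction F) : IsTestFunction (partialFst F) :=
  hF.fderiv_apply _

theorem IsTestFunction.partialSnd (hF : IsTestFunction F) : IsTestFunction (partialSnd F) :=
  hF.fderiv_apply _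

theorem IsTestFunction.hasDerivAt_fst (hF : IsTestFunction F) (x y : ℝ) :
    HasDerivAt (fun z => F (z, y)) (PathIntegral.partialFst F (x, y)) x := by
  have h := (hF.1.differentiable (by simp) (x, y)).hasFDerivAt
  exact h.comp_hasDerivAt x ((hasDerivAt_id x).prodMk (hasDerivAt_const x y))

theorem IsTestFunction.hasDerivAt_snd (hF : IsTestFunction F) (x y : ℝ) :
    HasDerivAt (fun z => F (x, z)) (PathIntegral.partialSnd F (x, y)) y := by
  have h := (hF.1.differentiable (by simp) (x, y)).hasFDerivAt
  exact h.comp_hasDerivAt y ((hasDerivAt_const y x).prodMk (hasDerivAt_id y))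

theorem IsTestFunction.partialFst_partialSnd (hF : IsTestFunction F) :
    PathIntegral.partialFst (PathIntegral.partialSnd F) =
      PathIntegral.partialSnd (PathIntegral.partialFst F) := by
  funext p
  have hd : DifferentiableAt ℝ (fderiv ℝ F) p :=
    (hF.1.fderiv_right (m := ∞) (by simp)).differentiable (by simp) p
  have h : ∀ v w : ℝ × ℝ, fderiv ℝ (fun q => fderiv ℝ F q v) p w =
      fderiv ℝ (fderiv ℝ F) p w v := by
    intro v w
    rw [fderiv_clm_apply hd (differentiableAt_const v)]
    simp
  have hs : IsSymmSndFDerivAt ℝ F p :=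
    ((contDiff_infty.1 hF.1 2).contDiffAt (x := p)).isSymmSndFDerivAt
      (by simp [minSmoothness_of_isRCLikeNormedField])
  exact (h _ _).trans ((hs.eq _ _).trans (h _ _).symm)

theorem IsTestFunction.comp_fst (hF : IsTestFunction F) (y : ℝ) :
    IsTestFunction fun x => F (x, y) := by
  refine ⟨hF.1.comp (contDiff_id.prodMk contDiff_const), ?_⟩
  refine HasCompactSupport.intro (hF.2.image continuous_fst) fun x hx => ?_
  by_contra h
  exact hx ⟨(x, y), subset_tsupport _ h, rfl⟩

theorem IsTestFunction.comp_snd (hF : IsTestFunction F) (x : ℝ) :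
    IsTestFunction fun y => F (x, y) := by
  refine ⟨hF.1.comp (contDiff_const.prodMk contDiff_id), ?_⟩
  refine HasCompactSupport.intro (hF.2.image continuous_snd) fun y hy => ?_
  by_contra h
  exact hy ⟨(x, y), subset_tsupport _ h, rfl⟩

theorem IsTestFunction.iteratedDeriv_two_fst (hF : IsTestFunction F) (x y : ℝ) :
    iteratedDeriv 2 (fun z => F (z, y)) x =
      PathIntegral.partialFst (PathIntegral.partialFst F) (x, y) := by
  have h1 : deriv (fun z => F (z, y)) = fun z => PathIntegral.partialFst F (z, y) :=
    funext fun z => (hF.hasDerivAt_fst z y).deriv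
  rw [iteratedDeriv_succ, iteratedDeriv_one, h1]
  exact (hF.partialFst.hasDerivAt_fst x y).deriv

/-- All of the support lies in the square `[-M, M]²`. -/
def SupportedInSquare (M : ℝ) (F : ℝ × ℝ → ℂ) : Prop :=
  tsupport F ⊆ Icc (-M) M ×ˢ Icc (-M) M

theorem SupportedInSquare.eq_zero {M : ℝ} (hM : SupportedInSquare M F) {x y : ℝ}
    (h : x ∉ Icc (-M) M ∨ y ∉ Icc (-M) M) : F (x, y) = 0 := by
  by_contra hne
  have := hM (subset_tsupport _ hne)
  rcases h with h | h
  · exact h this.1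
  · exact h this.2

theorem SupportedInSquare.fderiv_apply {M : ℝ} (hM : SupportedInSquare M F) (v : ℝ × ℝ) :
    SupportedInSquare M fun p => fderiv ℝ F p v :=
  (tsupport_fderiv_apply_subset ℝ v).trans hM

theorem IsTestFunction.exists_supportedInSquare (hF : IsTestFunction F) :
    ∃ M, SupportedInSquare M F := by
  obtain ⟨M, hM⟩ := hF.2.isBounded.subset_closedBall 0
  refine ⟨M, fun p hp => ?_⟩
  have h := hM hp
  rw [mem_closedBall_zero_iff, Prod.norm_def, max_le_iff, Real.norm_eq_abs, Real.norm_eq_abs] at h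
  exact ⟨abs_le.1 h.1, abs_le.1 h.2⟩

/-- A test function is a superposition of products, by the fundamental theorem of calculus in the
second variable. -/
theorem IsTestFunction.integral_partialSnd_mul_stepFun (hF : IsTestFunction F) {M : ℝ}
    (hM : SupportedInSquare M F) (x y : ℝ) :
    ∫ b, PathIntegral.partialSnd F (x, b) * stepFun M b y = F (x, y) := by
  by_cases hy : y ≤ M
  · have h1 : ∀ b, PathIntegral.partialSnd F (x, b) * stepFun M b y =
        (Iic y).indicator (fun b => PathIntegral.partialSnd F (x, b)) b := by
      intro b
      by_cases hb : b ≤ y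
      · simp [stepFun, hb, hy]
      · simp [stepFun, hb]
    have h2 : deriv (fun z => F (x, z)) = fun z => PathIntegral.partialSnd F (x, z) :=
      funext fun z => (hF.hasDerivAt_snd x z).deriv
    simp only [h1]
    rw [integral_indicator measurableSet_Iic, ← h2]
    exact HasCompactSupport.integral_Iic_deriv_eq ((hF.comp_snd x).1.of_le (by simp))
      (hF.comp_snd x).2 y
  · have h1 : ∀ b, stepFun M b y = 0 := fun b =>
      indicator_of_notMem (fun h => hy h.2) _
    rw [hM.eq_zero (Or.inr fun h => hy h.2)]
    simp [h1]

theorem integrable_mul_stepFun {M : ℝ} {h : ℝ → ℂ} (hh : Integrable h) (y : ℝ) :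
    Integrable fun b => h b * stepFun M b y := by
  have hstep : Measurable fun b => stepFun M b y := by
    have : (fun b => stepFun M b y) = {b : ℝ | b ≤ y ∧ y ≤ M}.indicator fun _ => 1 := by
      funext b
      rfl
    rw [this]
    exact measurable_const.indicator (measurableSet_Iic.inter (MeasurableSet.const _))
  refine hh.mono (hh.aestronglyMeasurable.mul hstep.aestronglyMeasurable)
    (Eventually.of_forall fun b => ?_)
  by_cases hb : y ∈ Icc b M <;> simp [stepFun, hb]

variable {V : ℝ → ℝ}

theorem memLp_indicator_potential (hV : Measurable V)
    (hV2 : LocallyIntegrable (fun x => V x ^ 2) (volume : Measure ℝ)) (a b : ℝ) :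
    MemLp ((Icc a b).indicator fun x => |V x|) 2 volume := by
  rw [memLp_indicator_iff_restrict measurableSet_Icc,
    memLp_two_iff_integrable_sq hV.abs.aestronglyMeasurable]
  simp only [sq_abs]
  exact hV2.integrableOn_isCompact isCompact_Icc

/-- The densities of a test function and of its image under the Hamiltonian are of this form. -/
theorem exists_isDensity (hV : Measurable V)
    (hV2 : LocallyIntegrable (fun x => V x ^ 2) (volume : Measure ℝ)) {Ψ₀ Ψ₁ : ℝ × ℝ → ℂ}
    (h₀ : IsTestFunction Ψ₀) (h₁ : IsTestFunction Ψ₁) {M : ℝ} (hM₀ : SupportedInSquare M Ψ₀)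
    (hM₁ : SupportedInSquare M Ψ₁) :
    ∃ G, IsDensity M (fun b x => Ψ₀ (x, b) + V x * Ψ₁ (x, b)) G := by
  obtain ⟨C₀, hC₀⟩ := h₀.2.exists_bound_of_continuous h₀.1.continuous
  obtain ⟨C₁, hC₁⟩ := h₁.2.exists_bound_of_continuous h₁.1.continuous
  have hV1 : Measurable fun x => (V x : ℂ) := Complex.measurable_ofReal.comp hV
  set G : ℝ → ℝ := (Icc (-M) M).indicator (fun _ => C₀) +
    fun x => C₁ * (Icc (-M) M).indicator (fun x => |V x|) x with hG
  have hG2 : MemLp G 2 volume :=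
    (memLp_indicator_const 2 measurableSet_Icc C₀ (Or.inr measure_Icc_lt_top.ne)).add
      ((memLp_indicator_potential hV hV2 _ _).const_mul C₁)
  have hsupp : ∀ x, x ∉ Icc (-M) M → G x = 0 := fun x hx => by simp [hG, hx]
  refine ⟨G, ?_, hG2, ?_, fun b x => ?_, fun b hb => ?_⟩
  · refine StronglyMeasurable.add ?_ (StronglyMeasurable.mul ?_ ?_)
    · exact (h₀.1.continuous.comp (by fun_prop : Continuous fun z : ℝ × ℝ =>
        (z.2, z.1))).stronglyMeasurable
    · exact (hV1.comp measurable_snd).stronglyMeasurable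
    · exact (h₁.1.continuous.comp (by fun_prop : Continuous fun z : ℝ × ℝ =>
        (z.2, z.1))).stronglyMeasurable
  · have h1 : G = (Icc (-M) M).indicator G := by
      funext x
      by_cases hx : x ∈ Icc (-M) M
      · rw [indicator_of_mem hx]
      · rw [indicator_of_notMem hx, hsupp x hx]
    rw [h1, integrable_indicator_iff measurableSet_Icc]
    have : IsFiniteMeasure (volume.restrict (Icc (-M) M)) := ⟨by simp⟩
    exact (hG2.restrict _).integrable one_le_two
  · by_cases hx : x ∈ Icc (-M) M
    · have h1 : G x = C₀ + C₁ * |V x| := by simp [hG, hx]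
      rw [h1]
      refine (norm_add_le _ _).trans (add_le_add (hC₀ _) ?_)
      rw [norm_mul, Complex.norm_real, Real.norm_eq_abs, mul_comm]
      gcongr
      exact hC₁ _
    · rw [hsupp x hx, hM₀.eq_zero (Or.inl hx), hM₁.eq_zero (Or.inl hx)]
      simp
  · funext x
    simp [hM₀.eq_zero (Or.inr hb), hM₁.eq_zero (Or.inr hb)]

end TestFunctions

/-! ### The equation for the propagator -/

section Propagator

variable {m ħ : ℝ} {V : ℝ → ℝ} {hV : Measurable V} {U : ℝ → L2 →L[ℂ] L2}

theorem IsDensity.congr {M : ℝ} {g g' : ℝ → ℝ → ℂ} {G : ℝ → ℝ} (hg : IsDensity M g G)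
    (h : g = g') : IsDensity M g' G := h ▸ hg

/-- The propagator exists as a generalized function and satisfies the Schrödinger equation. -/
theorem IsEvolution.propagator_equation (hU : IsEvolution m ħ hV U) (hm : 0 < m) (hħ : 0 < ħ)
    (hV2 : LocallyIntegrable (fun x => V x ^ 2) (volume : Measure ℝ)) {ti tf : ℝ} (ht : ti < tf)
    {Φ : ℝ × ℝ → ℂ} (hΦ : IsTestFunction Φ) :
    HasPathIntegral m ħ V ti tf Φ (propagator m ħ V ti tf Φ) ∧
      HasPathIntegral m ħ V ti tf (hamiltonianFst m ħ V Φ)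
        (propagator m ħ V ti tf (hamiltonianFst m ħ V Φ)) ∧
      ∃ d : ℂ, HasDerivAt (fun t => propagator m ħ V ti t Φ) d tf ∧
        I * ħ * d - propagator m ħ V ti tf (hamiltonianFst m ħ V Φ) = 0 := by
  obtain ⟨M, hM⟩ := hΦ.exists_supportedInSquare
  have hγ : ∀ b, IsTestFunction fun x => partialSnd Φ (x, b) := fun b => hΦ.partialSnd.comp_fst b
  set c : ℂ := -((ħ : ℂ) ^ 2 / (2 * m)) with hc
  -- The densities of `Φ` and of `H Φ`.
  have hzero : IsTestFunction (0 : ℝ × ℝ → ℂ) := ⟨contDiff_const, HasCompactSupport.zero⟩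
  obtain ⟨G₁, hg₁⟩ := exists_isDensity hV hV2 hΦ.partialSnd hzero (hM.fderiv_apply (0, 1))
    (by simp [SupportedInSquare])
  replace hg₁ := hg₁.congr (g' := fun b x => partialSnd Φ (x, b)) (by funext b x; simp)
  have hΨ : IsTestFunction (c • partialSnd (partialFst (partialFst Φ))) :=
    ⟨hΦ.partialFst.partialFst.partialSnd.1.const_smul c,
      hΦ.partialFst.partialFst.partialSnd.2.smul_left (f := fun _ => c)⟩
  have hΨM : SupportedInSquare M (c • partialSnd (partialFst (partialFst Φ))) :=
    (tsupport_smul_subset_right (fun _ => c) _).trans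
      (((hM.fderiv_apply (1, 0)).fderiv_apply (1, 0)).fderiv_apply (0, 1))
  obtain ⟨G₂, hg₂⟩ := exists_isDensity hV hV2 hΨ hΦ.partialSnd hΨM (hM.fderiv_apply (0, 1))
  replace hg₂ := hg₂.congr (g' := fun b => hamiltonian m ħ V fun x => partialSnd Φ (x, b)) (by
    funext b x
    rw [hamiltonian, hΦ.partialSnd.iteratedDeriv_two_fst, hΦ.partialFst_partialSnd,
      hΦ.partialFst.partialFst_partialSnd]
    rfl)
  have hsup₁ : (fun p : ℝ × ℝ => ∫ b, partialSnd Φ (p.1, b) * stepFun M b p.2) = Φ :=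
    funext fun p => hΦ.integral_partialSnd_mul_stepFun hM p.1 p.2
  have hsup₂ : (fun p : ℝ × ℝ => ∫ b, hamiltonian m ħ V (fun x => partialSnd Φ (x, b)) p.1 *
      stepFun M b p.2) = hamiltonianFst m ħ V Φ := by
    funext p
    have h1 := hΦ.partialFst.partialFst.integral_partialSnd_mul_stepFun
      ((hM.fderiv_apply (1, 0)).fderiv_apply (1, 0)) p.1 p.2
    have h2 := hΦ.integral_partialSnd_mul_stepFun hM p.1 p.2
    have h3 : ∀ Ψ : ℝ × ℝ → ℂ, IsTestFunction Ψ →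
        Integrable fun b => Ψ (p.1, b) * stepFun M b p.2 := fun Ψ hΨ =>
      integrable_mul_stepFun (memLp_one_iff_integrable.1 ((hΨ.comp_snd p.1).memLp 1)) _
    have h4 : ∀ b, hamiltonian m ħ V (fun x => partialSnd Φ (x, b)) p.1 * stepFun M b p.2 =
        c * (partialSnd (partialFst (partialFst Φ)) (p.1, b) * stepFun M b p.2) +
          V p.1 * (partialSnd Φ (p.1, b) * stepFun M b p.2) := by
      intro b
      rw [hamiltonian, hΦ.partialSnd.iteratedDeriv_two_fst, hΦ.partialFst_partialSnd,
        hΦ.partialFst.partialFst_partialSnd]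
      ring
    simp only [h4]
    rw [integral_add ((h3 _ hΦ.partialFst.partialFst.partialSnd).const_mul c)
      ((h3 _ hΦ.partialSnd).const_mul _), integral_const_mul, integral_const_mul, h1, h2,
      hamiltonianFst, hamiltonian, hΦ.iteratedDeriv_two_fst]
  have hpath₁ : ∀ t, ti < t → HasPathIntegral m ħ V ti t Φ (∫ b,
      inner ℂ (hg₁.memLp_apply b).conj.toLp (U (t - ti) (memLp_stepFun M b 2).toLp)) := by
    intro t h
    have := (hU.hasPathIntegral_superposition hg₁ hm hħ h).2
    rwa [hsup₁] at this
  have hpath₂ : HasPathIntegral m ħ V ti tf (hamiltonianFst m ħ V Φ) (∫ b,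
      inner ℂ (hg₂.memLp_apply b).conj.toLp (U (tf - ti) (memLp_stepFun M b 2).toLp)) := by
    have := (hU.hasPathIntegral_superposition hg₂ hm hħ ht).2
    rwa [hsup₂] at this
  refine ⟨(hpath₁ tf ht).propagator_eq ▸ hpath₁ tf ht, hpath₂.propagator_eq ▸ hpath₂, ?_⟩
  have hder := hasDerivAt_integral_of_dominated_loc_of_deriv_le (μ := volume)
    (F := fun t b => inner ℂ (hg₁.memLp_apply b).conj.toLp (U (t - ti) (memLp_stepFun M b 2).toLp))
    (F' := fun t b => -(I / ħ) *
      inner ℂ (hg₂.memLp_apply b).conj.toLp (U (t - ti) (memLp_stepFun M b 2).toLp))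
    (bound := fun b => ħ⁻¹ * hg₂.bound b) (Ioi_mem_nhds ht)
    (by
      filter_upwards [Ioi_mem_nhds ht] with t h
      exact (hU.hasPathIntegral_superposition hg₁ hm hħ h).1)
    (hg₁.integrable_bound.mono' (hU.hasPathIntegral_superposition hg₁ hm hħ ht).1
      (Eventually.of_forall fun b => hg₁.norm_inner_le b (hU.norm_apply_le _ _)))
    ((hU.hasPathIntegral_superposition hg₂ hm hħ ht).1.const_mul _)
    (Eventually.of_forall fun b t _ => by
      have h1 : ‖-(I / ħ : ℂ)‖ = ħ⁻¹ := by simp [abs_of_pos hħ]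
      rw [norm_mul, h1]
      exact mul_le_mul_of_nonneg_left (hg₂.norm_inner_le b (hU.norm_apply_le _ _))
        (inv_nonneg.2 hħ.le))
    (hg₂.integrable_bound.const_mul _)
    (Eventually.of_forall fun b t h => by
      have h1 := hU.hasDerivAt hV2 (hγ b) (memLp_stepFun M b 2).toLp (sub_pos.2 (mem_Ioi.1 h))
      exact h1.comp_sub_const t ti)
  refine ⟨_, hder.2.congr_of_eventuallyEq ?_, ?_⟩
  · filter_upwards [Ioi_mem_nhds ht] with t h
    exact (hpath₁ t h).propagator_eq
  · rw [hpath₂.propagator_eq, integral_const_mul]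
    have hħ' : (ħ : ℂ) ≠ 0 := by exact_mod_cast hħ.ne'
    field_simp
    rw [Complex.I_sq]
    ring

end Propagator

/-! ### The wavefunction -/

section Wavefunction

variable {m ħ : ℝ} {V : ℝ → ℝ} {hV : Measurable V} {U : ℝ → L2 →L[ℂ] L2}

theorem inner_conj_toLp_eq_integral {φ f : ℝ → ℂ} (hφ : MemLp φ 2 volume) {u : L2}
    (hu : f =ᵐ[volume] u) : inner ℂ hφ.conj.toLp u = ∫ x, φ x * f x := by
  rw [inner_eq_integral]
  refine integral_congr_ae ?_
  filter_upwards [hφ.conj.coeFn_toLp, hu] with x e1 e2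
  rw [e1, e2, Complex.conj_conj]

theorem integrable_indicator_Icc {f : ℝ → ℂ} (hf : MemLp f 2 volume) (a b : ℝ) :
    Integrable ((Icc a b).indicator f) := by
  rw [integrable_indicator_iff measurableSet_Icc]
  have : IsFiniteMeasure (volume.restrict (Icc a b)) := ⟨by simp⟩
  exact (hf.restrict _).integrable one_le_two

/-- Every representative of the evolved state is a wavefunction. -/
theorem IsEvolution.isWavefunction (hU : IsEvolution m ħ hV U) (hm : 0 < m) (hħ : 0 < ħ)
    (ti : ℝ) {f : ℝ → ℂ} (hf : MemLp f 2 volume) :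
    IsWavefunction m ħ V ti f fun t => U (t - ti) hf.toLp := by
  intro t ht
  refine ⟨Lp.memLp _, fun φ hφ => ?_⟩
  refine ⟨fun R => inner ℂ (hφ.memLp 2).conj.toLp
    (U (t - ti) (hf.indicator (s := Icc (-R) R) measurableSet_Icc).toLp), fun R => ?_, ?_⟩
  · exact hU.hasPathIntegral_mul hm hħ ht (hφ.memLp 2)
      (memLp_one_iff_integrable.1 (hφ.memLp 1)) _ (integrable_indicator_Icc hf _ _)
  · rw [← inner_conj_toLp_eq_integral (hφ.memLp 2) (ae_eq_refl _)]
    refine tendsto_const_nhds.inner (((U (t - ti)).continuous.tendsto _).comp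
      ((tendsto_cutoff hf.toLp).congr fun R => Lp.ext ?_))
    filter_upwards [coeFn_mulL2 (isMultiplier_indicator (measurableSet_Icc (a := -R) (b := R)))
      hf.toLp, hf.coeFn_toLp, (hf.indicator (s := Icc (-R) R) measurableSet_Icc).coeFn_toLp]
      with x e1 e2 e3
    rw [cutoff, e1, e2, e3]
    by_cases hx : x ∈ Icc (-R) R <;> simp [hx]

/-- The wavefunction is unique, as an element of `L²(ℝ)`. -/
theorem IsWavefunction.ae_eq {ti : ℝ} {f : ℝ → ℂ} {ψ ψ' : ℝ → ℝ → ℂ}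
    (h : IsWavefunction m ħ V ti f ψ) (h' : IsWavefunction m ħ V ti f ψ') {t : ℝ} (ht : ti < t) :
    ψ t =ᵐ[volume] ψ' t := by
  refine ae_eq_of_integral_contDiff_smul_eq ((h t ht).1.locallyIntegrable one_le_two)
    ((h' t ht).1.locallyIntegrable one_le_two) fun g hg hgc => ?_
  have hφ : IsTestFunction fun x => (g x : ℂ) :=
    ⟨Complex.ofRealCLM.contDiff.comp hg, hgc.comp_left (g := fun r : ℝ => (r : ℂ)) (by simp)⟩
  obtain ⟨c, hc, hlim⟩ := (h t ht).2 _ hφ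
  obtain ⟨c', hc', hlim'⟩ := (h' t ht).2 _ hφ
  have : c = c' := funext fun R => (hc R).unique (hc' R)
  subst this
  simpa using tendsto_nhds_unique hlim hlim'

/-- Every wavefunction satisfies the Schrödinger equation weakly. -/
theorem IsEvolution.wavefunction_equation (hU : IsEvolution m ħ hV U) (hm : 0 < m) (hħ : 0 < ħ)
    (hV2 : LocallyIntegrable (fun x => V x ^ 2) (volume : Measure ℝ)) {ti : ℝ} {f : ℝ → ℂ}
    (hf : MemLp f 2 volume) {ψ : ℝ → ℝ → ℂ} (hψ : IsWavefunction m ħ V ti f ψ) {t : ℝ}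
    (ht : ti < t) {φ : ℝ → ℂ} (hφ : IsTestFunction φ) :
    ∃ d : ℂ, HasDerivAt (fun s => ∫ x, φ x * ψ s x) d t ∧
      I * ħ * d - ∫ x, hamiltonian m ħ V φ x * ψ t x = 0 := by
  have hae : ∀ s, ti < s → ψ s =ᵐ[volume] U (s - ti) hf.toLp := fun s hs =>
    hψ.ae_eq (hU.isWavefunction hm hħ ti hf) hs
  have hd := (hU.hasDerivAt hV2 hφ hf.toLp (sub_pos.2 ht)).comp_sub_const t ti
  refine ⟨_, hd.congr_of_eventuallyEq ?_, ?_⟩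
  · filter_upwards [Ioi_mem_nhds ht] with s hs
    exact (inner_conj_toLp_eq_integral (hφ.memLp 2) (hae s hs)).symm
  · rw [inner_conj_toLp_eq_integral (memLp_hamiltonian hV hV2 hφ) (hae t ht)]
    have hħ' : (ħ : ℂ) ≠ 0 := by exact_mod_cast hħ.ne'
    field_simp
    rw [Complex.I_sq]
    ring

end Wavefunction

/-! ### From the weak to the classical equation -/

section Classical

theorem continuous_mul_of_tsupport_subset {E : Type*} [TopologicalSpace E] {κ Φ : E → ℂ}
    {W : Set E} (hW : IsOpen W) (hκ : ContinuousOn κ W) (hΦ : Continuous Φ) (hs : tsupport Φ ⊆ W) :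
    Continuous fun p => κ p * Φ p :=
  continuous_of_tsupport fun _ hp =>
    (hκ.continuousAt (hW.mem_nhds (hs (tsupport_mul_subset_right hp)))).mul hΦ.continuousAt

variable {E : Type*} [NormedAddCommGroup E] [NormedSpace ℝ E] [MeasurableSpace E] [BorelSpace E]
  {μ : Measure E}

theorem integrable_mul_of_tsupport_subset [IsFiniteMeasureOnCompacts μ] {κ Φ : E → ℂ} {W : Set E}
    (hW : IsOpen W) (hκ : ContinuousOn κ W) (hΦ : IsTestFunction Φ) (hs : tsupport Φ ⊆ W) :
    Integrable (fun p => κ p * Φ p) μ :=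
  (continuous_mul_of_tsupport_subset hW hκ hΦ.1.continuous hs).integrable_of_hasCompactSupport
    hΦ.2.mul_left

theorem integral_mul_fderiv_eq_neg [FiniteDimensional ℝ E] [μ.IsAddHaarMeasure] {κ Φ : E → ℂ}
    {W : Set E} (hW : IsOpen W) (hκ : ContDiffOn ℝ 1 κ W) (hΦ : IsTestFunction Φ)
    (hs : tsupport Φ ⊆ W) (v : E) :
    ∫ p, κ p * fderiv ℝ Φ p v ∂μ = -∫ p, fderiv ℝ κ p v * Φ p ∂μ := by
  have hκ' : ContinuousOn (fun p => fderiv ℝ κ p v) W :=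
    (hκ.continuousOn_fderiv_of_isOpen hW le_rfl).clm_apply continuousOn_const
  exact integral_bilinear_hasLineDerivAt_right_eq_neg_left_of_integrable
    (B := ContinuousLinearMap.mul ℝ ℂ) (integrable_mul_of_tsupport_subset hW hκ' hΦ hs)
    (integrable_mul_of_tsupport_subset hW hκ.continuousOn (hΦ.fderiv_apply v)
      ((tsupport_fderiv_apply_subset ℝ v).trans hs))
    (integrable_mul_of_tsupport_subset hW hκ.continuousOn hΦ hs)
    (fun p hp => ((hκ.differentiableOn one_ne_zero).differentiableAt
      (hW.mem_nhds (hs hp))).hasFDerivAt.hasLineDerivAt v)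
    (fun p _ => (hΦ.1.differentiable (by simp) p).hasFDerivAt.hasLineDerivAt v)

theorem integral_mul_fderiv_fderiv [FiniteDimensional ℝ E] [μ.IsAddHaarMeasure] {κ Φ : E → ℂ}
    {W : Set E} (hW : IsOpen W) (hκ : ContDiffOn ℝ 2 κ W) (hΦ : IsTestFunction Φ)
    (hs : tsupport Φ ⊆ W) (v : E) :
    ∫ p, κ p * fderiv ℝ (fun q => fderiv ℝ Φ q v) p v ∂μ =
      ∫ p, fderiv ℝ (fun q => fderiv ℝ κ q v) p v * Φ p ∂μ := by
  have hκ' : ContDiffOn ℝ 1 (fun p => fderiv ℝ κ p v) W :=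
    (hκ.fderiv_of_isOpen hW (by norm_num)).clm_apply contDiffOn_const
  rw [integral_mul_fderiv_eq_neg hW (hκ.of_le (by norm_num)) (hΦ.fderiv_apply v)
    ((tsupport_fderiv_apply_subset ℝ v).trans hs), integral_mul_fderiv_eq_neg hW hκ' hΦ hs,
    neg_neg]

/-- Differentiation with respect to time under the integral. -/
theorem hasDerivAt_integral_mul_testFunction [FiniteDimensional ℝ E] [IsFiniteMeasureOnCompacts μ]
    {U : Set (ℝ × E)} (hU : IsOpen U) {k : ℝ × E → ℂ} (hk : ContDiffOn ℝ 1 k U) {t : ℝ}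
    {Φ : E → ℂ} (hΦ : IsTestFunction Φ) (hs : ∀ p ∈ tsupport Φ, (t, p) ∈ U) :
    HasDerivAt (fun s => ∫ p, k (s, p) * Φ p ∂μ) (∫ p, fderiv ℝ k (t, p) (1, 0) * Φ p ∂μ) t := by
  obtain ⟨u, w, hu, -, htu, hw, huw⟩ := generalized_tube_lemma isCompact_singleton
    (s := {t}) hΦ.2.isCompact hU (by rintro ⟨s, p⟩ ⟨rfl, h2⟩; exact hs p h2)
  obtain ⟨δ, hδ, hδu⟩ := Metric.nhds_basis_closedBall.mem_iff.1 (hu.mem_nhds (htu rfl))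
  have hmem : ∀ s ∈ Metric.closedBall t δ, ∀ p ∈ tsupport Φ, (s, p) ∈ U := fun s h p hp =>
    huw ⟨hδu h, hw hp⟩
  have hk' : ContinuousOn (fun q => fderiv ℝ k q (1, 0)) U :=
    (hk.continuousOn_fderiv_of_isOpen hU le_rfl).clm_apply continuousOn_const
  obtain ⟨C, hC⟩ := ((isCompact_closedBall t δ).prod hΦ.2.isCompact).exists_bound_of_continuousOn
    (hk'.mono fun q hq => hmem q.1 hq.1 q.2 hq.2)
  have hint : ∀ (g : ℝ × E → ℂ), ContinuousOn g U → ∀ s ∈ Metric.closedBall t δ,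
      Integrable (fun p => g (s, p) * Φ p) μ := fun g hg s h =>
    integrable_mul_of_tsupport_subset (W := (fun p => (s, p)) ⁻¹' U)
      (hU.preimage (by fun_prop)) (hg.comp (by fun_prop) fun _ hp => hp) hΦ (hmem s h)
  have htδ : t ∈ Metric.closedBall t δ := Metric.mem_closedBall_self hδ.le
  refine (hasDerivAt_integral_of_dominated_loc_of_deriv_le
    (F' := fun s p => fderiv ℝ k (s, p) (1, 0) * Φ p) (bound := fun p => C * ‖Φ p‖)
    (Metric.closedBall_mem_nhds t hδ) ?_ (hint k hk.continuousOn t htδ)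
    (hint _ hk' t htδ).aestronglyMeasurable ?_ ?_ ?_).2
  · filter_upwards [Metric.closedBall_mem_nhds t hδ] with s h
    exact (hint k hk.continuousOn s h).aestronglyMeasurable
  · refine Eventually.of_forall fun p s h => ?_
    by_cases hp : p ∈ tsupport Φ
    · rw [norm_mul]
      exact mul_le_mul_of_nonneg_right (hC (s, p) ⟨h, hp⟩) (norm_nonneg _)
    · simp [image_eq_zero_of_notMem_tsupport hp]
  · exact ((hΦ.1.continuous.integrable_of_hasCompactSupport hΦ.2).norm).const_mul C
  · refine Eventually.of_forall fun p s h => ?_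
    by_cases hp : p ∈ tsupport Φ
    · have h1 := ((hk.differentiableOn one_ne_zero).differentiableAt
        (hU.mem_nhds (hmem s h p hp))).hasFDerivAt
      exact (h1.comp_hasDerivAt s
        ((hasDerivAt_id s).prodMk (hasDerivAt_const s p))).mul_const (Φ p)
    · simpa [image_eq_zero_of_notMem_tsupport hp] using hasDerivAt_const s (0 : ℂ)

/-- A function that is twice continuously differentiable and satisfies an evolution equation of
Schrödinger type weakly, on test functions concentrated near a point at which the potential is
continuous, satisfies the equation at this point. -/
theorem classical_of_weak [FiniteDimensional ℝ E] [μ.IsAddHaarMeasure] {U : Set (ℝ × E)}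
    (hU : IsOpen U) {k : ℝ × E → ℂ} (hk : ContDiffOn ℝ 2 k U) {Q : E → ℂ} (hQ : Measurable Q)
    (a c : ℂ) (v : E) {t : ℝ} {p₀ : E} (hp₀ : (t, p₀) ∈ U) (hQ₀ : ContinuousAt Q p₀)
    (h : ∀ N ∈ 𝓝 p₀, ∃ Φ : E → ℝ, (∀ p, 0 ≤ Φ p) ∧ IsTestFunction (fun p => (Φ p : ℂ)) ∧
      tsupport (fun p => (Φ p : ℂ)) ⊆ N ∧ 0 < ∫ p, Φ p ∂μ ∧
      ∃ d, HasDerivAt (fun s => ∫ p, k (s, p) * Φ p ∂μ) d t ∧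
        a * d - ∫ p, k (t, p) *
          (c * fderiv ℝ (fun q => fderiv ℝ (fun p => (Φ p : ℂ)) q v) p v + Q p * Φ p) ∂μ = 0) :
    a * fderiv ℝ k (t, p₀) (1, 0) -
      (c * fderiv ℝ (fun q => fderiv ℝ (fun p => k (t, p)) q v) p₀ v + Q p₀ * k (t, p₀)) = 0 := by
  set W : Set E := (fun p => (t, p)) ⁻¹' U with hWdef
  have hW : IsOpen W := hU.preimage (by fun_prop)
  have hκ : ContDiffOn ℝ 2 (fun p => k (t, p)) W :=
    hk.comp (contDiff_const.prodMk contDiff_id).contDiffOn fun _ hp => hp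
  have hκ2 : ContinuousOn
      (fun p => fderiv ℝ (fun q => fderiv ℝ (fun p => k (t, p)) q v) p v) W := by
    have h1 : ContDiffOn ℝ 1 (fun q => fderiv ℝ (fun p => k (t, p)) q v) W :=
      (hκ.fderiv_of_isOpen hW (by norm_num)).clm_apply contDiffOn_const
    exact (h1.continuousOn_fderiv_of_isOpen hW le_rfl).clm_apply continuousOn_const
  have hkt : ContinuousOn (fun p => fderiv ℝ k (t, p) (1, 0)) W :=
    ((hk.continuousOn_fderiv_of_isOpen hU (by norm_num)).clm_apply continuousOn_const).comp
      (t := U) (by fun_prop) fun _ hp => hp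
  set F : E → ℂ := fun p => a * fderiv ℝ k (t, p) (1, 0) -
    (c * fderiv ℝ (fun q => fderiv ℝ (fun p => k (t, p)) q v) p v + Q p * k (t, p)) with hF
  have hFc : ContinuousAt F p₀ :=
    (continuousAt_const.mul (hkt.continuousAt (hW.mem_nhds hp₀))).sub
      ((continuousAt_const.mul (hκ2.continuousAt (hW.mem_nhds hp₀))).add
        (hQ₀.mul (hκ.continuousOn.continuousAt (hW.mem_nhds hp₀))))
  change F p₀ = 0
  by_contra hne
  have hpos : 0 < ‖F p₀‖ / 2 := half_pos (norm_pos_iff.2 hne)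
  have hN : W ∩ {p | ‖F p - F p₀‖ < ‖F p₀‖ / 2} ∩ {p | ‖Q p‖ < ‖Q p₀‖ + 1} ∈ 𝓝 p₀ := by
    refine inter_mem (inter_mem (hW.mem_nhds hp₀) ?_) ?_
    · have h1 := hFc.eventually (Metric.ball_mem_nhds (F p₀) hpos)
      filter_upwards [h1] with p hp using mem_ball_iff_norm.1 hp
    · exact hQ₀.norm.eventually_lt_const (lt_add_one _)
  obtain ⟨Φ, hΦ0, hΦ, hsupp, hint, d, hd, heq⟩ := h _ hN
  have hsW : tsupport (fun p => (Φ p : ℂ)) ⊆ W := fun p hp => (hsupp hp).1.1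
  have hd' := hd.unique (hasDerivAt_integral_mul_testFunction (μ := μ) hU (hk.of_le (by norm_num))
    hΦ hsW)
  -- The potential is bounded on the support of the test function.
  have hi1 : Integrable (fun p => fderiv ℝ k (t, p) (1, 0) * (Φ p : ℂ)) μ :=
    integrable_mul_of_tsupport_subset hW hkt hΦ hsW
  have hi2 : Integrable (fun p => fderiv ℝ (fun q => fderiv ℝ (fun p => k (t, p)) q v) p v *
      (Φ p : ℂ)) μ := integrable_mul_of_tsupport_subset hW hκ2 hΦ hsW
  have hi2' : Integrable (fun p => k (t, p) *
      fderiv ℝ (fun q => fderiv ℝ (fun p => (Φ p : ℂ)) q v) p v) μ :=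
    integrable_mul_of_tsupport_subset hW hκ.continuousOn ((hΦ.fderiv_apply v).fderiv_apply v)
      ((tsupport_fderiv_apply_subset ℝ v).trans ((tsupport_fderiv_apply_subset ℝ v).trans hsW))
  have hi0 : Integrable (fun p => k (t, p) * (Φ p : ℂ)) μ :=
    integrable_mul_of_tsupport_subset hW hκ.continuousOn hΦ hsW
  have hi3 : Integrable (fun p => Q p * (k (t, p) * (Φ p : ℂ))) μ := by
    refine (hi0.norm.const_mul (‖Q p₀‖ + 1)).mono'
      (hQ.aestronglyMeasurable.mul hi0.aestronglyMeasurable) (Eventually.of_forall fun p => ?_)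
    by_cases hp : p ∈ tsupport (fun p => (Φ p : ℂ))
    · rw [norm_mul]
      exact mul_le_mul_of_nonneg_right (hsupp hp).2.le (norm_nonneg _)
    · have : (Φ p : ℂ) = 0 := image_eq_zero_of_notMem_tsupport (f := fun p => (Φ p : ℂ)) hp
      simp [this]
  have hFint : ∫ p, F p * Φ p ∂μ = 0 := by
    have h1 : ∀ p, F p * Φ p = a * (fderiv ℝ k (t, p) (1, 0) * (Φ p : ℂ)) -
        (c * (fderiv ℝ (fun q => fderiv ℝ (fun p => k (t, p)) q v) p v * (Φ p : ℂ)) +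
          Q p * (k (t, p) * (Φ p : ℂ))) := by
      intro p
      rw [hF]
      ring
    have h2 : ∀ p, k (t, p) *
        (c * fderiv ℝ (fun q => fderiv ℝ (fun p => (Φ p : ℂ)) q v) p v + Q p * Φ p) =
        c * (k (t, p) * fderiv ℝ (fun q => fderiv ℝ (fun p => (Φ p : ℂ)) q v) p v) +
          Q p * (k (t, p) * (Φ p : ℂ)) := by
      intro p
      ring
    simp only [h2] at heq
    rw [integral_add (hi2'.const_mul c) hi3, integral_const_mul,
      integral_mul_fderiv_fderiv hW hκ hΦ hsW, hd'] at heq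
    have h3 : Integrable (fun p => c * (fderiv ℝ (fun q => fderiv ℝ (fun p => k (t, p)) q v) p v *
        (Φ p : ℂ)) + Q p * (k (t, p) * (Φ p : ℂ))) μ := (hi2.const_mul c).add hi3
    simp only [h1]
    rw [integral_sub (hi1.const_mul a) h3, integral_add (hi2.const_mul c) hi3,
      integral_const_mul, integral_const_mul]
    exact heq
  have hiΦ : Integrable Φ μ := by
    have := (hΦ.1.continuous.integrable_of_hasCompactSupport hΦ.2 (μ := μ)).re
    simpa using this
  have hiF : Integrable (fun p => F p * (Φ p : ℂ)) μ := by
    refine (((hi1.const_mul a).sub ((hi2.const_mul c).add hi3))).congr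
      (Eventually.of_forall fun p => ?_)
    simp only [hF, Pi.sub_apply, Pi.add_apply]
    ring
  -- On the support, `F` is close to `F p₀`, so its average against `Φ` cannot vanish.
  have h1 : ‖∫ p, (F p - F p₀) * Φ p ∂μ‖ ≤ ‖F p₀‖ / 2 * ∫ p, Φ p ∂μ := by
    rw [← integral_const_mul]
    refine norm_integral_le_of_norm_le (hiΦ.const_mul _) (Eventually.of_forall fun p => ?_)
    by_cases hp : p ∈ tsupport (fun p => (Φ p : ℂ))
    · rw [norm_mul, Complex.norm_real, Real.norm_of_nonneg (hΦ0 p)]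
      exact mul_le_mul_of_nonneg_right (hsupp hp).1.2.le (hΦ0 p)
    · have : (Φ p : ℂ) = 0 := image_eq_zero_of_notMem_tsupport (f := fun p => (Φ p : ℂ)) hp
      rw [this, mul_zero, norm_zero]
      exact mul_nonneg hpos.le (hΦ0 p)
  have h2 : ∫ p, (F p - F p₀) * Φ p ∂μ = -(F p₀ * (∫ p, Φ p ∂μ : ℝ)) := by
    have h3 : Integrable (fun p => F p₀ * (Φ p : ℂ)) μ := hiΦ.ofReal.const_mul _
    simp only [sub_mul]
    rw [integral_sub hiF h3, hFint, integral_const_mul, zero_sub, integral_complex_ofReal]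
  rw [h2, norm_neg, norm_mul, Complex.norm_real, Real.norm_of_nonneg hint.le] at h1
  nlinarith

end Classical

/-! ### Classical solutions given by the propagator and by wavefunctions -/

section Representatives

variable {m ħ : ℝ} {V : ℝ → ℝ} {hV : Measurable V} {U : ℝ → L2 →L[ℂ] L2}

theorem exists_bump (x : ℝ) {r : ℝ} (hr : 0 < r) : ∃ φ : ℝ → ℝ, (∀ z, 0 ≤ φ z) ∧
    IsTestFunction (fun z => (φ z : ℂ)) ∧
    tsupport (fun z => (φ z : ℂ)) ⊆ Metric.closedBall x r ∧ 0 < ∫ z, φ z := by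
  let b : ContDiffBump x := ⟨r / 2, r, half_pos hr, half_lt_self hr⟩
  refine ⟨b, fun z => b.nonneg, ⟨Complex.ofRealCLM.contDiff.comp b.contDiff,
    b.hasCompactSupport.comp_left (g := fun r : ℝ => (r : ℂ)) (by simp)⟩, ?_, b.integral_pos⟩
  exact (tsupport_comp_subset (g := fun r : ℝ => (r : ℂ)) (by simp) b).trans b.tsupport_eq.subset

theorem tsupport_mul_prod_subset (φ χ : ℝ → ℂ) :
    tsupport (fun p : ℝ × ℝ => φ p.1 * χ p.2) ⊆ tsupport φ ×ˢ tsupport χ := by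
  refine closure_minimal (fun p hp => ?_)
    ((isClosed_tsupport φ).prod (isClosed_tsupport χ))
  exact ⟨subset_tsupport _ (left_ne_zero_of_mul hp), subset_tsupport _ (right_ne_zero_of_mul hp)⟩

theorem IsTestFunction.mul_prod {φ χ : ℝ → ℂ} (hφ : IsTestFunction φ) (hχ : IsTestFunction χ) :
    IsTestFunction fun p : ℝ × ℝ => φ p.1 * χ p.2 :=
  ⟨(hφ.1.comp contDiff_fst).mul (hχ.1.comp contDiff_snd),
    (hφ.2.isCompact.prod hχ.2.isCompact).of_isClosed_subset (isClosed_tsupport _)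
      (tsupport_mul_prod_subset φ χ)⟩

theorem iteratedDeriv_two_eq_fderiv (φ : ℝ → ℂ) (x : ℝ) :
    iteratedDeriv 2 φ x = fderiv ℝ (fun z => fderiv ℝ φ z 1) x 1 := by
  rw [iteratedDeriv_succ, iteratedDeriv_one]
  rfl

theorem deriv_fst_eq_fderiv {E : Type*} [NormedAddCommGroup E] [NormedSpace ℝ E]
    {k : ℝ × E → ℂ} {t : ℝ} {p : E} (hk : DifferentiableAt ℝ k (t, p)) :
    deriv (fun s => k (s, p)) t = fderiv ℝ k (t, p) (1, 0) :=
  (hk.hasFDerivAt.comp_hasDerivAt t ((hasDerivAt_id t).prodMk (hasDerivAt_const t p))).deriv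

/-- A wavefunction satisfies the equation pointwise where it is twice continuously
differentiable and the potential is continuous. -/
theorem IsEvolution.wavefunction_classical (hU : IsEvolution m ħ hV U) (hm : 0 < m) (hħ : 0 < ħ)
    (hV2 : LocallyIntegrable (fun x => V x ^ 2) (volume : Measure ℝ)) {ti : ℝ} {f : ℝ → ℂ}
    (hf : MemLp f 2 volume) {ψ : ℝ → ℝ → ℂ} (hψ : IsWavefunction m ħ V ti f ψ) {S : Set (ℝ × ℝ)}
    (hS : IsOpen S) (hSt : ∀ p ∈ S, ti < p.1)
    (hψS : ContDiffOn ℝ 2 (fun p : ℝ × ℝ => ψ p.1 p.2) S) {t x : ℝ} (htx : (t, x) ∈ S)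
    (hVx : ContinuousAt V x) :
    I * ħ * deriv (fun s => ψ s x) t - hamiltonian m ħ V (ψ t) x = 0 := by
  have hkey := classical_of_weak (μ := volume) hS hψS (Q := fun x => (V x : ℂ))
    (Complex.measurable_ofReal.comp hV) (I * ħ) (-((ħ : ℂ) ^ 2 / (2 * m))) 1 htx
    (Complex.continuous_ofReal.continuousAt.comp hVx) (fun N hN => by
      obtain ⟨r, hr, hrN⟩ := Metric.nhds_basis_closedBall.mem_iff.1 hN
      obtain ⟨φ, h0, hφ, hsupp, hpos⟩ := exists_bump x hr
      obtain ⟨d, hd, heq⟩ := hU.wavefunction_equation hm hħ hV2 hf hψ (hSt _ htx) hφ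
      refine ⟨φ, h0, hφ, hsupp.trans hrN, hpos, d, ?_, ?_⟩
      · simpa only [mul_comm] using hd
      · simpa only [mul_comm (ψ t _), hamiltonian, iteratedDeriv_two_eq_fderiv] using heq)
  rw [hamiltonian, iteratedDeriv_two_eq_fderiv]
  rw [← deriv_fst_eq_fderiv ((hψS.differentiableOn two_ne_zero).differentiableAt
    (hS.mem_nhds htx))] at hkey
  exact hkey

/-- Where the propagator is given by a continuous function `κ`, the state evolving from `χ` is
`∫ κ(·, y) χ(y) dy`, so that `κ` also represents the propagator on products `g ⊗ χ` with `g` merely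
square-integrable. -/
theorem IsEvolution.propagator_mul_eq (hU : IsEvolution m ħ hV U) (hm : 0 < m) (hħ : 0 < ħ)
    {ti t : ℝ} (ht : ti < t) {W : Set (ℝ × ℝ)} {κ : ℝ × ℝ → ℂ} (hκ : ContinuousOn κ W)
    (h : ∀ Φ : ℝ × ℝ → ℂ, IsTestFunction Φ → tsupport Φ ⊆ W →
      propagator m ħ V ti t Φ = ∫ p, κ p * Φ p)
    {J L : Set ℝ} (hJ : IsOpen J) (hJL : closure J ×ˢ L ⊆ W) (hJc : IsCompact (closure J))
    (hL : IsCompact L) {χ : ℝ → ℂ} (hχ : IsTestFunction χ) (hχL : tsupport χ ⊆ L) {g : ℝ → ℂ}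
    (hg : MemLp g 2 volume) (hg1 : Integrable g) (hgJ : ∀ x, x ∉ J → g x = 0) :
    propagator m ħ V ti t (fun p => g p.1 * χ p.2) = ∫ p : ℝ × ℝ, κ p * (g p.1 * χ p.2) := by
  have hS : MeasurableSet (closure J ×ˢ L) := (hJc.prod hL).measurableSet
  set q : ℝ × ℝ → ℂ := (closure J ×ˢ L).indicator fun p => κ p * χ p.2 with hq
  have hcont : ContinuousOn (fun p : ℝ × ℝ => κ p * χ p.2) (closure J ×ˢ L) :=
    (hκ.mono hJL).mul (hχ.1.continuous.comp continuous_snd).continuousOn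
  have hqint : Integrable q (volume.prod volume) :=
    (integrable_indicator_iff hS).2 (hcont.integrableOn_compact (hJc.prod hL))
  obtain ⟨C, hC⟩ := (hJc.prod hL).exists_bound_of_continuousOn hcont
  -- On functions `g` vanishing outside `J`, the pairing with `κ` only involves `q`.
  have hpair : ∀ g : ℝ → ℂ, Integrable g → (∀ x, x ∉ J → g x = 0) →
      ∫ p : ℝ × ℝ, κ p * (g p.1 * χ p.2) = ∫ x, g x * ∫ y, q (x, y) := by
    intro g hg hgJ
    have h1 : (fun p : ℝ × ℝ => κ p * (g p.1 * χ p.2)) = fun p => g p.1 * q p := by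
      funext p
      by_cases hp : p ∈ closure J ×ˢ L
      · rw [hq, indicator_of_mem hp]
        ring
      · rw [hq, indicator_of_notMem hp]
        by_cases hpJ : p.1 ∈ J
        · have : χ p.2 = 0 := image_eq_zero_of_notMem_tsupport fun h =>
            hp ⟨subset_closure hpJ, hχL h⟩
          simp [this]
        · simp [hgJ _ hpJ]
    have h2 : Integrable (fun p : ℝ × ℝ => g p.1 * q p) (volume.prod volume) := by
      have h3 : Integrable (fun p : ℝ × ℝ => ‖g p.1‖ * L.indicator (fun _ => C) p.2)
          (volume.prod volume) := hg.norm.mul_prod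
        ((integrable_indicator_iff hL.measurableSet).2 (integrableOn_const hL.measure_lt_top.ne))
      refine h3.mono' (hg.aestronglyMeasurable.comp_fst.mul hqint.aestronglyMeasurable)
        (Eventually.of_forall fun p => ?_)
      rw [norm_mul]
      by_cases hp : p ∈ closure J ×ˢ L
      · rw [hq, indicator_of_mem hp, indicator_of_mem hp.2]
        exact mul_le_mul_of_nonneg_left (hC p hp) (norm_nonneg _)
      · by_cases hpJ : p.1 ∈ J
        · have hp2 : p.2 ∉ L := fun h => hp ⟨subset_closure hpJ, h⟩
          rw [hq, indicator_of_notMem hp, indicator_of_notMem hp2]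
          simp
        · simp [hgJ _ hpJ]
    rw [h1, Measure.volume_eq_prod, integral_prod _ h2]
    simp only [integral_const_mul]
  have hprop : ∀ {g : ℝ → ℂ} (hg : MemLp g 2 volume), Integrable g →
      propagator m ħ V ti t (fun p => g p.1 * χ p.2) =
        ∫ x, g x * U (t - ti) (hχ.memLp 2).toLp x := by
    intro g hg hg1
    rw [(hU.hasPathIntegral_mul hm hħ ht hg hg1 (hχ.memLp 2)
      (memLp_one_iff_integrable.1 (hχ.memLp 1))).propagator_eq]
    exact inner_conj_toLp_eq_integral hg (ae_eq_refl _)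
  have hu : LocallyIntegrable (U (t - ti) (hχ.memLp 2).toLp) :=
    (Lp.memLp _).locallyIntegrable one_le_two
  have hw : LocallyIntegrable fun x => ∫ y, q (x, y) := hqint.integral_prod_left.locallyIntegrable
  have hae := hJ.ae_eq_zero_of_integral_contDiff_smul_eq_zero (μ := volume)
    ((hu.sub hw).locallyIntegrableOn J) (fun g hgc hgs hgJ => by
      have hφ : IsTestFunction fun x => (g x : ℂ) :=
        ⟨Complex.ofRealCLM.contDiff.comp hgc, hgs.comp_left (g := fun r : ℝ => (r : ℂ)) (by simp)⟩
      have hφJ : tsupport (fun x => (g x : ℂ)) ⊆ J :=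
        (tsupport_comp_subset (g := fun r : ℝ => (r : ℂ)) (by simp) g).trans hgJ
      have hφ1 : Integrable fun x => (g x : ℂ) := memLp_one_iff_integrable.1 (hφ.memLp 1)
      have hΦ : IsTestFunction fun p : ℝ × ℝ => (g p.1 : ℂ) * χ p.2 := hφ.mul_prod hχ
      have h1 := h _ hΦ ((tsupport_mul_prod_subset _ _).trans
        ((prod_mono (hφJ.trans subset_closure) hχL).trans hJL))
      rw [hprop (hφ.memLp 2) hφ1, hpair _ hφ1 fun x hx =>
        image_eq_zero_of_notMem_tsupport (f := fun x => (g x : ℂ)) fun hx' => hx (hφJ hx')] at h1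
      have hi1 : Integrable fun x => (g x : ℂ) * U (t - ti) (hχ.memLp 2).toLp x :=
        (hu.integrable_smul_left_of_hasCompactSupport hφ.1.continuous hφ.2)
      have hi2 : Integrable fun x => (g x : ℂ) * ∫ y, q (x, y) :=
        (hw.integrable_smul_left_of_hasCompactSupport hφ.1.continuous hφ.2)
      simp only [Pi.sub_apply, Complex.real_smul, mul_sub]
      rw [integral_sub hi1 hi2, h1, sub_self])
  rw [hprop hg hg1, hpair g hg1 hgJ]
  refine integral_congr_ae ?_
  filter_upwards [hae] with x hx
  by_cases hxJ : x ∈ J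
  · rw [sub_eq_zero.1 (hx hxJ)]
  · simp [hgJ x hxJ]

/-- The test functions are products of bumps `φ ⊗ χ`. Since `H φ` is not smooth, the assumption on
the propagator is extended to `H φ ⊗ χ` by `IsEvolution.propagator_mul_eq`. -/
theorem IsEvolution.propagator_classical (hU : IsEvolution m ħ hV U) (hm : 0 < m) (hħ : 0 < ħ)
    (hV2 : LocallyIntegrable (fun x => V x ^ 2) (volume : Measure ℝ)) {ti : ℝ}
    {S : Set (ℝ × ℝ × ℝ)} {k : ℝ × ℝ × ℝ → ℂ} (hS : IsOpen S) (hSt : ∀ p ∈ S, ti < p.1)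
    (hk : ContDiffOn ℝ 2 k S)
    (h : ∀ t, ∀ Φ : ℝ × ℝ → ℂ, IsTestFunction Φ → (∀ p ∈ tsupport Φ, (t, p) ∈ S) →
      propagator m ħ V ti t Φ = ∫ p : ℝ × ℝ, k (t, p) * Φ p) {t x y : ℝ} (hp : (t, x, y) ∈ S)
    (hVx : ContinuousAt V x) :
    I * ħ * deriv (fun s => k (s, x, y)) t - hamiltonian m ħ V (fun z => k (t, z, y)) x = 0 := by
  set W : Set (ℝ × ℝ) := (fun p => (t, p)) ⁻¹' S with hWdef
  have hW : IsOpen W := hS.preimage (by fun_prop)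
  have hκ : ContDiffOn ℝ 2 (fun p => k (t, p)) W :=
    hk.comp (contDiff_const.prodMk contDiff_id).contDiffOn fun _ hp => hp
  have hkey := classical_of_weak (μ := volume) hS hk (Q := fun p : ℝ × ℝ => (V p.1 : ℂ))
    (Complex.measurable_ofReal.comp (hV.comp measurable_fst)) (I * ħ)
    (-((ħ : ℂ) ^ 2 / (2 * m))) (1, 0) hp
    (Complex.continuous_ofReal.continuousAt.comp (ContinuousAt.comp hVx continuousAt_fst))
    (fun N hN => by
      obtain ⟨r, hr, hrN⟩ := Metric.nhds_basis_closedBall.mem_iff.1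
        (inter_mem hN (hW.mem_nhds hp))
      rw [← closedBall_prod_same] at hrN
      obtain ⟨φ, hφ0, hφ, hφs, hφpos⟩ := exists_bump x (half_pos hr)
      obtain ⟨χ, hχ0, hχ, hχs, hχpos⟩ := exists_bump y hr
      have hΦ : IsTestFunction fun p : ℝ × ℝ => (φ p.1 : ℂ) * χ p.2 := hφ.mul_prod hχ
      have hΦs : tsupport (fun p : ℝ × ℝ => (φ p.1 : ℂ) * χ p.2) ⊆ N ∩ W :=
        ((tsupport_mul_prod_subset _ _).trans (prod_mono (hφs.trans
          (Metric.closedBall_subset_closedBall (half_le_self hr.le))) hχs)).trans hrN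
      refine ⟨fun p => φ p.1 * χ p.2, fun p => mul_nonneg (hφ0 _) (hχ0 _), ?_⟩
      simp only [Complex.ofReal_mul]
      obtain ⟨-, -, d, hd, heq⟩ := hU.propagator_equation hm hħ hV2 (hSt _ hp) hΦ
      refine ⟨hΦ, hΦs.trans inter_subset_left, ?_, d, ?_, ?_⟩
      · rw [Measure.volume_eq_prod, integral_prod_mul]
        exact mul_pos hφpos hχpos
      · refine hd.congr_of_eventuallyEq ?_
        obtain ⟨u, w, hu, -, htu, hw, huw⟩ := generalized_tube_lemma isCompact_singleton
          (s := {t}) hΦ.2.isCompact hS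
          (by rintro ⟨s, p⟩ ⟨rfl, h2⟩; exact (hΦs h2).2)
        filter_upwards [hu.mem_nhds (htu rfl)] with s hs
        exact (h s _ hΦ fun p hp => huw ⟨hs, hw hp⟩).symm
      · have hJ : closure (Metric.ball x r) ×ˢ Metric.closedBall y r ⊆ W :=
          (Set.prod_mono Metric.closure_ball_subset_closedBall subset_rfl).trans
            (hrN.trans inter_subset_right)
        have hHs : ∀ z, z ∉ Metric.ball x r → hamiltonian m ħ V (fun z => (φ z : ℂ)) z = 0 := by
          intro z hz
          have h1 : z ∉ tsupport fun z => (φ z : ℂ) := fun h1 =>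
            hz (Metric.closedBall_subset_ball (half_lt_self hr) (hφs h1))
          have h2 : fderiv ℝ (fun z => fderiv ℝ (fun z => (φ z : ℂ)) z 1) z 1 = 0 :=
            image_eq_zero_of_notMem_tsupport
              (f := fun z => fderiv ℝ (fun z => fderiv ℝ (fun z => (φ z : ℂ)) z 1) z 1)
              fun h2 => h1 (tsupport_fderiv_apply_subset ℝ _ (tsupport_fderiv_apply_subset ℝ _ h2))
          rw [hamiltonian, iteratedDeriv_two_eq_fderiv, h2,
            image_eq_zero_of_notMem_tsupport (f := fun z => (φ z : ℂ)) h1]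
          simp
        have hH1 : Integrable (hamiltonian m ħ V fun z => (φ z : ℂ)) := by
          have h1 := integrable_indicator_Icc (memLp_hamiltonian (m := m) (ħ := ħ) hV hV2 hφ)
            (x - r) (x + r)
          rwa [indicator_eq_self.2] at h1
          intro z hz
          by_contra hz'
          exact hz (hHs z fun h2 => hz' (Real.closedBall_eq_Icc ▸ Metric.ball_subset_closedBall h2))
        have hH : hamiltonianFst m ħ V (fun p : ℝ × ℝ => (φ p.1 : ℂ) * χ p.2) =
            fun p => hamiltonian m ħ V (fun z => (φ z : ℂ)) p.1 * χ p.2 := by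
          funext p
          have h1 := congrFun (hamiltonian_smul m ħ V (χ p.2 : ℂ) hφ) p.1
          rw [Pi.smul_apply, smul_eq_mul, mul_comm] at h1
          rw [← h1, hamiltonianFst]
          congr 1
          funext z
          simp [mul_comm]
        have h1 := hU.propagator_mul_eq hm hħ (hSt _ hp) hκ.continuousOn
          (fun Φ hΦ hs => h t Φ hΦ hs)
          Metric.isOpen_ball hJ (((isCompact_closedBall x r)).closure_of_subset
            Metric.ball_subset_closedBall) (isCompact_closedBall y r) hχ hχs
          (memLp_hamiltonian hV hV2 hφ) hH1 hHs
        have h2 : ∫ p : ℝ × ℝ, k (t, p) * (hamiltonian m ħ V (fun z => (φ z : ℂ)) p.1 * χ p.2) =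
            ∫ p, k (t, p) * hamiltonianFst m ħ V (fun p : ℝ × ℝ => (φ p.1 : ℂ) * χ p.2) p := by
          rw [hH]
        rw [hH, h1, h2] at heq
        rw [← heq]
        congr 1
        refine integral_congr_ae (Eventually.of_forall fun p => ?_)
        have h3 := hΦ.iteratedDeriv_two_fst p.1 p.2
        simp only [hamiltonianFst, hamiltonian, h3]
        rfl)
  have hx : ∀ᶠ z in 𝓝 x, (z, y) ∈ W :=
    (Continuous.prodMk_left y).continuousAt.eventually (hW.mem_nhds hp)
  have hline : ∀ {F : ℝ × ℝ → ℂ} {z : ℝ}, DifferentiableAt ℝ F (z, y) →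
      deriv (fun z => F (z, y)) z = fderiv ℝ F (z, y) (1, 0) := fun hF => deriv_fst_eq_fderiv hF
  have h1 : deriv (fun z => k (t, z, y)) =ᶠ[𝓝 x]
      fun z => fderiv ℝ (fun p => k (t, p)) (z, y) (1, 0) := by
    filter_upwards [hx] with z hz
    exact hline (F := fun p => k (t, p))
      ((hκ.differentiableOn two_ne_zero).differentiableAt (hW.mem_nhds hz))
  have hκ' : ContDiffOn ℝ 1 (fun p => fderiv ℝ (fun p => k (t, p)) p (1, 0)) W :=
    (hκ.fderiv_of_isOpen hW (by norm_num)).clm_apply contDiffOn_const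
  have h2 : iteratedDeriv 2 (fun z => k (t, z, y)) x =
      fderiv ℝ (fun p => fderiv ℝ (fun p => k (t, p)) p (1, 0)) (x, y) (1, 0) := by
    rw [iteratedDeriv_succ, iteratedDeriv_one, h1.deriv_eq]
    exact hline (F := fun p => fderiv ℝ (fun p => k (t, p)) p (1, 0))
      ((hκ'.differentiableOn one_ne_zero).differentiableAt (hW.mem_nhds hp))
  rw [hamiltonian, h2]
  rw [← deriv_fst_eq_fderiv ((hk.differentiableOn two_ne_zero).differentiableAt
    (hS.mem_nhds hp))] at hkey
  exact hkey

end Representatives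

end PathIntegral

theorem mainTheorem6 (m ħ : ℝ) (hm : 0 < m) (hħ : 0 < ħ) (V : ℝ → ℝ) (hV : Measurable V)
    (hV2 : LocallyIntegrable (fun x => V x ^ 2) (volume : Measure ℝ))
    (hH : PathIntegral.IsEssentiallySelfAdjoint (PathIntegral.hamiltonianOp m ħ V)) (ti : ℝ) :
    -- the propagator exists as a generalized function and satisfies the equation
    (∀ tf, ti < tf → ∀ Φ : ℝ × ℝ → ℂ, PathIntegral.IsTestFunction Φ →
      PathIntegral.HasPathIntegral m ħ V ti tf Φ (PathIntegral.propagator m ħ V ti tf Φ) ∧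
      PathIntegral.HasPathIntegral m ħ V ti tf (PathIntegral.hamiltonianFst m ħ V Φ)
        (PathIntegral.propagator m ħ V ti tf (PathIntegral.hamiltonianFst m ħ V Φ)) ∧
      ∃ d : ℂ, HasDerivAt (fun t => PathIntegral.propagator m ħ V ti t Φ) d tf ∧
        I * ħ * d -
          PathIntegral.propagator m ħ V ti tf (PathIntegral.hamiltonianFst m ħ V Φ) = 0) ∧
    -- classical form, wherever the propagator is given by a twice differentiable function
    (∀ (U : Set (ℝ × ℝ × ℝ)) (k : ℝ × ℝ × ℝ → ℂ), IsOpen U → (∀ p ∈ U, ti < p.1) →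
      ContDiffOn ℝ 2 k U →
      (∀ t, ∀ Φ : ℝ × ℝ → ℂ, PathIntegral.IsTestFunction Φ →
        (∀ p ∈ tsupport Φ, (t, p) ∈ U) →
        PathIntegral.propagator m ħ V ti t Φ = ∫ p : ℝ × ℝ, k (t, p) * Φ p) →
      ∀ t x y, (t, x, y) ∈ U → ContinuousAt V x →
        I * ħ * deriv (fun s => k (s, x, y)) t -
          PathIntegral.hamiltonian m ħ V (fun z => k (t, z, y)) x = 0) ∧
    -- the wavefunction exists and satisfies the equation, weakly and where possible classically
    (∀ f : ℝ → ℂ, MemLp f 2 (volume : Measure ℝ) →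
      (∃ ψ, PathIntegral.IsWavefunction m ħ V ti f ψ) ∧
      ∀ ψ, PathIntegral.IsWavefunction m ħ V ti f ψ →
        (∀ t, ti < t → ∀ φ : ℝ → ℂ, PathIntegral.IsTestFunction φ →
          ∃ d : ℂ, HasDerivAt (fun s => ∫ x, φ x * ψ s x) d t ∧
            I * ħ * d - ∫ x, PathIntegral.hamiltonian m ħ V φ x * ψ t x = 0) ∧
        (∀ U : Set (ℝ × ℝ), IsOpen U → (∀ p ∈ U, ti < p.1) →
          ContDiffOn ℝ 2 (fun p : ℝ × ℝ => ψ p.1 p.2) U →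
          ∀ t x, (t, x) ∈ U → ContinuousAt V x →
            I * ħ * deriv (fun s => ψ s x) t -
              PathIntegral.hamiltonian m ħ V (ψ t) x = 0)) := by
  obtain ⟨U, hU⟩ := PathIntegral.exists_isEvolution hħ hV hV2 hH
  refine ⟨fun tf ht Φ hΦ => hU.propagator_equation hm hħ hV2 ht hΦ, ?_, fun f hf => ?_⟩
  · intro S k hS hSt hk h t x y hp hVx
    exact hU.propagator_classical hm hħ hV2 hS hSt hk h hp hVx
  · refine ⟨⟨_, hU.isWavefunction hm hħ ti hf⟩, fun ψ hψ => ⟨fun t ht φ hφ => ?_, ?_⟩⟩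
    · exact hU.wavefunction_equation hm hħ hV2 hf hψ ht hφ
    · intro S hS hSt hψS t x hp hVx
      exact hU.wavefunction_classical hm hħ hV2 hf hψ hS hSt hψS hp hVx
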